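/- **Theorem (Phase transition in the high imbalance regime).** Let $a,b,c>0$ be constants with $a-c<1$. For every dimension $d$ let $\pi_d\in(0,1)$, $\mu_d\in\mathbb R^d$ and $n_d\in\mathbb N$ be such that, as $d\to\infty$, $$\pi_d\asymp d^{-a},\qquad \|\mu_d\|_2^2\asymp d^{b},\qquad n_d\asymp d^{c+1}.$$ Let $(x_1,y_1),\dots,(x_{n_d},y_{n_d})$ and a test point $(x_{\rm test},y_{\rm test})$ be i.i.d. from the following mixture: $\mathbb P(y=+1)=1-\mathbb P(y=-1)=\pi_d$ and $x=y\mu_d+z$, where $z\in\mathbb R^d$ is independent of $y$ and has independent (not necessarily identically distributed) coordinates $z_j$ with $\mathbb E z_j=0$, $\operatorname{Var}(z_j)=1$ and $\|z_j\|_{\psi_2}:=\inf\{K>0:\mathbb E\exp(z_j^2/K^2)\le 2\}\le C$, for a constant $C$ that does not depend on $d$ and $j$. For $\tau_d>0$ let $(\hat\beta,\hat\beta_0,\hat\kappa)$ be an optimal solution (depending measurably on the training data) of the margin-rebalanced SVM $$\max_{\beta\in\mathbb R^d,\ \beta_0,\kappa\in\mathbb R}\ \kappa\quad\text{subject to}\quad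 y_i(\langle x_i,\beta\rangle+\beta_0)\ge\tau_d\kappa\ \ (y_i=+1),\quad y_i(\langle x_i,\beta\rangle+\beta_0)\ge\kappa\ \ (y_i=-1),\quad \|\beta\|_2\le 1$$ whenever both labels occur in the training set (if only one label occurs, the problem is unbounded and $(\hat\beta,\hat\beta_0)$ is an arbitrary measurable function of the training data). Put $\hat f(x)=\langle x,\hat\beta\rangle+\hat\beta_0$ and $$\mathrm{Err}_+=\mathbb P(\hat f(x_{\rm test})\le 0\mid y_{\rm test}=+1),\quad \mathrm{Err}_-=\mathbb P(\hat f(x_{\rm test})>0\mid y_{\rm test}=-1),\quad \mathrm{Err}_{\rm b}=\tfrac12\mathrm{Err}_++\tfrac12\mathrm{Err}_-,$$ where the probabilities are over both the training data and the test point. Then, as $d\to\infty$: 1. (High signal) If $a-c<b$ and $1\le\tau_d\ll d^{b/2}$, then $\mathrm{Err}_+=o(1)$ and $\mathrm{Err}_-=o(1)$. 2. (Moderate signal) Let $b<a-c<2b$. If $d^{a-b-c}\ll\tau_d\ll d^{(a-c)/2}$, then $\mathrm{Err}_+=o(1)$ and $\mathrm{Err}_-=o(1)$. If $\tau_d\asymp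 1$, then $\mathrm{Err}_+=1-o(1)$ and $\mathrm{Err}_-=o(1)$. 3. (Low signal) If $a-c>2b$, then for every choice of $\tau_d>0$, $\mathrm{Err}_{\rm b}\ge\frac12-o(1)$. Here $u_d\ll v_d$ means $u_d=o(v_d)$ and $u_d\asymp v_d$ means that $u_d/v_d$ is eventually bounded above and below by positive constants. -/

import Mathlib

open MeasureTheory ProbabilityTheory Filter Asymptotics
open scoped ENNReal NNReal Topology

namespace HighImbalance

/-- A labelled data point `(x, y)`; the label `true` stands for `y = +1` (minority class) and
`false` for `y = -1` (majority class). -/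
abbrev Point (d : ℕ) : Type := EuclideanSpace ℝ (Fin d) × Bool

/-- The numerical value `±1` of a label. -/
def label (y : Bool) : ℝ := if y then 1 else -1

/-! ### The two-component sub-gaussian mixture model -/

/-- The sub-gaussian norm `inf {K > 0 : 𝔼[exp (X² / K²)] ≤ 2}` of a real random variable `X` with
law `ν` (equal to `∞` if there is no such `K`). -/
noncomputable def psi2Norm (ν : Measure ℝ) : ℝ≥0∞ :=
  ⨅ (K : ℝ) (_ : 0 < K ∧ ∫⁻ x, ENNReal.ofReal (Real.exp (x ^ 2 / K ^ 2)) ∂ν ≤ 2), ENNReal.ofReal K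

/-- The laws `ν j` of the coordinates of the noise vector: centred, of unit variance, and of
sub-gaussian norm at most `C`. -/
structure IsSubGaussianNoise {d : ℕ} (C : ℝ≥0) (ν : Fin d → Measure ℝ) : Prop where
  isProbabilityMeasure : ∀ j, IsProbabilityMeasure (ν j)
  mean_eq_zero : ∀ j, ∫ x, x ∂(ν j) = 0
  variance_eq_one : ∀ j, variance (fun x : ℝ => x) (ν j) = 1
  psi2Norm_le : ∀ j, psi2Norm (ν j) ≤ (C : ℝ≥0∞)

/-- The law of a label `y` with `ℙ(y = +1) = π` and `ℙ(y = -1) = 1 - π`. -/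
noncomputable def labelLaw (π : ℝ) : Measure Bool :=
  ENNReal.ofReal π • Measure.dirac true + ENNReal.ofReal (1 - π) • Measure.dirac false

/-- The law of a noise vector `z` in `ℝᵈ` with independent coordinates `z j ∼ ν j`. -/
noncomputable def noiseLaw {d : ℕ} (ν : Fin d → Measure ℝ) : Measure (EuclideanSpace ℝ (Fin d)) :=
  (Measure.pi ν).map (WithLp.toLp 2)

/-- The law of a data point `(x, y)`, where `x = y μ + z` and the label `y` and the noise `z` are
independent. -/
noncomputable def dataLaw {d : ℕ} (π : ℝ) (μ : EuclideanSpace ℝ (Fin d)) (ν : Fin d → Measure ℝ) :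
    Measure (Point d) :=
  ((labelLaw π).prod (noiseLaw ν)).map fun w => (label w.1 • μ + w.2, w.1)

/-- The joint law of `n` i.i.d. training points and of an independent test point. -/
noncomputable def jointLaw {d : ℕ} (n : ℕ) (π : ℝ) (μ : EuclideanSpace ℝ (Fin d))
    (ν : Fin d → Measure ℝ) : Measure ((Fin n → Point d) × Point d) :=
  (Measure.pi fun _ : Fin n => dataLaw π μ ν).prod (dataLaw π μ ν)

/-- The high imbalance regime `π ≍ d ^ (-a)`, `‖μ‖² ≍ d ^ b`, `n ≍ d ^ (c + 1)` as `d → ∞`. -/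
structure IsImbalanced (a b c : ℝ) (π : ℕ → ℝ) (μ : (d : ℕ) → EuclideanSpace ℝ (Fin d))
    (n : ℕ → ℕ) : Prop where
  ratio : π =Θ[atTop] fun d : ℕ => (d : ℝ) ^ (-a)
  signal : (fun d : ℕ => ‖μ d‖ ^ 2) =Θ[atTop] fun d : ℕ => (d : ℝ) ^ b
  sampleSize : (fun d : ℕ => (n d : ℝ)) =Θ[atTop] fun d : ℕ => (d : ℝ) ^ (c + 1)

/-! ### The margin-rebalanced support vector machine -/

/-- The constraints of the margin-rebalanced SVM on the training set `S`. -/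
structure IsFeasible {d n : ℕ} (τ : ℝ) (S : Fin n → Point d) (β : EuclideanSpace ℝ (Fin d))
    (β₀ κ : ℝ) : Prop where
  minority : ∀ i, (S i).2 = true → τ * κ ≤ label (S i).2 * (inner ℝ (S i).1 β + β₀)
  majority : ∀ i, (S i).2 = false → κ ≤ label (S i).2 * (inner ℝ (S i).1 β + β₀)
  norm_le_one : ‖β‖ ≤ 1

/-- `(β, β₀, κ)` is an optimal solution of the margin-rebalanced SVM: it maximizes `κ` under the
constraints. -/
def IsSVMSolution {d n : ℕ} (τ : ℝ) (S : Fin n → Point d) (β : EuclideanSpace ℝ (Fin d))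
    (β₀ κ : ℝ) : Prop :=
  IsFeasible τ S β β₀ κ ∧ ∀ β' β₀' κ', IsFeasible τ S β' β₀' κ' → κ' ≤ κ

/-- A margin-rebalanced SVM as a (measurable) map from training sets to parameters `(β, β₀)`.
If only one class is present, then the margin `κ` is unbounded, there is no optimal solution, and
the parameters are unconstrained. -/
structure IsSVM {d n : ℕ} (τ : ℝ)
    (svm : (Fin n → Point d) → EuclideanSpace ℝ (Fin d) × ℝ) : Prop where
  measurable : Measurable svm
  optimal : ∀ S : Fin n → Point d, (∃ i, (S i).2 = true) → (∃ i, (S i).2 = false) →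
    ∃ κ, IsSVMSolution τ S (svm S).1 (svm S).2 κ

/-- The linear score `⟨x, β⟩ + β₀`. -/
noncomputable def logit {d : ℕ} (θ : EuclideanSpace ℝ (Fin d) × ℝ) (x : EuclideanSpace ℝ (Fin d)) :
    ℝ :=
  inner ℝ x θ.1 + θ.2

/-! ### Test errors (the probabilities are over the training set and the test point) -/

/-- Minority error `ℙ(f(x_test) ≤ 0 | y_test = +1)`. -/
noncomputable def errPlus {d n : ℕ} (π : ℝ) (μ : EuclideanSpace ℝ (Fin d)) (ν : Fin d → Measure ℝ)
    (svm : (Fin n → Point d) → EuclideanSpace ℝ (Fin d) × ℝ) : ℝ :=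
  (cond (jointLaw n π μ ν) {w | w.2.2 = true}).real {w | logit (svm w.1) w.2.1 ≤ 0}

/-- Majority error `ℙ(f(x_test) > 0 | y_test = -1)`. -/
noncomputable def errMinus {d n : ℕ} (π : ℝ) (μ : EuclideanSpace ℝ (Fin d)) (ν : Fin d → Measure ℝ)
    (svm : (Fin n → Point d) → EuclideanSpace ℝ (Fin d) × ℝ) : ℝ :=
  (cond (jointLaw n π μ ν) {w | w.2.2 = false}).real {w | 0 < logit (svm w.1) w.2.1}

/-- Balanced error. -/
noncomputable def errBal {d n : ℕ} (π : ℝ) (μ : EuclideanSpace ℝ (Fin d)) (ν : Fin d → Measure ℝ)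
    (svm : (Fin n → Point d) → EuclideanSpace ℝ (Fin d) × ℝ) : ℝ :=
  1 / 2 * errPlus π μ ν svm + 1 / 2 * errMinus π μ ν svm

end HighImbalance

/-! Write `S` for the sum of the `N` minority noise vectors, `H` for the sum of the vectors `2 μ + Z
i` over the minority class, and `L = √(d / (n π))`. The count `N` concentrates around `n π`, which
tends to infinity because `a - c < 1`. Hence the minority noise average has norm of order `L ≍ d ^
((a - c) / 2)`. The majority noise average has norm of order `√(d / n)`, which tends to zero, so it
costs at most the constant `1`.

Averaging the constraints over a class removes the individual points. The majority gives `β₀ ≤ ⟨μ,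
β⟩ - κ + 1` and the minority gives `β₀ ≥ τ κ - ⟨μ, β⟩ - ‖S‖ / N`. Conversely, if a direction in the
unit ball separates the classes by `g`, then `(1 + τ) κ ≥ g` (`IsSVMSolution.le_gap`). Up to the
component of the test noise along `β`, which is bounded in probability, these facts control the
scores at `±μ + z`.

High signal: the direction `μ / ‖μ‖` gives `g ≈ 2 ‖μ‖`. Then `κ` is large since `τ ≪ ‖μ‖`, and `τ κ`
is at least about `‖μ‖ ≫ L` since `τ ≥ 1`.

Weak signal, `b < a - c`: the minority noise vectors are nearly orthogonal with squared norm near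
`d`. The direction `H / ‖H‖` therefore makes all minority margins almost equal and gives `g ≥ ‖H‖ /
N - 31 t` with `t = d ^ ε`. Here `‖H‖ / N` is of order `L`. If `τ ≪ L`, then `κ` is large and the
majority error vanishes. If `τ ≍ 1`, then `κ` is of order `L ≫ ‖μ‖`, and minority test points fall
on the wrong side. For the minority error to vanish one compares `g` with `‖S‖ / N`: `‖H‖ ^ 2 - ‖S‖
^ 2` is of order `N ^ 2 ‖μ‖ ^ 2`, so the signal gains a multiple of `‖μ‖ ^ 2 / L`. This gain beats
`t` when `a - c < 2 b`, and beats the loss `L / τ` exactly when `τ ≫ d ^ (a - b - c)`.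

Low signal: no choice of `τ` helps. The margin bounds force `β` to be close to `H / ‖H‖`, whence
`⟨μ, β⟩` is bounded, and also close to `S / ‖S‖`. A positive proportion of the majority points has
component at least `K` along `S`; averaging the majority constraints over these points alone lowers
the intercept by `K` up to a bounded error. As `K` is an arbitrary constant, the minority score is
negative with probability tending to one. The proportion comes from a tail lower bound for
delocalized linear forms of non-Gaussian noise (`exists_pos_le_measureReal_inner`), proved by
reweighting the noise with a signed product weight. -/

namespace HighImbalance

/-! ### Sub-gaussian random variables -/

/-- For a centred variable the linear term integrates to zero, so an exponential moment is
controlled by that of the square. -/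
lemma exp_le_add_exp_sq (x : ℝ) : Real.exp x ≤ x + Real.exp (x ^ 2) := by
  have h1 : x ^ 2 + 1 ≤ Real.exp (x ^ 2) := Real.add_one_le_exp _
  rcases le_total 1 x with hx | hx
  · have : Real.exp x ≤ Real.exp (x ^ 2) := Real.exp_le_exp.2 (by nlinarith)
    linarith
  · rcases le_total (-1) x with hx' | hx'
    · have := (abs_le.1 (Real.abs_exp_sub_one_sub_id_le (abs_le.2 ⟨hx', hx⟩))).2
      linarith
    · have : Real.exp x ≤ 1 := Real.exp_le_one_iff.2 (by linarith)
      nlinarith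

/-- The variance proxy of a centred random variable of sub-gaussian norm at most `C`. -/
noncomputable def varianceProxy (C : ℝ≥0) : ℝ≥0 := 2 * (C + 1) ^ 2

lemma varianceProxy_pos (C : ℝ≥0) : 0 < varianceProxy C := by
  unfold varianceProxy; positivity

/-- Enlarging `C` to `C + 1` makes the inequality strict, so that an admissible `K` below it exists
without knowing that the infimum is attained. It also keeps the scale positive when `C = 0`. -/
lemma lintegral_exp_le_of_psi2Norm_le {C : ℝ≥0} {ν : Measure ℝ} (h : psi2Norm ν ≤ C) :
    ∫⁻ x, ENNReal.ofReal (Real.exp (x ^ 2 / ((C : ℝ) + 1) ^ 2)) ∂ν ≤ 2 := by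
  have hlt : psi2Norm ν < ENNReal.ofReal ((C : ℝ) + 1) := by
    refine h.trans_lt ?_
    rw [← ENNReal.ofReal_coe_nnreal]
    exact (ENNReal.ofReal_lt_ofReal_iff (by positivity)).2 (by linarith)
  unfold psi2Norm at hlt
  simp only [iInf_lt_iff] at hlt
  obtain ⟨K, ⟨hK, hK2⟩, hlt⟩ := hlt
  have hKC : K < (C : ℝ) + 1 := (ENNReal.ofReal_lt_ofReal_iff (by positivity)).1 hlt
  refine le_trans (lintegral_mono fun x => ?_) hK2
  apply ENNReal.ofReal_le_ofReal
  apply Real.exp_le_exp.2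
  gcongr

lemma integrable_exp_sq_of_psi2Norm_le {C : ℝ≥0} {ν : Measure ℝ} (h : psi2Norm ν ≤ C) :
    Integrable (fun x : ℝ => Real.exp (x ^ 2 / ((C : ℝ) + 1) ^ 2)) ν := by
  refine ⟨by fun_prop, ?_⟩
  rw [hasFiniteIntegral_iff_ofReal (Eventually.of_forall fun x => (Real.exp_pos _).le)]
  exact (lintegral_exp_le_of_psi2Norm_le h).trans_lt (by simp)

lemma integral_exp_sq_le_of_psi2Norm_le {C : ℝ≥0} {ν : Measure ℝ} (h : psi2Norm ν ≤ C) :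
    ∫ x, Real.exp (x ^ 2 / ((C : ℝ) + 1) ^ 2) ∂ν ≤ 2 := by
  rw [integral_eq_lintegral_of_nonneg_ae (Eventually.of_forall fun x => (Real.exp_pos _).le)
    (by fun_prop)]
  exact ENNReal.toReal_le_of_le_ofReal (by norm_num)
    (by simpa using lintegral_exp_le_of_psi2Norm_le h)

lemma exp_mul_le_one_sub_add {s : ℝ} (hs0 : 0 ≤ s) (hs1 : s ≤ 1) (y : ℝ) :
    Real.exp (s * y) ≤ 1 - s + s * Real.exp y := by
  have := convexOn_exp.2 (Set.mem_univ (0 : ℝ)) (Set.mem_univ y) (sub_nonneg.2 hs1) hs0 (by ring)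
  simpa using this

/-- With `B = C + 1` and `s = t ^ 2 * B ^ 2` the target is `exp s`. For `s ≤ 1`, centring removes
the linear term and convexity of `exp` yields `1 + s`. For `s ≥ 1`, centring is not needed: `t x ≤ s
/ 2 + (x / B) ^ 2 / 2`, and the remaining factor is at most `3 / 2 ≤ 1 + s / 2`. -/
lemma hasSubgaussianMGF_of_psi2Norm_le {C : ℝ≥0} {ν : Measure ℝ} [IsProbabilityMeasure ν]
    (h : psi2Norm ν ≤ C) (hmean : ∫ x, x ∂ν = 0) :
    HasSubgaussianMGF (fun x : ℝ => x) (varianceProxy C) ν := by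
  set B : ℝ := (C : ℝ) + 1 with hB
  have hBpos : 0 < B := by positivity
  have hint := integrable_exp_sq_of_psi2Norm_le h
  have hle := integral_exp_sq_le_of_psi2Norm_le h
  rw [← hB] at hint hle
  have key : ∀ t x : ℝ, Real.exp (t * x) ≤
      Real.exp (t ^ 2 * B ^ 2 / 2) * Real.exp (x ^ 2 / B ^ 2) := by
    intro t x
    rw [← Real.exp_add]
    apply Real.exp_le_exp.2
    have h1 : t * x = (t * B) * (x / B) := by field_simp
    have h2 : x ^ 2 / B ^ 2 = (x / B) ^ 2 := by rw [div_pow]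
    rw [h1, h2]
    nlinarith [sq_nonneg (t * B - x / B), sq_nonneg (x / B)]
  have hint_exp : ∀ t : ℝ, Integrable (fun x : ℝ => Real.exp (t * x)) ν := fun t =>
    (hint.const_mul (Real.exp (t ^ 2 * B ^ 2 / 2))).mono' (by fun_prop)
      (Eventually.of_forall fun x => by
        rw [Real.norm_of_nonneg (Real.exp_pos _).le]; exact key t x)
  have hint_id : Integrable (fun x : ℝ => x) ν := by
    refine ((hint_exp 1).add (hint_exp (-1))).mono' (by fun_prop)
      (Eventually.of_forall fun x => ?_)
    have h1 := Real.add_one_le_exp x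
    have h2 := Real.add_one_le_exp (-x)
    have h3 := Real.exp_pos x
    have h4 := Real.exp_pos (-x)
    simp only [Pi.add_apply, one_mul, neg_mul, Real.norm_eq_abs]
    exact abs_le.2 ⟨by linarith, by linarith⟩
  refine ⟨hint_exp, fun t => ?_⟩
  have hcoe : ((varianceProxy C : ℝ≥0) : ℝ) * t ^ 2 / 2 = t ^ 2 * B ^ 2 := by
    simp only [varianceProxy, NNReal.coe_mul, NNReal.coe_pow, NNReal.coe_add, NNReal.coe_one,
      NNReal.coe_ofNat, hB]
    ring
  rw [hcoe, mgf]
  set s := t ^ 2 * B ^ 2 with hs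
  have hs0 : 0 ≤ s := by positivity
  rcases le_total s 1 with hs1 | hs1
  · have hpt : ∀ x : ℝ, Real.exp (t * x) ≤ t * x + (1 - s + s * Real.exp (x ^ 2 / B ^ 2)) := by
      intro x
      refine (exp_le_add_exp_sq _).trans ?_
      have := exp_mul_le_one_sub_add hs0 hs1 (x ^ 2 / B ^ 2)
      have heq : s * (x ^ 2 / B ^ 2) = (t * x) ^ 2 := by rw [hs]; field_simp
      rw [heq] at this
      linarith
    calc ∫ x, Real.exp (t * x) ∂ν
        ≤ ∫ x, (t * x + (1 - s + s * Real.exp (x ^ 2 / B ^ 2))) ∂ν :=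
          integral_mono (hint_exp t) ((hint_id.const_mul t).add
            ((integrable_const _).add (hint.const_mul s))) hpt
      _ = 1 - s + s * ∫ x, Real.exp (x ^ 2 / B ^ 2) ∂ν := by
          rw [integral_add (hint_id.const_mul t)
              (g := fun x => 1 - s + s * Real.exp (x ^ 2 / B ^ 2))
              ((integrable_const _).add (hint.const_mul s)),
            integral_add (integrable_const _) (hint.const_mul s), integral_const_mul,
            integral_const_mul, hmean]
          simp
      _ ≤ s + 1 := by nlinarith
      _ ≤ Real.exp s := Real.add_one_le_exp s
  · have hpt : ∀ x : ℝ, Real.exp (t * x) ≤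
        Real.exp (s / 2) * (1 - 1 / 2 + 1 / 2 * Real.exp (x ^ 2 / B ^ 2)) := by
      intro x
      have h0 := exp_mul_le_one_sub_add (s := 1 / 2) (by norm_num) (by norm_num) (x ^ 2 / B ^ 2)
      refine le_trans ?_ (mul_le_mul_of_nonneg_left h0 (Real.exp_pos _).le)
      rw [← Real.exp_add]
      apply Real.exp_le_exp.2
      have h1 : t * x = (t * B) * (x / B) := by field_simp
      have h2 : x ^ 2 / B ^ 2 = (x / B) ^ 2 := by rw [div_pow]
      rw [h1, h2, hs]
      nlinarith [sq_nonneg (t * B - x / B)]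
    calc ∫ x, Real.exp (t * x) ∂ν
        ≤ ∫ x, Real.exp (s / 2) * (1 - 1 / 2 + 1 / 2 * Real.exp (x ^ 2 / B ^ 2)) ∂ν :=
          integral_mono (hint_exp t) (((integrable_const _).add
            (hint.const_mul _)).const_mul _) hpt
      _ = Real.exp (s / 2) * (1 - 1 / 2 + 1 / 2 * ∫ x, Real.exp (x ^ 2 / B ^ 2) ∂ν) := by
          rw [integral_const_mul, integral_add (integrable_const _) (hint.const_mul _),
            integral_const_mul]
          simp
      _ ≤ Real.exp (s / 2) * (s / 2 + 1) :=
          mul_le_mul_of_nonneg_left (by linarith) (Real.exp_pos _).le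
      _ ≤ Real.exp (s / 2) * Real.exp (s / 2) := by gcongr; exact Real.add_one_le_exp _
      _ = Real.exp s := by rw [← Real.exp_add]; ring_nf

/-! ### Moments and tails of a single sub-gaussian variable. -/

section SubGaussian

variable {Ω : Type*} {mΩ : MeasurableSpace Ω} {P : Measure Ω} [IsProbabilityMeasure P]
  {X : Ω → ℝ} {v : ℝ≥0}

lemma pow_four_le_exp_add_exp (x : ℝ) : x ^ 4 ≤ 24 * (Real.exp x + Real.exp (-x)) := by
  rcases le_total 0 x with hx | hx
  · have := Real.pow_div_factorial_le_exp x hx 4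
    have h2 := Real.exp_pos (-x)
    norm_num [Nat.factorial] at this
    linarith
  · have := Real.pow_div_factorial_le_exp (-x) (by linarith) 4
    have h2 := Real.exp_pos x
    norm_num [Nat.factorial] at this
    have h3 : (-x) ^ 4 = x ^ 4 := by ring
    linarith

lemma _root_.ProbabilityTheory.HasSubgaussianMGF.integrable_pow
    (h : HasSubgaussianMGF X v P) (k : ℕ) : Integrable (fun ω => X ω ^ k) P := by
  have := (h.memLp k).integrable_norm_pow'
  exact (integrable_norm_iff (h.aestronglyMeasurable.pow k)).1 (by simpa using this)

/-- At the scale `1 / √v` both exponential moments are at most `√e ≤ 2`, and `x ^ 4 ≤ 24 (exp x +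
exp (-x))` gives `24 * 4 = 96`. -/
lemma integral_pow_four_le (h : HasSubgaussianMGF X v P) : ∫ ω, X ω ^ 4 ∂P ≤ 96 * v ^ 2 := by
  rcases eq_or_lt_of_le (zero_le (a := v)) with rfl | hv
  · have h0 := h.ae_eq_zero_of_hasSubgaussianMGF_zero
    rw [integral_congr_ae (g := fun _ => (0 : ℝ)) (h0.mono fun ω hω => by simp [hω])]
    simp
  have hv' : (0 : ℝ) < v := hv
  set l : ℝ := 1 / Real.sqrt v with hl
  have hl2 : (v : ℝ) * l ^ 2 = 1 := by
    rw [hl, div_pow, Real.sq_sqrt hv'.le]; field_simp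
  have h1 : ∀ t : ℝ, t ^ 2 = l ^ 2 → ∫ ω, Real.exp (t * X ω) ∂P ≤ 2 := by
    intro t ht
    refine (h.mgf_le t).trans ?_
    rw [ht, hl2]
    have := Real.exp_one_lt_d9
    have h2 : Real.exp (1 / 2) ^ 2 = Real.exp 1 := by rw [← Real.exp_nat_mul]; norm_num
    nlinarith [Real.exp_pos (1 / 2 : ℝ)]
  have h2 : ∫ ω, (l * X ω) ^ 4 ∂P ≤ 96 := by
    calc ∫ ω, (l * X ω) ^ 4 ∂P
        ≤ ∫ ω, 24 * (Real.exp (l * X ω) + Real.exp (-l * X ω)) ∂P := by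
          refine integral_mono ?_ (((h.integrable_exp_mul l).add
            (h.integrable_exp_mul (-l))).const_mul 24) fun ω => ?_
          · simp_rw [mul_pow]; exact (h.integrable_pow 4).const_mul _
          · have := pow_four_le_exp_add_exp (l * X ω)
            simpa [neg_mul] using this
      _ ≤ 96 := by
          rw [integral_const_mul, integral_add (h.integrable_exp_mul l)
            (h.integrable_exp_mul (-l))]
          have := h1 l rfl
          have := h1 (-l) (by ring)
          linarith
  simp_rw [mul_pow] at h2
  rw [integral_const_mul] at h2
  have h3 : ((v : ℝ) * l ^ 2) ^ 2 = 1 := by rw [hl2]; norm_num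
  have h4 : (v : ℝ) ^ 2 * (l ^ 4 * ∫ ω, X ω ^ 4 ∂P) ≤ (v : ℝ) ^ 2 * 96 := by gcongr
  have h5 : (v : ℝ) ^ 2 * (l ^ 4 * ∫ ω, X ω ^ 4 ∂P) = ∫ ω, X ω ^ 4 ∂P := by
    calc _ = ((v : ℝ) * l ^ 2) ^ 2 * ∫ ω, X ω ^ 4 ∂P := by ring
      _ = _ := by rw [h3, one_mul]
  linarith

lemma measure_lt_abs_le (h : HasSubgaussianMGF X v P) {t : ℝ} (ht : 0 ≤ t) :
    P {ω | t < |X ω|} ≤ ENNReal.ofReal (2 * Real.exp (-t ^ 2 / (2 * v))) := by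

  have h1 : ∀ Y : Ω → ℝ, HasSubgaussianMGF Y v P →
      P {ω | t ≤ Y ω} ≤ ENNReal.ofReal (Real.exp (-t ^ 2 / (2 * v))) := by
    intro Y hY
    have := hY.measure_ge_le ht
    rw [← ofReal_measureReal]
    exact ENNReal.ofReal_le_ofReal this
  calc P {ω | t < |X ω|} ≤ P ({ω | t ≤ X ω} ∪ {ω | t ≤ (-X) ω}) := by
        refine measure_mono fun ω hω => ?_
        rcases lt_abs.1 (show t < |X ω| from hω) with h | h
        · exact Or.inl h.le
        · exact Or.inr h.le
    _ ≤ _ := measure_union_le _ _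
    _ ≤ _ := add_le_add (h1 X h) (h1 _ h.neg)
    _ = _ := by
        rw [← ENNReal.ofReal_add (Real.exp_pos _).le (Real.exp_pos _).le]; congr 1; ring

end SubGaussian

/-! ### Linear combinations of independent centred sub-gaussian variables -/

section LinearCombination

variable {Ω ι : Type*} {mΩ : MeasurableSpace Ω} {P : Measure Ω}
  {X : ι → Ω → ℝ} {v : ℝ≥0}

lemma hasSubgaussianMGF_linearCombination (hX : iIndepFun X P)
    (hv : ∀ i, HasSubgaussianMGF (X i) v P) (s : Finset ι) (u : ι → ℝ) (r : ℝ≥0)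
    (hr : (r : ℝ) = ∑ i ∈ s, u i ^ 2) :
    HasSubgaussianMGF (fun ω => ∑ i ∈ s, u i * X i ω) (v * r) P := by
  have h := HasSubgaussianMGF.sum_of_iIndepFun (s := s)
    (hX.comp (fun i x => u i * x) fun i => by fun_prop) fun i _ => (hv i).const_mul (u i)
  convert h using 1
  · rfl
  · refine NNReal.eq ?_
    rw [NNReal.coe_mul, hr, NNReal.coe_sum, Finset.mul_sum]
    exact Finset.sum_congr rfl fun i _ => mul_comm _ _

lemma integral_linearCombination_sq [IsProbabilityMeasure P] (hX : iIndepFun X P) (hL2 : ∀ i, MemLp (X i) 2 P)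
    (h0 : ∀ i, ∫ ω, X i ω ∂P = 0) (h1 : ∀ i, ∫ ω, X i ω ^ 2 ∂P = 1) (s : Finset ι) (u : ι → ℝ) :
    ∫ ω, (∑ i ∈ s, u i * X i ω) ^ 2 ∂P = ∑ i ∈ s, u i ^ 2 := by
  have hL2' : ∀ i, MemLp (fun ω => u i * X i ω) 2 P := fun i => (hL2 i).const_mul (u i)
  have hmean : ∫ ω, (∑ i ∈ s, u i * X i ω) ∂P = 0 := by
    rw [integral_finsetSum _ fun i _ => (hL2' i).integrable one_le_two]
    exact Finset.sum_eq_zero fun i _ => by rw [integral_const_mul, h0, mul_zero]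
  have hmeas : AEMeasurable (fun ω => ∑ i ∈ s, u i * X i ω) P :=
    (memLp_finsetSum s fun i _ => hL2' i).aestronglyMeasurable.aemeasurable
  rw [← variance_of_integral_eq_zero hmeas hmean]
  have h := IndepFun.variance_sum (s := s) (fun i _ => hL2' i) fun i _ j _ hij =>
    (hX.comp (fun i x => u i * x) fun i => by fun_prop).indepFun hij
  have heq : (∑ i ∈ s, fun ω => u i * X i ω) = fun ω => ∑ i ∈ s, u i * X i ω := by
    ext ω; simp
  change variance (∑ i ∈ s, fun ω => u i * X i ω) P = _ at h
  rw [← heq, h]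
  refine Finset.sum_congr rfl fun i _ => ?_
  rw [variance_const_mul, variance_of_integral_eq_zero (hL2 i).aestronglyMeasurable.aemeasurable
    (h0 i), h1, mul_one]

end LinearCombination

/-! ### The noise vector -/

section Noise

variable {d : ℕ} {C : ℝ≥0} {ν : Fin d → Measure ℝ}

lemma IsSubGaussianNoise.isProbabilityMeasure_noiseLaw (hν : IsSubGaussianNoise C ν) :
    IsProbabilityMeasure (noiseLaw ν) := by
  have := hν.isProbabilityMeasure
  exact Measure.isProbabilityMeasure_map (by fun_prop)

lemma measurePreserving_toLp_noiseLaw (ν : Fin d → Measure ℝ) :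
    MeasurePreserving (WithLp.toLp 2) (Measure.pi ν) (noiseLaw ν) :=
  ⟨by fun_prop, rfl⟩

lemma IsSubGaussianNoise.measurePreserving_coord (hν : IsSubGaussianNoise C ν) (l : Fin d) :
    MeasurePreserving (fun z : EuclideanSpace ℝ (Fin d) => z l) (noiseLaw ν) (ν l) := by
  have := hν.isProbabilityMeasure
  refine ⟨by fun_prop, ?_⟩
  rw [noiseLaw, Measure.map_map (by fun_prop) (by fun_prop)]
  exact (measurePreserving_eval ν l).map_eq

lemma IsSubGaussianNoise.iIndepFun_coord (hν : IsSubGaussianNoise C ν) :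
    iIndepFun (fun (l : Fin d) (z : EuclideanSpace ℝ (Fin d)) => z l) (noiseLaw ν) := by
  have := hν.isProbabilityMeasure
  have := hν.isProbabilityMeasure_noiseLaw
  rw [iIndepFun_iff_map_fun_eq_pi_map fun l => by fun_prop]
  simp_rw [(hν.measurePreserving_coord _).map_eq]
  rw [noiseLaw, Measure.map_map (by fun_prop) (by fun_prop)]
  exact Measure.map_id

lemma IsSubGaussianNoise.hasSubgaussianMGF (hν : IsSubGaussianNoise C ν) (l : Fin d) :
    HasSubgaussianMGF (fun x : ℝ => x) (varianceProxy C) (ν l) :=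
  have := hν.isProbabilityMeasure l
  hasSubgaussianMGF_of_psi2Norm_le (hν.psi2Norm_le l) (hν.mean_eq_zero l)

lemma IsSubGaussianNoise.integral_sq (hν : IsSubGaussianNoise C ν) (l : Fin d) :
    ∫ x, x ^ 2 ∂(ν l) = 1 := by
  have := hν.isProbabilityMeasure l
  rw [← variance_of_integral_eq_zero (by fun_prop) (hν.mean_eq_zero l), hν.variance_eq_one l]

lemma IsSubGaussianNoise.hasSubgaussianMGF_coord (hν : IsSubGaussianNoise C ν) (l : Fin d) :
    HasSubgaussianMGF (fun z : EuclideanSpace ℝ (Fin d) => z l) (varianceProxy C)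
      (noiseLaw ν) := by
  have h := hν.hasSubgaussianMGF l
  rw [← (hν.measurePreserving_coord l).map_eq] at h
  exact h.of_map (by fun_prop)

lemma IsSubGaussianNoise.integral_coord (hν : IsSubGaussianNoise C ν) (l : Fin d) :
    ∫ z, z l ∂(noiseLaw ν) = 0 := by
  rw [← hν.mean_eq_zero l, ← (hν.measurePreserving_coord l).map_eq,
    integral_map (by fun_prop) (by fun_prop)]

lemma IsSubGaussianNoise.integral_coord_sq (hν : IsSubGaussianNoise C ν) (l : Fin d) :
    ∫ z, (z l) ^ 2 ∂(noiseLaw ν) = 1 := by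
  rw [← hν.integral_sq l, ← (hν.measurePreserving_coord l).map_eq,
    integral_map (by fun_prop) (by fun_prop)]

lemma IsSubGaussianNoise.memLp_coord (hν : IsSubGaussianNoise C ν) (l : Fin d) :
    MemLp (fun z : EuclideanSpace ℝ (Fin d) => z l) 2 (noiseLaw ν) :=
  (hν.hasSubgaussianMGF_coord l).memLp 2

lemma inner_eq_sum_mul (z u : EuclideanSpace ℝ (Fin d)) : inner ℝ z u = ∑ l, u l * z l := by
  simp [PiLp.inner_apply]

lemma norm_sq_eq_sum_sq (u : EuclideanSpace ℝ (Fin d)) : ‖u‖ ^ 2 = ∑ l, u l ^ 2 := by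
  simp [EuclideanSpace.norm_sq_eq]

lemma IsSubGaussianNoise.hasSubgaussianMGF_inner (hν : IsSubGaussianNoise C ν)
    (u : EuclideanSpace ℝ (Fin d)) :
    HasSubgaussianMGF (fun z => inner ℝ z u) (varianceProxy C * ‖u‖₊ ^ 2) (noiseLaw ν) := by
  have := hν.isProbabilityMeasure_noiseLaw
  simp_rw [inner_eq_sum_mul]
  exact hasSubgaussianMGF_linearCombination hν.iIndepFun_coord hν.hasSubgaussianMGF_coord _ _ _
    (by simp [← norm_sq_eq_sum_sq])

lemma IsSubGaussianNoise.integral_inner_sq (hν : IsSubGaussianNoise C ν)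
    (u : EuclideanSpace ℝ (Fin d)) : ∫ z, (inner ℝ z u) ^ 2 ∂(noiseLaw ν) = ‖u‖ ^ 2 := by
  have := hν.isProbabilityMeasure_noiseLaw
  simp_rw [inner_eq_sum_mul, norm_sq_eq_sum_sq]
  exact integral_linearCombination_sq hν.iIndepFun_coord hν.memLp_coord hν.integral_coord
    hν.integral_coord_sq _ _

/-- Tail bound for a one-dimensional marginal of the noise. -/
lemma IsSubGaussianNoise.measure_lt_abs_inner_le (hν : IsSubGaussianNoise C ν)
    (u : EuclideanSpace ℝ (Fin d)) {t : ℝ} (ht : 0 ≤ t) :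
    noiseLaw ν {z | t * ‖u‖ < |inner ℝ z u|} ≤
      ENNReal.ofReal (2 * Real.exp (-t ^ 2 / (2 * varianceProxy C))) := by
  have := hν.isProbabilityMeasure_noiseLaw
  rcases eq_or_ne u 0 with rfl | hu
  · simp
  have hu' : 0 < ‖u‖ := norm_pos_iff.2 hu
  refine (measure_lt_abs_le (hν.hasSubgaussianMGF_inner u) (by positivity)).trans_eq ?_
  congr 3
  have hv : (0 : ℝ) < varianceProxy C := varianceProxy_pos C
  simp only [NNReal.coe_mul, NNReal.coe_pow, coe_nnnorm]
  field_simp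

/-- Chebyshev's inequality is enough for the single test point: `A` is a constant which is made
large only at the very end. -/
lemma IsSubGaussianNoise.measure_le_abs_inner_le (hν : IsSubGaussianNoise C ν)
    (u : EuclideanSpace ℝ (Fin d)) (hu : ‖u‖ ≤ 1) {A : ℝ} (hA : 0 < A) :
    noiseLaw ν {z | A < |inner ℝ z u|} ≤ ENNReal.ofReal (1 / A ^ 2) := by
  have := hν.isProbabilityMeasure_noiseLaw
  have hsub := hν.hasSubgaussianMGF_inner u
  have hmean : ∫ z, inner ℝ z u ∂(noiseLaw ν) = 0 := by
    simp_rw [inner_eq_sum_mul]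
    rw [integral_finsetSum _ fun l _ => ((hν.memLp_coord l).integrable one_le_two).const_mul _]
    exact Finset.sum_eq_zero fun l _ => by rw [integral_const_mul, hν.integral_coord, mul_zero]
  have h := meas_ge_le_variance_div_sq (hsub.memLp 2) hA
  rw [variance_of_integral_eq_zero hsub.aemeasurable hmean, hν.integral_inner_sq, hmean] at h
  refine (measure_mono fun z hz => ?_).trans (h.trans (ENNReal.ofReal_le_ofReal ?_))
  · simpa using (show A < |inner ℝ z u| from hz).le
  · gcongr; nlinarith [norm_nonneg u]

/-- Concentration of the squared norm of the noise. -/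
lemma IsSubGaussianNoise.measure_lt_abs_norm_sq_sub_le (hν : IsSubGaussianNoise C ν)
    {T : ℝ} (hT : 0 < T) :
    noiseLaw ν {z | T < |‖z‖ ^ 2 - d|} ≤
      ENNReal.ofReal (96 * (varianceProxy C : ℝ) ^ 2 * d / T ^ 2) := by
  have := hν.isProbabilityMeasure_noiseLaw
  have hL2 : ∀ l, MemLp (fun z : EuclideanSpace ℝ (Fin d) => z l ^ 2) 2 (noiseLaw ν) := fun l => by
    rw [memLp_two_iff_integrable_sq (by fun_prop)]
    simpa [← pow_mul] using (hν.hasSubgaussianMGF_coord l).integrable_pow 4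
  have hsum : (fun z : EuclideanSpace ℝ (Fin d) => ‖z‖ ^ 2) = ∑ l, fun z => z l ^ 2 := by
    ext z; simp [norm_sq_eq_sum_sq]
  have hmean : ∫ z, ‖z‖ ^ 2 ∂(noiseLaw ν) = d := by
    simp_rw [norm_sq_eq_sum_sq]
    rw [integral_finsetSum _ fun l _ => (hL2 l).integrable one_le_two]
    simp [hν.integral_coord_sq]
  have hvar : variance (fun z => ‖z‖ ^ 2) (noiseLaw ν) ≤ 96 * (varianceProxy C : ℝ) ^ 2 * d := by
    have hind := hν.iIndepFun_coord.comp (fun _ x => x ^ 2) fun i => by fun_prop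
    rw [hsum, IndepFun.variance_sum (fun l _ => hL2 l) fun i _ j _ hij => hind.indepFun hij]
    calc ∑ l : Fin d, variance (fun z : EuclideanSpace ℝ (Fin d) => z l ^ 2) (noiseLaw ν)
        ≤ ∑ l : Fin d, 96 * (varianceProxy C : ℝ) ^ 2 := by
          refine Finset.sum_le_sum fun l _ => ?_
          refine (variance_le_expectation_sq (by fun_prop)).trans ?_
          simp only [Pi.pow_apply, ← pow_mul]
          exact integral_pow_four_le (hν.hasSubgaussianMGF_coord l)
      _ = _ := by simp; ring
  have hL2' : MemLp (fun z : EuclideanSpace ℝ (Fin d) => ‖z‖ ^ 2) 2 (noiseLaw ν) := by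
    rw [hsum]; exact memLp_finsetSum' _ fun l _ => hL2 l
  have h := meas_ge_le_variance_div_sq hL2' hT
  rw [hmean] at h
  refine (measure_mono fun z hz => ?_).trans (h.trans (ENNReal.ofReal_le_ofReal ?_))
  · exact (show T < |‖z‖ ^ 2 - d| from hz).le
  · gcongr

end Noise

/-! ### A lower bound for the tail of delocalized linear combinations of the noise -/

/-- Young's inequality twice. The moments of `w` and `x` get coefficients of order `δ`; only the
constant, which will be multiplied by a probability, gets the large factor `δ⁻³`. -/
lemma abs_mul_abs_le {δ : ℝ} (hδ : 0 < δ) (x w : ℝ) :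
    |x| * |w| ≤ δ / 2 * w ^ 2 + (δ / 4 * x ^ 4 + 1 / (4 * δ ^ 3)) := by
  have h1 : |x| * |w| ≤ δ / 2 * w ^ 2 + 1 / (2 * δ) * x ^ 2 := by
    have : 0 ≤ (δ * |w| - |x|) ^ 2 / (2 * δ) := by positivity
    have h : (δ * |w| - |x|) ^ 2 / (2 * δ) = δ / 2 * |w| ^ 2 + 1 / (2 * δ) * |x| ^ 2 - |x| * |w| := by
      field_simp; ring
    rw [h, sq_abs, sq_abs] at this
    linarith
  have h2 : 1 / (2 * δ) * x ^ 2 ≤ δ / 4 * x ^ 4 + 1 / (4 * δ ^ 3) := by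
    have : 0 ≤ (δ ^ 2 * x ^ 2 - 1) ^ 2 / (4 * δ ^ 3) := by positivity
    have h : (δ ^ 2 * x ^ 2 - 1) ^ 2 / (4 * δ ^ 3) =
        δ / 4 * x ^ 4 + 1 / (4 * δ ^ 3) - 1 / (2 * δ) * x ^ 2 := by
      field_simp; ring
    rw [h] at this
    linarith
  linarith

variable {d : ℕ} {C : ℝ≥0} {ν : Fin d → Measure ℝ}

/-- The weight `∏ (1 + θ h_l z_l)`, which tilts the noise in the direction `h`. -/
noncomputable def tilt (θ : ℝ) (h : Fin d → ℝ) (z : EuclideanSpace ℝ (Fin d)) : ℝ :=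
  ∏ l, (1 + θ * h l * z l)

lemma IsSubGaussianNoise.integrable_pow_one (hν : IsSubGaussianNoise C ν) (l : Fin d) :
    Integrable (fun x : ℝ => x) (ν l) := by
  have := hν.isProbabilityMeasure l
  exact (hν.hasSubgaussianMGF l).integrable

lemma IsSubGaussianNoise.integrable_sq (hν : IsSubGaussianNoise C ν) (l : Fin d) :
    Integrable (fun x : ℝ => x ^ 2) (ν l) := by
  have := hν.isProbabilityMeasure l
  exact (hν.hasSubgaussianMGF l).integrable_pow 2

lemma IsSubGaussianNoise.integrable_and_integral_prod (hν : IsSubGaussianNoise C ν)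
    (f : Fin d → ℝ → ℝ) (hf : ∀ l, Integrable (f l) (ν l)) :
    Integrable (fun z : EuclideanSpace ℝ (Fin d) => ∏ l, f l (z l)) (noiseLaw ν) ∧
      ∫ z : EuclideanSpace ℝ (Fin d), ∏ l, f l (z l) ∂(noiseLaw ν) = ∏ l, ∫ x, f l x ∂(ν l) := by
  have := hν.isProbabilityMeasure
  have hmp := measurePreserving_toLp_noiseLaw ν
  have hemb : MeasurableEmbedding (WithLp.toLp 2 : (Fin d → ℝ) → EuclideanSpace ℝ (Fin d)) :=
    (MeasurableEquiv.toLp 2 (Fin d → ℝ)).measurableEmbedding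
  constructor
  · rw [← hmp.integrable_comp_emb hemb]
    exact Integrable.fintype_prod_dep hf
  · rw [← hmp.integral_comp hemb]
    exact integral_fintype_prod_eq_prod f

lemma IsSubGaussianNoise.integrable_tilt (hν : IsSubGaussianNoise C ν) (θ : ℝ) (h : Fin d → ℝ) :
    Integrable (tilt θ h) (noiseLaw ν) ∧ ∫ z, tilt θ h z ∂(noiseLaw ν) = 1 := by
  have := hν.isProbabilityMeasure
  have hint : ∀ l, Integrable (fun x : ℝ => 1 + θ * h l * x) (ν l) := fun l =>
    (integrable_const _).add ((hν.integrable_pow_one l).const_mul _)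
  obtain ⟨h1, h2⟩ := hν.integrable_and_integral_prod (fun l x => 1 + θ * h l * x) hint
  refine ⟨h1, h2.trans (Finset.prod_eq_one fun l _ => ?_)⟩
  rw [integral_add (integrable_const _) ((hν.integrable_pow_one l).const_mul _),
    integral_const_mul, hν.mean_eq_zero]
  simp

lemma IsSubGaussianNoise.integrable_tilt_sq (hν : IsSubGaussianNoise C ν) (θ : ℝ)
    (h : Fin d → ℝ) (h1 : ∑ l, h l ^ 2 = 1) :
    Integrable (fun z => tilt θ h z ^ 2) (noiseLaw ν) ∧
      ∫ z, tilt θ h z ^ 2 ∂(noiseLaw ν) ≤ Real.exp (θ ^ 2) := by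
  have := hν.isProbabilityMeasure
  have hexp : ∀ l, (fun x : ℝ => (1 + θ * h l * x) ^ 2) =
      fun x => (1 + 2 * (θ * h l) * x) + (θ * h l) ^ 2 * x ^ 2 := fun l => by ext x; ring
  have hint1 : ∀ l, Integrable (fun x : ℝ => 1 + 2 * (θ * h l) * x) (ν l) := fun l =>
    (integrable_const _).add ((hν.integrable_pow_one l).const_mul _)
  have hint2 : ∀ l, Integrable (fun x : ℝ => (θ * h l) ^ 2 * x ^ 2) (ν l) := fun l =>
    (hν.integrable_sq l).const_mul _
  have hint : ∀ l, Integrable (fun x : ℝ => (1 + θ * h l * x) ^ 2) (ν l) := fun l => by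
    rw [hexp]; exact (hint1 l).add (hint2 l)
  obtain ⟨hi, he⟩ := hν.integrable_and_integral_prod (fun l x => (1 + θ * h l * x) ^ 2) hint
  simp only [tilt, ← Finset.prod_pow]
  refine ⟨hi, he.trans_le ?_⟩
  have hval : ∀ l, ∫ x, (1 + θ * h l * x) ^ 2 ∂(ν l) = 1 + (θ * h l) ^ 2 := fun l => by
    rw [hexp, integral_add (hint1 l) (hint2 l), integral_add (integrable_const _)
      ((hν.integrable_pow_one l).const_mul _), integral_const_mul, integral_const_mul,
      hν.mean_eq_zero, hν.integral_sq]
    simp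
  simp_rw [hval]
  calc ∏ l, (1 + (θ * h l) ^ 2) ≤ ∏ l, Real.exp ((θ * h l) ^ 2) :=
        Finset.prod_le_prod (fun l _ => by positivity) fun l _ => by
          rw [add_comm]; exact Real.add_one_le_exp _
    _ = Real.exp (θ ^ 2) := by
        rw [← Real.exp_sum]
        simp_rw [mul_pow]
        rw [← Finset.mul_sum, h1, mul_one]

/-- Multiplying the weight by `z k` changes only the factor of index `k`, whose mean becomes `θ * h
k` because the variance is one. Summing against `h k` gives `θ * ‖h‖ ^ 2`. -/
lemma IsSubGaussianNoise.integrable_inner_mul_tilt (hν : IsSubGaussianNoise C ν) (θ : ℝ)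
    (h : EuclideanSpace ℝ (Fin d)) (h1 : ‖h‖ = 1) :
    Integrable (fun z => inner ℝ z h * tilt θ h z) (noiseLaw ν) ∧
      ∫ z, inner ℝ z h * tilt θ h z ∂(noiseLaw ν) = θ := by
  classical
  have := hν.isProbabilityMeasure
  set f : Fin d → Fin d → ℝ → ℝ := fun k l x =>
    if l = k then x + θ * h l * x ^ 2 else 1 + θ * h l * x with hf
  have hint : ∀ k l, Integrable (f k l) (ν l) := fun k l => by
    by_cases hlk : l = k
    · simp only [hf, hlk, if_true]
      exact (hν.integrable_pow_one k).add ((hν.integrable_sq k).const_mul _)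
    · simp only [hf, hlk, if_false]
      exact (integrable_const _).add ((hν.integrable_pow_one l).const_mul _)
  have hval : ∀ k, ∏ l, ∫ x, f k l x ∂(ν l) = θ * h k := fun k => by
    rw [Finset.prod_eq_single k]
    · simp only [hf, if_true]
      rw [integral_add (hν.integrable_pow_one k) ((hν.integrable_sq k).const_mul _),
        integral_const_mul, hν.mean_eq_zero, hν.integral_sq]
      simp
    · intro l _ hlk
      simp only [hf, hlk, if_false]
      rw [integral_add (integrable_const _) ((hν.integrable_pow_one l).const_mul _),
        integral_const_mul, hν.mean_eq_zero]
      simp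
    · simp
  have hprod : ∀ k (z : EuclideanSpace ℝ (Fin d)), ∏ l, f k l (z l) = z k * tilt θ h z :=
    fun k z => by
      rw [tilt, ← Finset.mul_prod_erase _ _ (Finset.mem_univ k),
        ← Finset.mul_prod_erase (a := k) _ (fun l => 1 + θ * h l * z l) (Finset.mem_univ k),
        ← mul_assoc]
      congr 1
      · simp only [hf, if_true]; ring
      · exact Finset.prod_congr rfl fun l hl => by simp [hf, Finset.ne_of_mem_erase hl]
  have hmain := fun k => hν.integrable_and_integral_prod (f k) (hint k)
  simp_rw [hprod, hval] at hmain
  have heq : (fun z : EuclideanSpace ℝ (Fin d) => inner ℝ z h * tilt θ h z) =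
      fun z => ∑ k, h k * (z k * tilt θ h z) := by
    ext z; rw [inner_eq_sum_mul, Finset.sum_mul]
    exact Finset.sum_congr rfl fun k _ => by ring
  rw [heq]
  refine ⟨integrable_finsetSum _ fun k _ => (hmain k).1.const_mul _, ?_⟩
  rw [integral_finsetSum _ fun k _ => (hmain k).1.const_mul _]
  simp_rw [integral_const_mul, (hmain _).2]
  have h2 := norm_sq_eq_sum_sq h
  rw [h1] at h2
  calc ∑ k, h k * (θ * h k) = θ * ∑ k, h k ^ 2 := by
        rw [Finset.mul_sum]; exact Finset.sum_congr rfl fun k _ => by ring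
    _ = θ := by rw [← h2]; ring

/-- Off this event all factors of the tilt are nonnegative. Markov's inequality for fourth moments
makes the event rare when `∑ h l ^ 4` is small; this is where delocalization enters. -/
lemma IsSubGaussianNoise.measureReal_exists_one_lt_le (hν : IsSubGaussianNoise C ν) (θ : ℝ)
    (h : Fin d → ℝ) :
    (noiseLaw ν).real {z | ∃ l, 1 < |θ * h l * z l|} ≤
      θ ^ 4 * (96 * (varianceProxy C : ℝ) ^ 2) * ∑ l, h l ^ 4 := by
  have := hν.isProbabilityMeasure_noiseLaw
  have hunion : {z : EuclideanSpace ℝ (Fin d) | ∃ l, 1 < |θ * h l * z l|} =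
      ⋃ l, {z | 1 < |θ * h l * z l|} := by ext; simp
  rw [hunion]
  refine (measureReal_iUnion_fintype_le _).trans ?_
  rw [Finset.mul_sum]
  refine Finset.sum_le_sum fun l _ => ?_
  have hint := (hν.hasSubgaussianMGF_coord l).integrable_pow 4
  have hM := mul_meas_ge_le_integral_of_nonneg (μ := noiseLaw ν)
    (f := fun z : EuclideanSpace ℝ (Fin d) => (θ * h l * z l) ^ 4)
    (Eventually.of_forall fun z => by positivity)
    (by simpa only [mul_pow] using hint.const_mul _) 1
  have h4 := integral_pow_four_le (hν.hasSubgaussianMGF_coord l)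
  calc (noiseLaw ν).real {z | 1 < |θ * h l * z l|}
      ≤ (noiseLaw ν).real {z | 1 ≤ (θ * h l * z l) ^ 4} := by
        refine measureReal_mono fun z hz => ?_
        have h2 : (θ * h l * z l) ^ 4 = |θ * h l * z l| ^ 4 := by
          rw [← abs_pow, abs_of_nonneg (by positivity)]
        rw [Set.mem_ofPred_eq, h2]
        exact one_le_pow₀ (le_of_lt hz)
    _ ≤ ∫ z, (θ * h l * z l) ^ 4 ∂(noiseLaw ν) := by linarith
    _ = θ ^ 4 * h l ^ 4 * ∫ z, z l ^ 4 ∂(noiseLaw ν) := by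
        rw [← integral_const_mul]; congr 1; ext z; ring
    _ ≤ θ ^ 4 * h l ^ 4 * (96 * (varianceProxy C : ℝ) ^ 2) := by gcongr
    _ = _ := by ring

/-- Every linear combination of the noise whose coefficients are small exceeds a given level with
a probability bounded below. -/
lemma exists_pos_le_measureReal_inner (C : ℝ≥0) (K : ℝ) : ∃ p > 0, ∃ η > 0,
    ∀ (d : ℕ) (ν : Fin d → Measure ℝ), IsSubGaussianNoise C ν →
      ∀ h : EuclideanSpace ℝ (Fin d), ‖h‖ = 1 → ∑ l, h l ^ 4 ≤ η →
        p ≤ (noiseLaw ν).real {z | K ≤ inner ℝ z h} := by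
  -- The mean of `⟨z, h⟩ - K` under the tilt is then exactly `2`.
  set θ : ℝ := K + 2 with hθ
  set V : ℝ := 96 * (varianceProxy C : ℝ) ^ 2 with hV
  have hVpos : 0 < V := by have := varianceProxy_pos C; positivity
  set M : ℝ := Real.exp (θ ^ 2) + 8 * (V + K ^ 4) with hM
  have hMpos : 0 < M := by positivity
  set δ : ℝ := 1 / M with hδ
  have hδpos : 0 < δ := by positivity
  -- The union of `bad` and `big` will have probability at least `4 * δ ^ 3`; `η` is chosen so that
  -- `bad` takes at most half of that.
  refine ⟨2 * δ ^ 3, by positivity, 2 * δ ^ 3 / (θ ^ 4 * V + 1), by positivity, ?_⟩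
  intro d ν hν h h1 h4
  have := hν.isProbabilityMeasure_noiseLaw
  obtain ⟨hw, hw1⟩ := hν.integrable_tilt θ h
  obtain ⟨hw2, hw2le⟩ := hν.integrable_tilt_sq θ h (by rw [← norm_sq_eq_sum_sq, h1]; norm_num)
  obtain ⟨hxw, hxw1⟩ := hν.integrable_inner_mul_tilt θ h h1
  have hsub := hν.hasSubgaussianMGF_inner h
  have hx4 : ∫ z, (inner ℝ z h) ^ 4 ∂(noiseLaw ν) ≤ V := by
    have := integral_pow_four_le hsub
    have hn : ‖h‖₊ = 1 := NNReal.eq h1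
    simpa [hn] using this
  set bad : Set (EuclideanSpace ℝ (Fin d)) := {z | ∃ l, 1 < |θ * h l * z l|} with hbad
  set big : Set (EuclideanSpace ℝ (Fin d)) := {z | K ≤ inner ℝ z h} with hbig
  have hbadmeas : MeasurableSet bad := by
    have : bad = ⋃ l, {z | 1 < |θ * h l * z l|} := by ext; simp [hbad]
    rw [this]
    exact MeasurableSet.iUnion fun l => measurableSet_lt (by fun_prop) (by fun_prop)
  have hbigmeas : MeasurableSet big := measurableSet_le (by fun_prop) (by fun_prop)
  have hbadle : (noiseLaw ν).real bad ≤ 2 * δ ^ 3 := by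
    refine (hν.measureReal_exists_one_lt_le θ h).trans ?_
    have h5 : θ ^ 4 * V * ∑ l, h l ^ 4 ≤ (θ ^ 4 * V + 1) * (2 * δ ^ 3 / (θ ^ 4 * V + 1)) := by
      gcongr; linarith
    rwa [mul_div_cancel₀ _ (by positivity)] at h5
  set A := bad ∪ big with hA
  have hAmeas : MeasurableSet A := hbadmeas.union hbigmeas
  -- Off `A` the left side is at most zero, as the weight is nonnegative and the linear form is at
  -- most `K`. On `A` Young's inequality applies, so the constant `1 / (4 δ ^ 3)` is paid only
  -- there.
  have hpt : ∀ z, (inner ℝ z h - K) * tilt θ h z ≤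
      δ / 2 * tilt θ h z ^ 2 + (δ / 4 * (8 * (inner ℝ z h ^ 4 + K ^ 4)) +
        1 / (4 * δ ^ 3) * A.indicator (fun _ => (1 : ℝ)) z) := by
    intro z
    have h44 : (inner ℝ z h - K) ^ 4 ≤ 8 * (inner ℝ z h ^ 4 + K ^ 4) := by
      set x : ℝ := inner ℝ z h
      nlinarith [sq_nonneg (x + K), sq_nonneg (x ^ 2 - K ^ 2), sq_nonneg (x - K),
        sq_nonneg ((x - K) ^ 2), sq_nonneg ((x + K) ^ 2), sq_nonneg (x ^ 2 + K ^ 2 - 2 * x * K),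
        mul_nonneg (sq_nonneg (x + K)) (sq_nonneg (x - K)), sq_nonneg (x ^ 2 + K ^ 2 + 2 * x * K)]
    by_cases hz : z ∈ A
    · have h5 := abs_mul_abs_le hδpos (inner ℝ z h - K) (tilt θ h z)
      have h6 : (inner ℝ z h - K) * tilt θ h z ≤ |inner ℝ z h - K| * |tilt θ h z| := by
        rw [← abs_mul]; exact le_abs_self _
      have h7 : δ / 4 * (inner ℝ z h - K) ^ 4 ≤ δ / 4 * (8 * (inner ℝ z h ^ 4 + K ^ 4)) := by
        gcongr
      simp only [Set.indicator_of_mem hz, mul_one]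
      linarith
    · have h8 : 0 ≤ tilt θ h z := by
        refine Finset.prod_nonneg fun l _ => ?_
        have : |θ * h l * z l| ≤ 1 := by
          by_contra hc
          exact hz (Or.inl ⟨l, not_le.1 hc⟩)
        linarith [(abs_le.1 this).1]
      have h9 : inner ℝ z h ≤ K := by
        by_contra hc
        exact hz (Or.inr (not_le.1 hc).le)
      simp only [Set.indicator_of_notMem hz, mul_zero, add_zero]
      refine le_trans (mul_nonpos_of_nonpos_of_nonneg (by linarith) h8) ?_
      positivity
  have hi4 : Integrable (fun z => δ / 4 * (8 * ((inner ℝ z h) ^ 4 + K ^ 4))) (noiseLaw ν) :=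
    (((hsub.integrable_pow 4).add (integrable_const _)).const_mul _).const_mul _
  have hiA : Integrable (fun z => 1 / (4 * δ ^ 3) * A.indicator (fun _ => (1 : ℝ)) z)
      (noiseLaw ν) := ((integrable_const _).indicator hAmeas).const_mul _
  have hi5 : Integrable (fun z => δ / 4 * (8 * ((inner ℝ z h) ^ 4 + K ^ 4)) +
      1 / (4 * δ ^ 3) * A.indicator (fun _ => (1 : ℝ)) z) (noiseLaw ν) := hi4.add hiA
  have hI := integral_mono (μ := noiseLaw ν)
    (f := fun z => (inner ℝ z h - K) * tilt θ h z) (by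
      simp_rw [sub_mul]; exact hxw.sub (hw.const_mul K))
    ((hw2.const_mul (δ / 2)).add hi5) hpt
  have hL : ∫ z, (inner ℝ z h - K) * tilt θ h z ∂(noiseLaw ν) = 2 := by
    simp_rw [sub_mul]
    rw [integral_sub hxw (hw.const_mul K), hxw1, integral_const_mul, hw1]
    rw [hθ]; ring
  rw [hL] at hI
  simp only [Pi.add_apply] at hI
  rw [integral_add (hw2.const_mul (δ / 2)) hi5, integral_add hi4 hiA,
    integral_const_mul, integral_const_mul, integral_const_mul, integral_const_mul,
    integral_add (hsub.integrable_pow 4) (integrable_const _),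
    integral_indicator_const _ hAmeas] at hI
  simp only [integral_const, probReal_univ, smul_eq_mul, mul_one, one_mul] at hI
  -- `M` is defined so that the moment terms use at most `1` of the total `2`; the indicator term
  -- must supply the rest.
  have hle1 : δ / 2 * Real.exp (θ ^ 2) + δ / 4 * (8 * (V + K ^ 4)) ≤ 1 := by
    have h10 : δ * M = 1 := by rw [hδ]; field_simp
    have : δ / 2 * Real.exp (θ ^ 2) + δ / 4 * (8 * (V + K ^ 4)) ≤ δ * M := by
      have h11 : 0 ≤ δ * Real.exp (θ ^ 2) := by positivity
      have h12 : 0 ≤ δ * (8 * (V + K ^ 4)) := by positivity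
      rw [hM]; linarith
    linarith
  have h13 : δ / 2 * ∫ z, tilt θ h z ^ 2 ∂(noiseLaw ν) ≤ δ / 2 * Real.exp (θ ^ 2) := by gcongr
  have h14 : δ / 4 * (8 * ((∫ z, inner ℝ z h ^ 4 ∂(noiseLaw ν)) + K ^ 4)) ≤
      δ / 4 * (8 * (V + K ^ 4)) := by gcongr
  have h15 : 1 ≤ 1 / (4 * δ ^ 3) * (noiseLaw ν).real A := by linarith
  have h16 : 4 * δ ^ 3 ≤ (noiseLaw ν).real A := by
    rw [one_div, inv_mul_eq_div, le_div_iff₀ (by positivity)] at h15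
    linarith
  have h17 : (noiseLaw ν).real A ≤ (noiseLaw ν).real bad + (noiseLaw ν).real big :=
    measureReal_union_le _ _
  linarith

/-! ### Tail bounds from independence and from moments -/

section General

variable {Ω : Type*} {mΩ : MeasurableSpace Ω} {P : Measure Ω}

/-- Fubini: a bound for every fixed value of `X` survives for an independent random `X`. This
transfers tail bounds from fixed to random directions. -/
lemma measure_indepFun_le {α β : Type*} [MeasurableSpace α] [MeasurableSpace β]
    [IsProbabilityMeasure P] {X : Ω → α} {Y : Ω → β} (h : IndepFun X Y P) (hX : Measurable X)
    (hY : Measurable Y) {A : Set (α × β)} (hA : MeasurableSet A) {δ : ℝ≥0∞}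
    (hδ : ∀ x, P {ω | (x, Y ω) ∈ A} ≤ δ) : P {ω | (X ω, Y ω) ∈ A} ≤ δ := by
  have := Measure.isProbabilityMeasure_map (μ := P) hX.aemeasurable
  have := Measure.isProbabilityMeasure_map (μ := P) hY.aemeasurable
  have h1 : P {ω | (X ω, Y ω) ∈ A} = P.map (fun ω => (X ω, Y ω)) A := by
    rw [Measure.map_apply (hX.prodMk hY) hA]; rfl
  rw [h1, (indepFun_iff_map_prod_eq_prod_map_map hX.aemeasurable hY.aemeasurable).1 h,
    Measure.prod_apply hA]
  calc ∫⁻ x, P.map Y (Prod.mk x ⁻¹' A) ∂(P.map X) ≤ ∫⁻ _, δ ∂(P.map X) :=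
        lintegral_mono fun x => by
          rw [Measure.map_apply hY (measurable_prodMk_left hA)]; exact hδ x
    _ = δ := by simp

lemma measureReal_lt_le_integral_div {f : Ω → ℝ} (hf : Integrable f P) (h0 : ∀ ω, 0 ≤ f ω)
    [IsFiniteMeasure P] {r : ℝ} (hr : 0 < r) : P.real {ω | r < f ω} ≤ (∫ ω, f ω ∂P) / r := by
  have h := mul_meas_ge_le_integral_of_nonneg (Eventually.of_forall h0) hf r
  rw [le_div_iff₀ hr, mul_comm]
  refine le_trans (mul_le_mul_of_nonneg_left (measureReal_mono fun ω hω => ?_) hr.le) h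
  exact (show r < f ω from hω).le

lemma measureReal_le_of_le_ofReal {s : Set Ω} {x : ℝ} (hx : 0 ≤ x)
    (h : P s ≤ ENNReal.ofReal x) : P.real s ≤ x :=
  ENNReal.toReal_le_of_le_ofReal hx h

lemma measureReal_exists_le {ι : Type*} (s : Finset ι) (p : ι → Ω → Prop)
    {x : ℝ} (h : ∀ i ∈ s, P.real {ω | p i ω} ≤ x) :
    P.real {ω | ∃ i ∈ s, p i ω} ≤ s.card * x := by
  have : {ω | ∃ i ∈ s, p i ω} = ⋃ i ∈ s, {ω | p i ω} := by ext; simp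
  rw [this]
  refine (measureReal_biUnion_finset_le s _).trans ?_
  rw [← nsmul_eq_mul]
  exact Finset.sum_le_card_nsmul s _ x h

end General

/-! ### The noise of the training sample -/

section Sample

variable {d n : ℕ} {C : ℝ≥0} {ν : Fin d → Measure ℝ}

/-- The joint law of `n` independent noise vectors. -/
noncomputable def noiseSample (n : ℕ) (ν : Fin d → Measure ℝ) :
    Measure (Fin n → EuclideanSpace ℝ (Fin d)) :=
  Measure.pi fun _ => noiseLaw ν

lemma IsSubGaussianNoise.isProbabilityMeasure_noiseSample (hν : IsSubGaussianNoise C ν) :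
    IsProbabilityMeasure (noiseSample n ν) := by
  have := hν.isProbabilityMeasure_noiseLaw
  unfold noiseSample; infer_instance

lemma IsSubGaussianNoise.measurePreserving_eval (hν : IsSubGaussianNoise C ν) (i : Fin n) :
    MeasurePreserving (fun Z : Fin n → EuclideanSpace ℝ (Fin d) => Z i) (noiseSample n ν)
      (noiseLaw ν) := by
  have := hν.isProbabilityMeasure_noiseLaw
  exact MeasureTheory.measurePreserving_eval (fun _ : Fin n => noiseLaw ν) i

lemma IsSubGaussianNoise.iIndepFun_eval (hν : IsSubGaussianNoise C ν) :
    iIndepFun (fun (i : Fin n) (Z : Fin n → EuclideanSpace ℝ (Fin d)) => Z i)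
      (noiseSample n ν) := by
  have := hν.isProbabilityMeasure_noiseLaw
  exact iIndepFun_pi (X := fun _ z => z) fun _ => by fun_prop

lemma IsSubGaussianNoise.hasSubgaussianMGF_sample_coord (hν : IsSubGaussianNoise C ν) (i : Fin n)
    (l : Fin d) :
    HasSubgaussianMGF (fun Z : Fin n → EuclideanSpace ℝ (Fin d) => Z i l) (varianceProxy C)
      (noiseSample n ν) := by
  have h := hν.hasSubgaussianMGF_coord l
  rw [← (hν.measurePreserving_eval i).map_eq] at h
  exact h.of_map (hν.measurePreserving_eval i).measurable.aemeasurable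

lemma IsSubGaussianNoise.integral_eval (hν : IsSubGaussianNoise C ν) (i : Fin n)
    {f : EuclideanSpace ℝ (Fin d) → ℝ} (hf : Measurable f) :
    ∫ Z, f (Z i) ∂(noiseSample n ν) = ∫ z, f z ∂(noiseLaw ν) := by
  rw [← (hν.measurePreserving_eval i).map_eq,
    integral_map (hν.measurePreserving_eval i).measurable.aemeasurable (by fun_prop)]

lemma IsSubGaussianNoise.measureReal_eval (hν : IsSubGaussianNoise C ν) (i : Fin n)
    {p : EuclideanSpace ℝ (Fin d) → Prop} (hA : MeasurableSet {z | p z}) :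
    (noiseSample n ν).real {Z | p (Z i)} = (noiseLaw ν).real {z | p z} :=
  congrArg ENNReal.toReal ((hν.measurePreserving_eval i).measure_preimage hA.nullMeasurableSet)

lemma IsSubGaussianNoise.iIndepFun_sample_coord (hν : IsSubGaussianNoise C ν) (l : Fin d) :
    iIndepFun (fun (i : Fin n) (Z : Fin n → EuclideanSpace ℝ (Fin d)) => Z i l)
      (noiseSample n ν) :=
  hν.iIndepFun_eval.comp (fun _ z => z l) fun _ => by fun_prop

lemma IsSubGaussianNoise.hasSubgaussianMGF_sum_coord (hν : IsSubGaussianNoise C ν)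
    (A : Finset (Fin n)) (l : Fin d) :
    HasSubgaussianMGF (fun Z : Fin n → EuclideanSpace ℝ (Fin d) => (∑ i ∈ A, Z i) l)
      (varianceProxy C * A.card) (noiseSample n ν) := by
  have h := hasSubgaussianMGF_linearCombination (hν.iIndepFun_sample_coord (n := n) l)
    (fun i => hν.hasSubgaussianMGF_sample_coord i l) A (fun _ => 1) A.card (by simp)
  simpa using h

/-- The norm of a sum of noise vectors. -/
lemma IsSubGaussianNoise.measureReal_lt_norm_sum_le (hν : IsSubGaussianNoise C ν)
    (A : Finset (Fin n)) {r : ℝ} (hr : 0 < r) :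
    (noiseSample n ν).real {Z | r < ‖∑ i ∈ A, Z i‖} ≤ A.card * d / r ^ 2 := by
  have := hν.isProbabilityMeasure_noiseSample (n := n)
  have hsq : ∀ l : Fin d, ∫ Z, ((∑ i ∈ A, Z i) l) ^ 2 ∂(noiseSample n ν) = A.card := fun l => by
    have h := integral_linearCombination_sq (hν.iIndepFun_sample_coord (n := n) l)
      (fun i => (hν.hasSubgaussianMGF_sample_coord i l).memLp 2)
      (fun i => by rw [hν.integral_eval i (f := fun z => z l) (by fun_prop), hν.integral_coord])
      (fun i => by
        rw [hν.integral_eval i (f := fun z => z l ^ 2) (by fun_prop), hν.integral_coord_sq])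
      A (fun _ => 1)
    simpa using h
  have hint : ∀ l : Fin d, Integrable (fun Z : Fin n → EuclideanSpace ℝ (Fin d) =>
      ((∑ i ∈ A, Z i) l) ^ 2) (noiseSample n ν) := fun l =>
    (hν.hasSubgaussianMGF_sum_coord A l).integrable_pow 2
  have h := measureReal_lt_le_integral_div (P := noiseSample n ν)
    (f := fun Z => ‖∑ i ∈ A, Z i‖ ^ 2)
    (by simp_rw [norm_sq_eq_sum_sq]; exact integrable_finsetSum _ fun l _ => hint l)
    (fun _ => by positivity) (r := r ^ 2) (by positivity)
  simp_rw [norm_sq_eq_sum_sq] at h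
  rw [integral_finsetSum _ fun l _ => hint l] at h
  simp_rw [hsq, ← norm_sq_eq_sum_sq] at h
  refine le_trans (measureReal_mono fun Z hZ => ?_) (h.trans_eq ?_)
  · have hZ' : r < ‖∑ i ∈ A, Z i‖ := hZ
    exact pow_lt_pow_left₀ hZ' hr.le two_ne_zero
  · simp [mul_comm]

/-- Sums of noise vectors are delocalized. -/
lemma IsSubGaussianNoise.measureReal_lt_sum_pow_four_le (hν : IsSubGaussianNoise C ν)
    (A : Finset (Fin n)) {r : ℝ} (hr : 0 < r) :
    (noiseSample n ν).real {Z | r < ∑ l, ((∑ i ∈ A, Z i) l) ^ 4} ≤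
      d * (96 * ((varianceProxy C : ℝ) * A.card) ^ 2) / r := by
  have := hν.isProbabilityMeasure_noiseSample (n := n)
  have hsub := fun l => hν.hasSubgaussianMGF_sum_coord (n := n) A l
  refine (measureReal_lt_le_integral_div
    (integrable_finsetSum _ fun l _ => (hsub l).integrable_pow 4)
    (fun Z => Finset.sum_nonneg fun l _ => by positivity) hr).trans ?_
  gcongr
  rw [integral_finsetSum _ fun l _ => (hsub l).integrable_pow 4]
  calc ∑ l : Fin d, ∫ Z, ((∑ i ∈ A, Z i) l) ^ 4 ∂(noiseSample n ν)
      ≤ ∑ l : Fin d, 96 * ((varianceProxy C : ℝ) * A.card) ^ 2 :=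
        Finset.sum_le_sum fun l _ => by simpa using integral_pow_four_le (hsub l)
    _ = _ := by simp

/-- A union bound over the whole sample; the exponential tail absorbs the factor `n`, polynomial in
the dimension, at levels `t = d ^ ε`. -/
lemma IsSubGaussianNoise.measureReal_exists_lt_abs_inner_le (hν : IsSubGaussianNoise C ν)
    (u : EuclideanSpace ℝ (Fin d)) {t : ℝ} (ht : 0 ≤ t) :
    (noiseSample n ν).real {Z | ∃ i, t * ‖u‖ < |inner ℝ (Z i) u|} ≤
      n * (2 * Real.exp (-t ^ 2 / (2 * varianceProxy C))) := by
  have := hν.isProbabilityMeasure_noiseSample (n := n)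
  have h := measureReal_exists_le (P := noiseSample n ν) Finset.univ
    (fun i Z => t * ‖u‖ < |inner ℝ (Z i) u|)
    (x := 2 * Real.exp (-t ^ 2 / (2 * varianceProxy C))) fun i _ => by
      rw [hν.measureReal_eval i (p := fun z => t * ‖u‖ < |inner ℝ z u|)
        (measurableSet_lt (by fun_prop) (by fun_prop))]
      exact measureReal_le_of_le_ofReal (by positivity) (hν.measure_lt_abs_inner_le u ht)
  simpa using h

/-- Each noise vector is almost orthogonal to the sum of the other ones. -/
lemma IsSubGaussianNoise.measureReal_exists_lt_abs_inner_sum_erase_le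
    (hν : IsSubGaussianNoise C ν) (w : EuclideanSpace ℝ (Fin d)) (A : Finset (Fin n)) {t : ℝ}
    (ht : 0 ≤ t) :
    (noiseSample n ν).real {Z | ∃ i, t * ‖∑ k ∈ A.erase i, (w + Z k)‖ <
        |inner ℝ (Z i) (∑ k ∈ A.erase i, (w + Z k))|} ≤
      n * (2 * Real.exp (-t ^ 2 / (2 * varianceProxy C))) := by
  have := hν.isProbabilityMeasure_noiseSample (n := n)
  have h := measureReal_exists_le (P := noiseSample n ν) Finset.univ
    (fun i Z => t * ‖∑ k ∈ A.erase i, (w + Z k)‖ <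
        |inner ℝ (Z i) (∑ k ∈ A.erase i, (w + Z k))|)
    (x := 2 * Real.exp (-t ^ 2 / (2 * varianceProxy C))) fun i _ => by
      refine measureReal_le_of_le_ofReal (by positivity) ?_
      -- Leaving out the index `i` makes the sum independent of `Z i`. For `i ∉ A` nothing is left
      -- out, which is the case used for majority points.
      have hind : IndepFun (fun Z : Fin n → EuclideanSpace ℝ (Fin d) =>
          ∑ k ∈ A.erase i, (w + Z k)) (fun Z => Z i) (noiseSample n ν) := by
        have h1 := (hν.iIndepFun_eval (n := n)).indepFun_finset (A.erase i) {i} (by simp)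
          fun i => by fun_prop
        have hψ : Measurable fun g : (({i} : Finset (Fin n)) → EuclideanSpace ℝ (Fin d)) =>
            g ⟨i, Finset.mem_singleton_self i⟩ :=
          measurable_pi_apply (⟨i, Finset.mem_singleton_self i⟩ : ({i} : Finset (Fin n)))
        have h2 := h1.comp (φ := fun f : (A.erase i → EuclideanSpace ℝ (Fin d)) =>
          ∑ k, (w + f k))
          (by fun_prop) hψ
        convert h2 using 1
        · ext1 Z
          exact (Finset.sum_coe_sort (A.erase i) fun k => w + Z k).symm
        · rfl
      refine measure_indepFun_le hind (by fun_prop) (by fun_prop)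
        (A := {p | t * ‖p.1‖ < |inner ℝ p.2 p.1|})
        (measurableSet_lt (by fun_prop) (by fun_prop)) fun u => ?_
      have h3 := (hν.measurePreserving_eval i).measure_preimage
        (s := {z | t * ‖u‖ < |inner ℝ z u|})
        (measurableSet_lt (by fun_prop) (by fun_prop)).nullMeasurableSet
      exact h3.trans_le (hν.measure_lt_abs_inner_le u ht)
  simpa using h

lemma IsSubGaussianNoise.measureReal_exists_lt_abs_norm_sq_sub_le (hν : IsSubGaussianNoise C ν)
    (A : Finset (Fin n)) {T : ℝ} (hT : 0 < T) :
    (noiseSample n ν).real {Z | ∃ i ∈ A, T < |‖Z i‖ ^ 2 - d|} ≤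
      A.card * (96 * (varianceProxy C : ℝ) ^ 2 * d / T ^ 2) := by
  have := hν.isProbabilityMeasure_noiseSample (n := n)
  refine measureReal_exists_le A (fun i (Z : Fin n → EuclideanSpace ℝ (Fin d)) =>
    T < |‖Z i‖ ^ 2 - d|) fun i _ => ?_
  rw [hν.measureReal_eval i (p := fun z => T < |‖z‖ ^ 2 - d|)
    (measurableSet_lt (by fun_prop) (by fun_prop))]
  exact measureReal_le_of_le_ofReal (by positivity) (hν.measure_lt_abs_norm_sq_sub_le hT)

end Sample

/-! ### Noise vectors that are large in a given direction -/

section Exceed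

variable {d n : ℕ} {C : ℝ≥0} {ν : Fin d → Measure ℝ}

/-- The indicator that the component of `z` in the direction of `s` is at least `K`. -/
noncomputable def exceed (K : ℝ) (s z : EuclideanSpace ℝ (Fin d)) : ℝ :=
  if K * ‖s‖ ≤ inner ℝ z s then 1 else 0

lemma measurable_exceed {Ω : Type*} [MeasurableSpace Ω] (K : ℝ)
    {f g : Ω → EuclideanSpace ℝ (Fin d)} (hf : Measurable f) (hg : Measurable g) :
    Measurable fun ω => exceed K (f ω) (g ω) :=
  Measurable.ite (measurableSet_le (by fun_prop) (by fun_prop)) measurable_const measurable_const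

lemma measurable_exceed_right (K : ℝ) (s : EuclideanSpace ℝ (Fin d)) : Measurable (exceed K s) :=
  measurable_exceed K measurable_const measurable_id

lemma exceed_nonneg (K : ℝ) (s z : EuclideanSpace ℝ (Fin d)) : 0 ≤ exceed K s z := by
  unfold exceed; split_ifs <;> norm_num

lemma exceed_le_one (K : ℝ) (s z : EuclideanSpace ℝ (Fin d)) : exceed K s z ≤ 1 := by
  unfold exceed; split_ifs <;> norm_num

lemma exceed_sq (K : ℝ) (s z : EuclideanSpace ℝ (Fin d)) : exceed K s z ^ 2 = exceed K s z := by
  unfold exceed; split_ifs <;> norm_num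

lemma memLp_exceed [IsFiniteMeasure (noiseLaw ν)] (K : ℝ) (s : EuclideanSpace ℝ (Fin d)) :
    MemLp (exceed K s) 2 (noiseLaw ν) :=
  MemLp.of_bound (measurable_exceed_right K s).aestronglyMeasurable 1
    (Eventually.of_forall fun z => by
      rw [Real.norm_of_nonneg (exceed_nonneg K s z)]; exact exceed_le_one K s z)

lemma IsSubGaussianNoise.memLp_exceed_mul_coord (hν : IsSubGaussianNoise C ν) (K : ℝ)
    (s : EuclideanSpace ℝ (Fin d)) (l : Fin d) :
    MemLp (fun z => exceed K s z * z l) 2 (noiseLaw ν) := by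
  refine (hν.memLp_coord l).mono
    ((measurable_exceed_right K s).mul (by fun_prop)).aestronglyMeasurable
    (Eventually.of_forall fun z => ?_)
  rw [norm_mul, Real.norm_of_nonneg (exceed_nonneg K s z)]
  exact mul_le_of_le_one_left (norm_nonneg _) (exceed_le_one K s z)

/-- Let `a` be the mean of `exceed K s z • z`. Testing against `a` itself gives `‖a‖ ^ 2 ≤ 1 / 2 +
‖a‖ ^ 2 / 2`, as the noise has identity covariance. The bound does not grow with the dimension,
although the selection by `exceed` biases every coordinate. -/
lemma IsSubGaussianNoise.sum_integral_exceed_mul_coord_sq_le (hν : IsSubGaussianNoise C ν) (K : ℝ)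
    (s : EuclideanSpace ℝ (Fin d)) :
    ∑ l, (∫ z, exceed K s z * z l ∂(noiseLaw ν)) ^ 2 ≤ 1 := by
  have := hν.isProbabilityMeasure_noiseLaw
  set a : EuclideanSpace ℝ (Fin d) :=
    WithLp.toLp 2 fun l => ∫ z, exceed K s z * z l ∂(noiseLaw ν) with ha
  have hint := fun l => (hν.memLp_exceed_mul_coord K s l).integrable one_le_two
  have heq : ∀ z, exceed K s z * inner ℝ z a = ∑ l, a l * (exceed K s z * z l) := fun z => by
    rw [inner_eq_sum_mul, Finset.mul_sum]
    exact Finset.sum_congr rfl fun l _ => by ring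
  have h1 : ∑ l, a l ^ 2 = ∫ z, exceed K s z * inner ℝ z a ∂(noiseLaw ν) := by
    simp_rw [heq]
    rw [integral_finsetSum _ fun l _ => (hint l).const_mul _]
    exact Finset.sum_congr rfl fun l _ => by rw [integral_const_mul, sq]
  have h2 : ∫ z, exceed K s z * inner ℝ z a ∂(noiseLaw ν) ≤ 1 / 2 + 1 / 2 * ‖a‖ ^ 2 := by
    have hi : Integrable (fun z => 1 / 2 * inner ℝ z a ^ 2) (noiseLaw ν) :=
      ((hν.hasSubgaussianMGF_inner a).integrable_pow 2).const_mul _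
    have h3 : ∫ z, (1 / 2 + 1 / 2 * inner ℝ z a ^ 2) ∂(noiseLaw ν) = 1 / 2 + 1 / 2 * ‖a‖ ^ 2 := by
      rw [integral_add (integrable_const _) hi, integral_const_mul, hν.integral_inner_sq]
      simp
    rw [← h3]
    have hj : Integrable (fun z => exceed K s z * inner ℝ z a) (noiseLaw ν) := by
      simp_rw [heq]
      exact integrable_finsetSum _ fun l _ => (hint l).const_mul _
    refine integral_mono hj ((integrable_const _).add hi) fun z => ?_
    have h4 := exceed_nonneg K s z
    have h5 := exceed_le_one K s z
    simp only
    nlinarith [sq_nonneg (exceed K s z - inner ℝ z a)]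
  rw [← norm_sq_eq_sum_sq] at h1
  have h3 : ‖a‖ ^ 2 ≤ 1 := by linarith
  rwa [norm_sq_eq_sum_sq] at h3

lemma IsSubGaussianNoise.memLp_comp_eval (hν : IsSubGaussianNoise C ν) (i : Fin n)
    {f : EuclideanSpace ℝ (Fin d) → ℝ} (hf : MemLp f 2 (noiseLaw ν)) :
    MemLp (fun Z : Fin n → EuclideanSpace ℝ (Fin d) => f (Z i)) 2 (noiseSample n ν) :=
  hf.comp_measurePreserving (hν.measurePreserving_eval i)

lemma IsSubGaussianNoise.variance_sum_eval (hν : IsSubGaussianNoise C ν) (A : Finset (Fin n))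
    {f : EuclideanSpace ℝ (Fin d) → ℝ} (hfm : Measurable f) (hf : MemLp f 2 (noiseLaw ν)) :
    variance (fun Z => ∑ i ∈ A, f (Z i)) (noiseSample n ν) =
      A.card * variance f (noiseLaw ν) := by
  have hind := (hν.iIndepFun_eval (n := n)).comp (fun _ => f) fun _ => hfm
  have h := IndepFun.variance_sum (s := A) (fun i _ => hν.memLp_comp_eval i hf)
    fun i _ j _ hij => hind.indepFun hij
  have heq : (∑ i ∈ A, fun Z : Fin n → EuclideanSpace ℝ (Fin d) => f (Z i)) =
      fun Z => ∑ i ∈ A, f (Z i) := by ext Z; simp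
  rw [heq] at h
  rw [h, ← nsmul_eq_mul]
  refine Finset.sum_eq_card_nsmul fun i _ => ?_
  exact (hν.measurePreserving_eval i).variance_fun_comp hfm.aemeasurable

lemma IsSubGaussianNoise.integral_sum_eval (hν : IsSubGaussianNoise C ν) (A : Finset (Fin n))
    {f : EuclideanSpace ℝ (Fin d) → ℝ} (hfm : Measurable f) (hf : MemLp f 2 (noiseLaw ν)) :
    ∫ Z, ∑ i ∈ A, f (Z i) ∂(noiseSample n ν) = A.card * ∫ z, f z ∂(noiseLaw ν) := by
  have := hν.isProbabilityMeasure_noiseSample (n := n)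
  rw [integral_finsetSum _ fun i _ => (hν.memLp_comp_eval i hf).integrable one_le_two,
    ← nsmul_eq_mul]
  exact Finset.sum_eq_card_nsmul fun i _ => hν.integral_eval i hfm

lemma IsSubGaussianNoise.memLp_sum_eval (hν : IsSubGaussianNoise C ν) (A : Finset (Fin n))
    {f : EuclideanSpace ℝ (Fin d) → ℝ} (hf : MemLp f 2 (noiseLaw ν)) :
    MemLp (fun Z => ∑ i ∈ A, f (Z i)) 2 (noiseSample n ν) :=
  memLp_finsetSum _ fun i _ => hν.memLp_comp_eval i hf

/-- If the direction `s` is exceeded with probability at least `p`, then it is exceeded by a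
proportion of the sample. -/
lemma IsSubGaussianNoise.measureReal_sum_exceed_lt_le (hν : IsSubGaussianNoise C ν)
    (A : Finset (Fin n)) (hA : A.Nonempty) (K : ℝ) (s : EuclideanSpace ℝ (Fin d)) {p : ℝ}
    (hp : 0 < p) (hs : p ≤ (noiseLaw ν).real {z | K * ‖s‖ ≤ inner ℝ z s}) :
    (noiseSample n ν).real {Z | ∑ j ∈ A, exceed K s (Z j) < p / 2 * A.card} ≤
      4 / (p * A.card) := by
  have := hν.isProbabilityMeasure_noiseLaw
  have := hν.isProbabilityMeasure_noiseSample (n := n)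
  set q := (noiseLaw ν).real {z | K * ‖s‖ ≤ inner ℝ z s} with hq
  have hqpos : 0 < q := hp.trans_le hs
  have hcard : (0 : ℝ) < A.card := by exact_mod_cast hA.card_pos
  have hmeas := measurable_exceed_right K s
  have hmem : MemLp (exceed K s) 2 (noiseLaw ν) := memLp_exceed K s
  have hmean : ∫ z, exceed K s z ∂(noiseLaw ν) = q := by
    have h1 : exceed K s = {z | K * ‖s‖ ≤ inner ℝ z s}.indicator 1 := by
      ext z; simp [exceed, Set.indicator_apply]
    rw [h1, integral_indicator_one (measurableSet_le (by fun_prop) (by fun_prop))]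
  have hvar : variance (exceed K s) (noiseLaw ν) ≤ q := by
    refine (variance_le_expectation_sq hmem.aestronglyMeasurable).trans_eq ?_
    simp only [Pi.pow_apply, exceed_sq, hmean]
  have h := meas_ge_le_variance_div_sq (hν.memLp_sum_eval A hmem) (c := q / 2 * A.card)
    (by positivity)
  rw [hν.variance_sum_eval A hmeas hmem, hν.integral_sum_eval A hmeas hmem, hmean] at h
  have h2 := measureReal_le_of_le_ofReal (div_nonneg (mul_nonneg hcard.le (variance_nonneg _ _))
    (by positivity)) h
  refine (measureReal_mono fun Z hZ => ?_).trans (h2.trans ?_)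
  · have hZ' : ∑ j ∈ A, exceed K s (Z j) < p / 2 * A.card := hZ
    have h3 : p / 2 * A.card ≤ q / 2 * A.card := by gcongr
    change q / 2 * A.card ≤ |∑ j ∈ A, exceed K s (Z j) - A.card * q|
    rw [abs_sub_comm]
    exact le_trans (by linarith) (le_abs_self _)
  · calc (A.card * variance (exceed K s) (noiseLaw ν)) / (q / 2 * A.card) ^ 2
        ≤ (A.card * q) / (q / 2 * A.card) ^ 2 := by gcongr
      _ = 4 / (q * A.card) := by field_simp; ring
      _ ≤ 4 / (p * A.card) := by gcongr

/-- The sum of the noise vectors that exceed the level `K` in the direction `s`. -/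
lemma IsSubGaussianNoise.measureReal_lt_norm_sum_exceed_le (hν : IsSubGaussianNoise C ν)
    (A : Finset (Fin n)) (K : ℝ) (s : EuclideanSpace ℝ (Fin d)) {r : ℝ} (hr : 0 < r) :
    (noiseSample n ν).real {Z | r < ‖∑ j ∈ A, exceed K s (Z j) • Z j‖} ≤
      (A.card * d + (A.card : ℝ) ^ 2) / r ^ 2 := by
  have := hν.isProbabilityMeasure_noiseLaw
  have := hν.isProbabilityMeasure_noiseSample (n := n)
  have hcoord : ∀ (Z : Fin n → EuclideanSpace ℝ (Fin d)) l,
      (∑ j ∈ A, exceed K s (Z j) • Z j) l = ∑ j ∈ A, exceed K s (Z j) * Z j l := fun Z l => by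
    simp
  have hm : ∀ l, Measurable fun z : EuclideanSpace ℝ (Fin d) => exceed K s z * z l := fun l =>
    (measurable_exceed_right K s).mul (by fun_prop)
  have hL := hν.memLp_exceed_mul_coord K s
  have hLs := fun l => hν.memLp_sum_eval A (hL l)
  -- Variance plus squared mean. Over all coordinates the variances sum to at most `A.card * d`, and
  -- the squared means to at most `A.card ^ 2`.
  have hsq : ∀ l, ∫ Z, (∑ j ∈ A, exceed K s (Z j) * Z j l) ^ 2 ∂(noiseSample n ν) ≤
      A.card + (A.card : ℝ) ^ 2 * (∫ z, exceed K s z * z l ∂(noiseLaw ν)) ^ 2 := fun l => by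
    have h1 := variance_eq_sub (hLs l)
    rw [hν.variance_sum_eval A (hm l) (hL l), hν.integral_sum_eval A (hm l) (hL l)] at h1
    have h2 : variance (fun z => exceed K s z * z l) (noiseLaw ν) ≤ 1 := by
      refine (variance_le_expectation_sq (hL l).aestronglyMeasurable).trans ?_
      rw [← hν.integral_coord_sq l]
      refine integral_mono (hL l).integrable_sq (hν.memLp_coord l).integrable_sq fun z => ?_
      simp only [Pi.pow_apply, mul_pow, exceed_sq]
      exact mul_le_of_le_one_left (sq_nonneg _) (exceed_le_one K s z)
    have h3 : (A.card : ℝ) * variance (fun z => exceed K s z * z l) (noiseLaw ν) ≤ A.card * 1 := by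
      gcongr
    simp only [Pi.pow_apply] at h1
    nlinarith
  have h := measureReal_lt_le_integral_div (P := noiseSample n ν)
    (f := fun Z => ‖∑ j ∈ A, exceed K s (Z j) • Z j‖ ^ 2)
    (by
      simp_rw [norm_sq_eq_sum_sq, hcoord]
      exact integrable_finsetSum _ fun l _ => (hLs l).integrable_sq)
    (fun _ => by positivity) (r := r ^ 2) (by positivity)
  refine (measureReal_mono fun Z hZ => ?_).trans (h.trans ?_)
  · have hZ' : r < ‖∑ j ∈ A, exceed K s (Z j) • Z j‖ := hZ
    exact pow_lt_pow_left₀ hZ' hr.le two_ne_zero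
  · gcongr
    simp_rw [norm_sq_eq_sum_sq, hcoord]
    rw [integral_finsetSum _ fun l _ => (hLs l).integrable_sq]
    refine (Finset.sum_le_sum fun l _ => hsq l).trans ?_
    rw [Finset.sum_add_distrib, ← Finset.mul_sum]
    have h4 := hν.sum_integral_exceed_mul_coord_sq_le K s
    have h5 : (A.card : ℝ) ^ 2 * ∑ l, (∫ z, exceed K s z * z l ∂(noiseLaw ν)) ^ 2 ≤
        (A.card : ℝ) ^ 2 * 1 := by gcongr
    simp only [Finset.sum_const, Finset.card_univ, Fintype.card_fin, nsmul_eq_mul]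
    linarith

/-- For a delocalized sum `s` of noise vectors, an independent sample contains many vectors that
exceed a given level in the direction `s`, and their sum is not too large. -/
lemma exists_measureReal_delocalized_le (C : ℝ≥0) (K : ℝ) : ∃ p > 0, ∃ η > 0,
    ∀ (d n : ℕ) (ν : Fin d → Measure ℝ), IsSubGaussianNoise C ν →
      ∀ (A B : Finset (Fin n)), Disjoint A B → B.Nonempty → ∀ t > 0,
        (noiseSample n ν).real {Z | (0 < ‖∑ i ∈ A, Z i‖ ∧
            ∑ l, ((∑ i ∈ A, Z i) l) ^ 4 ≤ η * ‖∑ i ∈ A, Z i‖ ^ 4) ∧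
          (∑ j ∈ B, exceed K (∑ i ∈ A, Z i) (Z j) < p / 2 * B.card ∨
            t * B.card < ‖∑ j ∈ B, exceed K (∑ i ∈ A, Z i) (Z j) • Z j‖)} ≤
          4 / (p * B.card) + (d / B.card + 1) / t ^ 2 := by
  obtain ⟨p, hp, η, hη, hmain⟩ := exists_pos_le_measureReal_inner C K
  refine ⟨p, hp, η, hη, fun d n ν hν A B hAB hB t ht => ?_⟩
  have := hν.isProbabilityMeasure_noiseSample (n := n)
  have hcard : (0 : ℝ) < B.card := by exact_mod_cast hB.card_pos
  -- The direction is built from indices in `A` and tested on indices in the disjoint set `B`, so it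
  -- may be treated as fixed.
  have hind : IndepFun (fun Z : Fin n → EuclideanSpace ℝ (Fin d) => ∑ i ∈ A, Z i)
      (fun Z (j : B) => Z j) (noiseSample n ν) := by
    have h1 := (hν.iIndepFun_eval (n := n)).indepFun_finset A B hAB fun i => by fun_prop
    have h2 := h1.comp (φ := fun f : (A → EuclideanSpace ℝ (Fin d)) => ∑ k, f k)
      (ψ := fun g => g) (by fun_prop) measurable_id
    convert h2 using 1
    · ext1 Z
      exact (Finset.sum_coe_sort A fun k => Z k).symm
    · rfl
  refine measureReal_le_of_le_ofReal (by positivity) ?_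
  have hE : ∀ j : B, Measurable fun p : EuclideanSpace ℝ (Fin d) ×
      (B → EuclideanSpace ℝ (Fin d)) => exceed K p.1 (p.2 j) := fun j =>
    measurable_exceed K measurable_fst ((measurable_pi_apply j).comp measurable_snd)
  have hsum : ∀ (s : EuclideanSpace ℝ (Fin d)) (Z : Fin n → EuclideanSpace ℝ (Fin d)),
      ∑ j : B, exceed K s (Z j) = ∑ j ∈ B, exceed K s (Z j) := fun s Z =>
    Finset.sum_coe_sort B fun j => exceed K s (Z j)
  have hsum' : ∀ (s : EuclideanSpace ℝ (Fin d)) (Z : Fin n → EuclideanSpace ℝ (Fin d)),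
      ∑ j : B, exceed K s (Z j) • Z j = ∑ j ∈ B, exceed K s (Z j) • Z j := fun s Z =>
    Finset.sum_coe_sort B fun j => exceed K s (Z j) • Z j
  have key := measure_indepFun_le hind (by fun_prop) (by fun_prop)
    (A := {q | (0 < ‖q.1‖ ∧ ∑ l, (q.1 l) ^ 4 ≤ η * ‖q.1‖ ^ 4) ∧
      (∑ j, exceed K q.1 (q.2 j) < p / 2 * B.card ∨
        t * B.card < ‖∑ j, exceed K q.1 (q.2 j) • q.2 j‖)})
    (δ := ENNReal.ofReal (4 / (p * B.card) + (d / B.card + 1) / t ^ 2)) ?_ ?_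
  · simp only [Set.mem_ofPred_eq, hsum, hsum'] at key
    exact key
  · have m1 : MeasurableSet {q : EuclideanSpace ℝ (Fin d) × (B → EuclideanSpace ℝ (Fin d)) |
        0 < ‖q.1‖} := measurableSet_lt (by fun_prop) (by fun_prop)
    have m2 : MeasurableSet {q : EuclideanSpace ℝ (Fin d) × (B → EuclideanSpace ℝ (Fin d)) |
        ∑ l, (q.1 l) ^ 4 ≤ η * ‖q.1‖ ^ 4} := measurableSet_le (by fun_prop) (by fun_prop)
    have m3 : MeasurableSet {q : EuclideanSpace ℝ (Fin d) × (B → EuclideanSpace ℝ (Fin d)) |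
        ∑ j, exceed K q.1 (q.2 j) < p / 2 * B.card} :=
      measurableSet_lt (Finset.measurable_sum _ fun j _ => hE j) measurable_const
    have m4 : MeasurableSet {q : EuclideanSpace ℝ (Fin d) × (B → EuclideanSpace ℝ (Fin d)) |
        t * B.card < ‖∑ j, exceed K q.1 (q.2 j) • q.2 j‖} :=
      measurableSet_lt measurable_const (Measurable.norm (Finset.measurable_sum _ fun j _ =>
        (hE j).smul ((measurable_pi_apply j).comp measurable_snd)))
    exact (m1.inter m2).inter (m3.union m4)
  · intro s
    by_cases hs : 0 < ‖s‖ ∧ ∑ l, (s l) ^ 4 ≤ η * ‖s‖ ^ 4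
    swap
    · simp only [Set.mem_ofPred_eq, hs, false_and]
      simp
    have hps : p ≤ (noiseLaw ν).real {z | K * ‖s‖ ≤ inner ℝ z s} := by
      -- The delocalization condition and the event are homogeneous in `s`, so the bound for unit
      -- vectors applies to the normalized sum.
      have h1 : ‖‖s‖⁻¹ • s‖ = 1 := by
        rw [norm_smul, norm_inv, norm_norm, inv_mul_cancel₀ hs.1.ne']
      have h2 := hmain d ν hν (‖s‖⁻¹ • s) h1 (by
        have h3 : ∀ l, (‖s‖⁻¹ • s) l ^ 4 = (‖s‖ ^ 4)⁻¹ * s l ^ 4 := fun l => by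
          simp [mul_pow]
        simp_rw [h3]
        rw [← Finset.mul_sum, inv_mul_le_iff₀ (by have := hs.1; positivity)]
        linarith [hs.2])
      convert h2 using 3
      ext z
      rw [real_inner_smul_right, inv_mul_eq_div, le_div_iff₀ hs.1]
    rw [← ofReal_measureReal]
    apply ENNReal.ofReal_le_ofReal
    simp only [hs, Set.mem_ofPred_eq, true_and, and_self, hsum, hsum']
    refine (measureReal_union_le {Z : Fin n → EuclideanSpace ℝ (Fin d) |
      ∑ j ∈ B, exceed K s (Z j) < p / 2 * B.card} {Z |
      t * B.card < ‖∑ j ∈ B, exceed K s (Z j) • Z j‖}).trans (add_le_add ?_ ?_)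
    · exact hν.measureReal_sum_exceed_lt_le B hB K s hp hps
    · have h3 := hν.measureReal_lt_norm_sum_exceed_le B K s (r := t * B.card) (by positivity)
      have h4 : (B.card * d + (B.card : ℝ) ^ 2) / (t * B.card) ^ 2 = (d / B.card + 1) / t ^ 2 := by
        field_simp
      exact h3.trans_eq h4

end Exceed

/-! ### Deterministic bounds for the support vector machine -/

section Geometry

variable {d n : ℕ} {μ : EuclideanSpace ℝ (Fin d)} {y : Fin n → Bool}
  {Z : Fin n → EuclideanSpace ℝ (Fin d)}

/-- The training set with labels `y` and noise vectors `Z`. -/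
noncomputable def trainingSet (μ : EuclideanSpace ℝ (Fin d)) (y : Fin n → Bool)
    (Z : Fin n → EuclideanSpace ℝ (Fin d)) : Fin n → Point d :=
  fun i => (label (y i) • μ + Z i, y i)

/-- The indices of the minority class. -/
def minorityIdx (y : Fin n → Bool) : Finset (Fin n) := {i | y i = true}

/-- The indices of the majority class. -/
def majorityIdx (y : Fin n → Bool) : Finset (Fin n) := {i | y i = false}

lemma disjoint_minority_majority (y : Fin n → Bool) : Disjoint (minorityIdx y) (majorityIdx y) := by
  rw [Finset.disjoint_left]
  intro i hi hj
  simp only [minorityIdx, majorityIdx, Finset.mem_filter] at hi hj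
  simp [hi.2] at hj

lemma card_minority_add_card_majority (y : Fin n → Bool) :
    (minorityIdx y).card + (majorityIdx y).card = n := by
  have h := Finset.card_filter_add_card_filter_not (s := (Finset.univ : Finset (Fin n)))
    (p := fun i => y i = true)
  simp only [Bool.not_eq_true, Finset.card_univ, Fintype.card_fin] at h
  exact h

/-- The sum of the noise vectors of the majority class is small, and the noise is almost
orthogonal to the signal. -/
structure IsTypical (t : ℝ) (μ : EuclideanSpace ℝ (Fin d)) (y : Fin n → Bool)
    (Z : Fin n → EuclideanSpace ℝ (Fin d)) : Prop where
  norm_sum_majority_le : ‖∑ j ∈ majorityIdx y, Z j‖ ≤ (majorityIdx y).card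
  abs_inner_signal_le : ∀ i, |inner ℝ (Z i) μ| ≤ t * ‖μ‖

/-- The noise vectors of the minority class have almost the same norm, and each noise vector is
almost orthogonal to the sum over the minority class of the other ones. -/
structure IsSpread (t : ℝ) (μ : EuclideanSpace ℝ (Fin d)) (y : Fin n → Bool)
    (Z : Fin n → EuclideanSpace ℝ (Fin d)) : Prop where
  abs_inner_sum_erase_le : ∀ i, |inner ℝ (Z i) (∑ k ∈ (minorityIdx y).erase i, ((2 : ℝ) • μ + Z k))| ≤
    t * ‖∑ k ∈ (minorityIdx y).erase i, ((2 : ℝ) • μ + Z k)‖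
  abs_norm_sq_sub_le : ∀ i ∈ minorityIdx y,
    |‖Z i‖ ^ 2 - d| ≤ t * Real.sqrt ((minorityIdx y).card * d)

/-! ### Class averages of the constraints, and the margin forced by a separating direction. -/

section Solution

variable {τ : ℝ} {β : EuclideanSpace ℝ (Fin d)} {β₀ κ : ℝ}

lemma IsFeasible.le_of_mem_minority (h : IsFeasible τ (trainingSet μ y Z) β β₀ κ) {i : Fin n}
    (hi : i ∈ minorityIdx y) : τ * κ ≤ inner ℝ μ β + inner ℝ (Z i) β + β₀ := by
  have hy : y i = true := by simpa [minorityIdx] using hi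
  have := h.minority i hy
  simpa [trainingSet, label, hy, inner_add_left] using this

lemma IsFeasible.le_of_mem_majority (h : IsFeasible τ (trainingSet μ y Z) β β₀ κ) {j : Fin n}
    (hj : j ∈ majorityIdx y) : κ ≤ inner ℝ μ β - inner ℝ (Z j) β - β₀ := by
  have hy : y j = false := by simpa [majorityIdx] using hj
  have := h.majority j hy
  simp only [trainingSet, label, hy, Bool.false_eq_true, if_false, inner_add_left,
    neg_smul, one_smul, inner_neg_left] at this
  linarith

/-- For a direction `u` separating the classes by `g`, the intercept can be placed so that the worst
majority point has margin `g / (1 + τ)`. Every minority point then has margin at least `τ * g / (1 +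
τ)`, and optimality of `κ` gives the bound. -/
lemma IsSVMSolution.le_gap (h : IsSVMSolution τ (trainingSet μ y Z) β β₀ κ) (hτ : 0 < τ)
    (hmaj : (majorityIdx y).Nonempty) {u : EuclideanSpace ℝ (Fin d)} (hu : ‖u‖ ≤ 1) {g : ℝ}
    (hg : ∀ i ∈ minorityIdx y, ∀ j ∈ majorityIdx y,
      g ≤ 2 * inner ℝ μ u + inner ℝ (Z i) u - inner ℝ (Z j) u) :
    g ≤ (1 + τ) * κ := by
  obtain ⟨j, hj, hmax⟩ := Finset.exists_max_image (majorityIdx y) (fun j => inner ℝ (Z j) u) hmaj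
  have hfeas : IsFeasible τ (trainingSet μ y Z) u
      (inner ℝ μ u - inner ℝ (Z j) u - g / (1 + τ)) (g / (1 + τ)) := by
    refine ⟨fun i hi => ?_, fun i hi => ?_, hu⟩
    · have hi' : y i = true := hi
      have h1 := hg i (by simp [minorityIdx, hi']) j hj
      have h2 : τ * (g / (1 + τ)) = g - g / (1 + τ) := by field_simp; ring
      simp only [trainingSet, label, hi', if_true, one_smul, inner_add_left, one_mul]
      linarith
    · have hi' : y i = false := hi
      have h1 := hmax i (by simp [majorityIdx, hi'])
      simp only [trainingSet, label, hi', Bool.false_eq_true, if_false, inner_add_left,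
        neg_smul, one_smul, inner_neg_left]
      linarith
  have h1 := h.2 _ _ _ hfeas
  rw [div_le_iff₀ (by positivity)] at h1
  linarith

lemma le_inner_sum {s : Finset (Fin n)} {a : ℝ} (u : EuclideanSpace ℝ (Fin d))
    (h : ∀ i ∈ s, a ≤ inner ℝ (Z i) u) : s.card * a ≤ inner ℝ (∑ i ∈ s, Z i) u := by
  rw [sum_inner, ← nsmul_eq_mul]
  exact Finset.card_nsmul_le_sum _ _ _ h

lemma inner_sum_le {s : Finset (Fin n)} {a : ℝ} (u : EuclideanSpace ℝ (Fin d))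
    (h : ∀ i ∈ s, inner ℝ (Z i) u ≤ a) : inner ℝ (∑ i ∈ s, Z i) u ≤ s.card * a := by
  rw [sum_inner, ← nsmul_eq_mul]
  exact Finset.sum_le_card_nsmul _ _ _ h

lemma abs_inner_le_norm_of_norm_le_one {u v : EuclideanSpace ℝ (Fin d)} (hv : ‖v‖ ≤ 1) :
    |inner ℝ u v| ≤ ‖u‖ :=
  (abs_real_inner_le_norm u v).trans (mul_le_of_le_one_right (norm_nonneg _) hv)

/-- The intercept is at most what the average of the majority class allows. -/
lemma IsFeasible.intercept_le (h : IsFeasible τ (trainingSet μ y Z) β β₀ κ) {t : ℝ}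
    (hZ : IsTypical t μ y Z) (hmaj : (majorityIdx y).Nonempty) :
    β₀ ≤ inner ℝ μ β - κ + 1 := by
  have hcard : (0 : ℝ) < (majorityIdx y).card := by exact_mod_cast hmaj.card_pos
  have h1 := inner_sum_le (Z := Z) (s := majorityIdx y) (a := inner ℝ μ β - β₀ - κ) β fun j hj => by
    linarith [h.le_of_mem_majority hj]
  have h2 := (abs_le.1 ((abs_inner_le_norm_of_norm_le_one (u := ∑ j ∈ majorityIdx y, Z j)
    h.norm_le_one).trans hZ.norm_sum_majority_le)).1
  have h3 : (majorityIdx y).card * (-1 : ℝ) ≤ (majorityIdx y).card * (inner ℝ μ β - β₀ - κ) := by linarith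
  have := le_of_mul_le_mul_left h3 hcard
  linarith

/-- The intercept is at least what the average of the minority class requires. -/
lemma IsFeasible.le_intercept (h : IsFeasible τ (trainingSet μ y Z) β β₀ κ)
    (hmin : (minorityIdx y).Nonempty) :
    τ * κ - inner ℝ μ β - ‖∑ i ∈ minorityIdx y, Z i‖ / (minorityIdx y).card ≤ β₀ := by
  have hcard : (0 : ℝ) < (minorityIdx y).card := by exact_mod_cast hmin.card_pos
  have h1 := le_inner_sum (Z := Z) (s := minorityIdx y) (a := τ * κ - inner ℝ μ β - β₀) β
    fun i hi => by linarith [h.le_of_mem_minority hi]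
  have h2 := (abs_le.1 (abs_inner_le_norm_of_norm_le_one (u := ∑ j ∈ minorityIdx y, Z j)
    h.norm_le_one)).2
  have h3 : τ * κ - inner ℝ μ β - β₀ ≤ ‖∑ i ∈ minorityIdx y, Z i‖ / (minorityIdx y).card := by
    rw [le_div_iff₀ hcard]; linarith
  linarith

/-- The margin is at most the distance of the class averages in the direction `β`. -/
lemma IsFeasible.gap_le (h : IsFeasible τ (trainingSet μ y Z) β β₀ κ) {t : ℝ}
    (hZ : IsTypical t μ y Z) (hmaj : (majorityIdx y).Nonempty) :
    (minorityIdx y).card * ((1 + τ) * κ - 1) ≤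
      inner ℝ (∑ i ∈ minorityIdx y, ((2 : ℝ) • μ + Z i)) β := by
  have h1 := h.intercept_le hZ hmaj
  have h2 := le_inner_sum (Z := fun i => (2 : ℝ) • μ + Z i) (s := minorityIdx y)
    (a := (1 + τ) * κ - 1) β fun i hi => by
      have := h.le_of_mem_minority hi
      rw [inner_add_left, real_inner_smul_left]
      linarith
  exact h2

end Solution

/-- Here `x = ‖H‖`, `p = ⟨μ, H⟩`, `m = ‖μ‖` and `q = √(N d)`. Summing `⟨Z i, H⟩ ≈ d` over the
minority gives `x ^ 2 - 2 N p ≈ q ^ 2`. The hypotheses make the errors small fractions of `q x` and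
`q ^ 2`, so `x` is comparable with `q`. -/
lemma order_of_norm_of_gram_bounds {N t m q x d p : ℝ} (hN1 : 1 ≤ N)
    (hx0 : 0 ≤ x) (hqpos : 0 < q) (hq2 : q ^ 2 = N * d) (h1 : 112 * t * q ≤ d)
    (h2 : 16 * m * q ≤ d) (hp : |p| ≤ m * x)
    (hlow : N * (d - (t * x + 7 * (t * q))) ≤ x ^ 2 - 2 * (N * p))
    (hupp : x ^ 2 - 2 * (N * p) ≤ N * (d + (t * x + 7 * (t * q)))) :
    q / 2 ≤ x ∧ x ≤ 2 * q ∧ x * (x / N) - 2 * p ≤ d + (t * x + 7 * (t * q)) := by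
  have hN0 : 0 ≤ N := by linarith
  obtain ⟨hp1, hp2⟩ := abs_le.1 hp
  have hNt : 112 * (N * t) ≤ q := by
    have : 112 * (N * t) * q ≤ q * q := by
      have := mul_le_mul_of_nonneg_left h1 hN0
      linarith
    exact le_of_mul_le_mul_right this hqpos
  have hNm : 16 * (N * m) ≤ q := by
    have : 16 * (N * m) * q ≤ q * q := by
      have := mul_le_mul_of_nonneg_left h2 hN0
      linarith
    exact le_of_mul_le_mul_right this hqpos
  have k1 := mul_le_mul_of_nonneg_left hp1 hN0
  have k2 := mul_le_mul_of_nonneg_left hp2 hN0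
  have g1 := mul_le_mul_of_nonneg_right hNt hx0
  have g2 := mul_le_mul_of_nonneg_right hNm hx0
  have g3 := mul_le_mul_of_nonneg_right hNt hqpos.le
  refine ⟨?_, ?_, ?_⟩
  · by_contra hc
    push Not at hc
    nlinarith [mul_le_mul_of_nonneg_left hc.le hqpos.le, mul_le_mul_of_nonneg_left hc.le hx0,
      mul_pos hqpos hqpos]
  · by_contra hc
    push Not at hc
    nlinarith [mul_le_mul_of_nonneg_left hc.le hqpos.le, mul_le_mul_of_nonneg_left hc.le hx0,
      mul_pos hqpos hqpos]
  · have : N * (x * (x / N) - 2 * p) ≤ N * (d + (t * x + 7 * (t * q))) := by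
      have h5 : N * (x * (x / N)) = x ^ 2 := by field_simp
      linarith
    exact le_of_mul_le_mul_left this (by linarith)

/-- The sum of the vectors `2 μ + Z i` over the minority class. -/
noncomputable def shiftedSum (μ : EuclideanSpace ℝ (Fin d)) (y : Fin n → Bool)
    (Z : Fin n → EuclideanSpace ℝ (Fin d)) : EuclideanSpace ℝ (Fin d) :=
  ∑ i ∈ minorityIdx y, ((2 : ℝ) • μ + Z i)

lemma sum_minority_eq (μ : EuclideanSpace ℝ (Fin d)) (y : Fin n → Bool)
    (Z : Fin n → EuclideanSpace ℝ (Fin d)) :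
    ∑ i ∈ minorityIdx y, Z i = shiftedSum μ y Z - (2 * ((minorityIdx y).card : ℝ)) • μ := by
  rw [shiftedSum, Finset.sum_add_distrib, Finset.sum_const, ← Nat.cast_smul_eq_nsmul ℝ, smul_smul,
    mul_comm (2 : ℝ)]
  simp

/-- Split `H` into the leave-one-out sum and `2 μ + Z i`. The first part contributes `t (‖H‖ + 2 ‖μ‖
+ 2 √d)`, the cross term `2 t ‖μ‖`, the squared norm `t q`; together at most `t ‖H‖ + (4 + 2 + 1) t
q`. -/
lemma IsSpread.abs_inner_shiftedSum_sub_le {t : ℝ} (hsp : IsSpread t μ y Z)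
    (htyp : IsTypical t μ y Z) (ht : 0 ≤ t) {q : ℝ}
    (hq : q = Real.sqrt ((minorityIdx y).card * d)) (hrq : Real.sqrt d ≤ q) (hmq : ‖μ‖ ≤ q)
    (hqd : t * q ≤ d) {i : Fin n} (hi : i ∈ minorityIdx y) :
    |inner ℝ (Z i) (shiftedSum μ y Z) - d| ≤ t * ‖shiftedSum μ y Z‖ + 7 * (t * q) := by
  have hr2 : Real.sqrt d ^ 2 = d := Real.sq_sqrt (by positivity)
  have hr0 : 0 ≤ Real.sqrt d := Real.sqrt_nonneg _
  have hU : ∑ k ∈ (minorityIdx y).erase i, ((2 : ℝ) • μ + Z k) =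
      shiftedSum μ y Z - ((2 : ℝ) • μ + Z i) := by
    rw [shiftedSum, ← Finset.add_sum_erase _ _ hi]; abel
  have e1 := hsp.abs_inner_sum_erase_le i
  have e2 := hsp.abs_norm_sq_sub_le i hi
  have e3 := htyp.abs_inner_signal_le i
  rw [hU] at e1
  rw [← hq] at e2
  have e4 : ‖Z i‖ ≤ 2 * Real.sqrt d := by
    have := (abs_le.1 e2).2
    refine (abs_le_of_sq_le_sq' ?_ (by positivity)).2
    rw [mul_pow, hr2]
    linarith
  have e5 : ‖shiftedSum μ y Z - ((2 : ℝ) • μ + Z i)‖ ≤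
      ‖shiftedSum μ y Z‖ + (2 * ‖μ‖ + 2 * Real.sqrt d) := by
    refine (norm_sub_le _ _).trans (add_le_add le_rfl ((norm_add_le _ _).trans ?_))
    rw [norm_smul, Real.norm_ofNat]
    linarith
  have e6 : inner ℝ (Z i) (shiftedSum μ y Z) =
      inner ℝ (Z i) (shiftedSum μ y Z - ((2 : ℝ) • μ + Z i)) +
      (2 * inner ℝ (Z i) μ + ‖Z i‖ ^ 2) := by
    rw [inner_sub_right, inner_add_right, real_inner_smul_right, real_inner_self_eq_norm_sq]
    ring
  have e7 := e1.trans (mul_le_mul_of_nonneg_left e5 ht)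
  have e8 := mul_le_mul_of_nonneg_left hmq ht
  have e9 := mul_le_mul_of_nonneg_left hrq ht
  rw [e6]
  rw [abs_le] at e2 e3 e7 ⊢
  constructor <;> linarith

/-- Quantitative consequences of `IsSpread`: the norm of the shifted sum is of order `√(N d)`,
where `N` is the number of minority points, and the data is separated in its direction. -/
lemma IsSpread.norm_shiftedSum_and_gap {t : ℝ} (hsp : IsSpread t μ y Z)
    (htyp : IsTypical t μ y Z) (ht : 0 ≤ t) (hd : 1 ≤ d) (hmin : (minorityIdx y).Nonempty)
    (h1 : 112 * t * Real.sqrt ((minorityIdx y).card * d) ≤ d)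
    (h2 : 16 * ‖μ‖ * Real.sqrt ((minorityIdx y).card * d) ≤ d) :
    Real.sqrt ((minorityIdx y).card * d) / 2 ≤ ‖shiftedSum μ y Z‖ ∧
    ‖shiftedSum μ y Z‖ ≤ 2 * Real.sqrt ((minorityIdx y).card * d) ∧
    ∀ i ∈ minorityIdx y, ∀ j ∈ majorityIdx y,
      ‖shiftedSum μ y Z‖ * (‖shiftedSum μ y Z‖ / (minorityIdx y).card - 31 * t) ≤
      2 * inner ℝ μ (shiftedSum μ y Z) + inner ℝ (Z i) (shiftedSum μ y Z) -
        inner ℝ (Z j) (shiftedSum μ y Z) := by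
  obtain ⟨q, hq⟩ : ∃ q, q = Real.sqrt ((minorityIdx y).card * d) := ⟨_, rfl⟩
  obtain ⟨N, hN⟩ : ∃ N : ℝ, N = (minorityIdx y).card := ⟨_, rfl⟩
  rw [← hq] at h1 h2 ⊢
  rw [← hN] at hq ⊢
  have hN1 : 1 ≤ N := by rw [hN]; exact_mod_cast hmin.card_pos
  have hd1 : (1 : ℝ) ≤ d := by exact_mod_cast hd
  have hNd : (d : ℝ) ≤ N * d := le_mul_of_one_le_left (by linarith) hN1
  have hq2 : q ^ 2 = N * d := by rw [hq]; exact Real.sq_sqrt (by linarith)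
  have hqpos : 0 < q := by rw [hq]; exact Real.sqrt_pos.2 (by linarith)
  have hrq : Real.sqrt d ≤ q := by rw [hq]; exact Real.sqrt_le_sqrt hNd
  have hmq : ‖μ‖ ≤ q := by
    by_contra hc
    push Not at hc
    have := mul_le_mul_of_nonneg_right hc.le hqpos.le
    linarith
  have hqd : t * q ≤ d := by linarith [mul_nonneg ht hqpos.le]
  have hZH := fun i (hi : i ∈ minorityIdx y) =>
    hsp.abs_inner_shiftedSum_sub_le htyp ht (by rw [← hN]; exact hq) hrq hmq hqd hi
  have hS : inner ℝ (∑ i ∈ minorityIdx y, Z i) (shiftedSum μ y Z) =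
      ‖shiftedSum μ y Z‖ ^ 2 - 2 * (N * inner ℝ μ (shiftedSum μ y Z)) := by
    rw [sum_minority_eq μ, inner_sub_left, real_inner_smul_left, real_inner_self_eq_norm_sq, ← hN]
    ring
  have hlow := le_inner_sum (Z := Z) (s := minorityIdx y)
    (a := d - (t * ‖shiftedSum μ y Z‖ + 7 * (t * q))) (shiftedSum μ y Z)
    fun i hi => by linarith [(abs_le.1 (hZH i hi)).1]
  have hupp := inner_sum_le (Z := Z) (s := minorityIdx y)
    (a := d + (t * ‖shiftedSum μ y Z‖ + 7 * (t * q))) (shiftedSum μ y Z)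
    fun i hi => by linarith [(abs_le.1 (hZH i hi)).2]
  rw [hS, ← hN] at hlow hupp
  obtain ⟨g1, g2, g3⟩ := order_of_norm_of_gram_bounds hN1 (norm_nonneg _) hqpos
    hq2 h1 h2 (abs_real_inner_le_norm _ _) hlow hupp
  refine ⟨g1, g2, fun i hi j hj => ?_⟩
  -- For a majority index the leave-one-out sum is all of `H`, so `⟨Z j, H⟩ ≤ t ‖H‖`.
  have hj' : j ∉ minorityIdx y := fun h =>
    Finset.disjoint_left.1 (disjoint_minority_majority y) h hj
  have f1 := hsp.abs_inner_sum_erase_le j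
  rw [Finset.erase_eq_of_notMem hj', ← shiftedSum] at f1
  have f2 := (abs_le.1 f1).2
  have f3 := (abs_le.1 (hZH i hi)).1
  -- The errors add up to `3 t ‖H‖ + 14 t q`, and `q ≤ 2 ‖H‖` turns this into `31 t ‖H‖`.
  have f4 := mul_le_mul_of_nonneg_left g1 ht
  rw [mul_sub]
  linarith

end Geometry

/-! ### Deterministic bounds for the scores of a test point -/

section Scores

variable {d n : ℕ} {μ : EuclideanSpace ℝ (Fin d)} {y : Fin n → Bool}
  {Z : Fin n → EuclideanSpace ℝ (Fin d)} {τ t : ℝ} {β : EuclideanSpace ℝ (Fin d)} {β₀ κ : ℝ}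

lemma logit_eq (θ : EuclideanSpace ℝ (Fin d) × ℝ) (x : EuclideanSpace ℝ (Fin d)) :
    logit θ x = inner ℝ x θ.1 + θ.2 := rfl

/-- At `-μ + z` the signal cancels against the one in the averaged majority constraint, leaving `-κ
+ 1`. -/
lemma IsSVMSolution.logit_neg_add_le (h : IsSVMSolution τ (trainingSet μ y Z) β β₀ κ)
    (hτ : 0 < τ) (hZ : IsTypical t μ y Z) (hmaj : (majorityIdx y).Nonempty) {g : ℝ}
    (hg : g ≤ (1 + τ) * κ) (z : EuclideanSpace ℝ (Fin d)) :
    logit (β, β₀) (-μ + z) ≤ |inner ℝ z β| - g / (1 + τ) + 1 := by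
  have h1 := h.1.intercept_le hZ hmaj
  have h2 : g / (1 + τ) ≤ κ := by rw [div_le_iff₀ (by positivity)]; linarith
  rw [logit_eq, inner_add_left, inner_neg_left]
  simp only
  linarith [le_abs_self (inner ℝ z β)]

lemma IsSVMSolution.logit_add_le (h : IsSVMSolution τ (trainingSet μ y Z) β β₀ κ)
    (hτ : 0 < τ) (hZ : IsTypical t μ y Z) (hmaj : (majorityIdx y).Nonempty) {g : ℝ}
    (hg : g ≤ (1 + τ) * κ) (z : EuclideanSpace ℝ (Fin d)) :
    logit (β, β₀) (μ + z) ≤ 2 * ‖μ‖ + |inner ℝ z β| - g / (1 + τ) + 1 := by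
  have h1 := h.1.intercept_le hZ hmaj
  have h2 : g / (1 + τ) ≤ κ := by rw [div_le_iff₀ (by positivity)]; linarith
  have h3 := (abs_le.1 (abs_inner_le_norm_of_norm_le_one (u := μ) h.1.norm_le_one)).2
  rw [logit_eq, inner_add_left]
  simp only
  linarith [le_abs_self (inner ℝ z β)]

/-- At `μ + z` the signal cancels against the averaged minority constraint. The difference `g - g /
(1 + τ)` is the share `τ * g / (1 + τ)` of the gap, a lower bound for `τ * κ`. -/
lemma IsSVMSolution.le_logit_add (h : IsSVMSolution τ (trainingSet μ y Z) β β₀ κ)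
    (hτ : 0 < τ) (hmin : (minorityIdx y).Nonempty) {g : ℝ}
    (hg : g ≤ (1 + τ) * κ) (z : EuclideanSpace ℝ (Fin d)) :
    g - g / (1 + τ) - ‖∑ i ∈ minorityIdx y, Z i‖ / (minorityIdx y).card - |inner ℝ z β| ≤
      logit (β, β₀) (μ + z) := by
  have h1 := h.1.le_intercept hmin
  have h2 : g - g / (1 + τ) ≤ τ * κ := by
    have : g - g / (1 + τ) = τ * g / (1 + τ) := by field_simp; ring
    rw [this, div_le_iff₀ (by positivity)]
    nlinarith
  rw [logit_eq, inner_add_left]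
  simp only
  linarith [neg_abs_le (inner ℝ z β)]

/-- The margin in the direction of the signal. -/
lemma IsSVMSolution.two_mul_norm_sub_le_gap (h : IsSVMSolution τ (trainingSet μ y Z) β β₀ κ)
    (hτ : 0 < τ) (hZ : IsTypical t μ y Z) (hmaj : (majorityIdx y).Nonempty) (hμ : 0 < ‖μ‖) :
    2 * ‖μ‖ - 2 * t ≤ (1 + τ) * κ := by
  refine h.le_gap hτ hmaj (u := ‖μ‖⁻¹ • μ) ?_ fun i _ j _ => ?_
  · rw [norm_smul, norm_inv, norm_norm, inv_mul_cancel₀ hμ.ne']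
  · have h1 := (abs_le.1 (hZ.abs_inner_signal_le i)).1
    have h2 := (abs_le.1 (hZ.abs_inner_signal_le j)).2
    simp only [real_inner_smul_right, real_inner_self_eq_norm_sq]
    have h3 : 2 * (‖μ‖⁻¹ * ‖μ‖ ^ 2) + ‖μ‖⁻¹ * inner ℝ (Z i) μ - ‖μ‖⁻¹ * inner ℝ (Z j) μ =
        ‖μ‖⁻¹ * (2 * ‖μ‖ ^ 2 + inner ℝ (Z i) μ - inner ℝ (Z j) μ) := by ring
    rw [h3, inv_mul_eq_div, le_div_iff₀ hμ]
    nlinarith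

/-- The number of minority points is comparable with `d / ℓ²`, and the signal is weak compared
with the noise of the average of the minority class. -/
structure IsNoisy (t l : ℝ) (μ : EuclideanSpace ℝ (Fin d)) (y : Fin n → Bool)
    (Z : Fin n → EuclideanSpace ℝ (Fin d)) : Prop where
  isTypical : IsTypical t μ y Z
  nonempty_minority : (minorityIdx y).Nonempty
  nonempty_majority : (majorityIdx y).Nonempty
  pos : 0 < l
  le_norm : l * (minorityIdx y).card ≤ ‖shiftedSum μ y Z‖
  norm_le : ‖shiftedSum μ y Z‖ ≤ 8 * (l * (minorityIdx y).card)
  four_mul_signal_le : 4 * ‖μ‖ ≤ l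
  sub_le : ∀ i ∈ minorityIdx y, ∀ j ∈ majorityIdx y,
      ‖shiftedSum μ y Z‖ * (‖shiftedSum μ y Z‖ / (minorityIdx y).card - 31 * t) ≤
      2 * inner ℝ μ (shiftedSum μ y Z) + inner ℝ (Z i) (shiftedSum μ y Z) -
        inner ℝ (Z j) (shiftedSum μ y Z)

lemma IsNoisy.card_pos {l : ℝ} (hZ : IsNoisy t l μ y Z) : (0 : ℝ) < (minorityIdx y).card := by
  exact_mod_cast hZ.nonempty_minority.card_pos

lemma IsNoisy.norm_pos {l : ℝ} (hZ : IsNoisy t l μ y Z) : 0 < ‖shiftedSum μ y Z‖ :=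
  (mul_pos hZ.pos hZ.card_pos).trans_le hZ.le_norm

lemma IsSVMSolution.le_gap_of_isNoisy (h : IsSVMSolution τ (trainingSet μ y Z) β β₀ κ)
    (hτ : 0 < τ) {l : ℝ} (hZ : IsNoisy t l μ y Z) :
    ‖shiftedSum μ y Z‖ / (minorityIdx y).card - 31 * t ≤ (1 + τ) * κ := by
  have hpos := hZ.norm_pos
  refine h.le_gap hτ hZ.nonempty_majority (u := ‖shiftedSum μ y Z‖⁻¹ • shiftedSum μ y Z) ?_
    fun i hi j hj => ?_
  · rw [norm_smul, norm_inv, norm_norm, inv_mul_cancel₀ hpos.ne']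
  · have h1 := hZ.sub_le i hi j hj
    simp only [real_inner_smul_right]
    have h3 : 2 * (‖shiftedSum μ y Z‖⁻¹ * inner ℝ μ (shiftedSum μ y Z)) +
        ‖shiftedSum μ y Z‖⁻¹ * inner ℝ (Z i) (shiftedSum μ y Z) -
        ‖shiftedSum μ y Z‖⁻¹ * inner ℝ (Z j) (shiftedSum μ y Z) =
        ‖shiftedSum μ y Z‖⁻¹ * (2 * inner ℝ μ (shiftedSum μ y Z) +
          inner ℝ (Z i) (shiftedSum μ y Z) - inner ℝ (Z j) (shiftedSum μ y Z)) := by ring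
    rw [h3, inv_mul_eq_div, le_div_iff₀ hpos]
    linarith

lemma IsTypical.abs_inner_signal_sum_le (hZ : IsTypical t μ y Z) :
    |inner ℝ μ (∑ i ∈ minorityIdx y, Z i)| ≤ (minorityIdx y).card * (t * ‖μ‖) := by
  rw [real_inner_comm, abs_le]
  have h1 := le_inner_sum (Z := Z) (s := minorityIdx y) (a := -(t * ‖μ‖)) μ fun i _ =>
    (abs_le.1 (hZ.abs_inner_signal_le i)).1
  have h2 := inner_sum_le (Z := Z) (s := minorityIdx y) (a := t * ‖μ‖) μ fun i _ =>
    (abs_le.1 (hZ.abs_inner_signal_le i)).2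
  exact ⟨by linarith, h2⟩

/-- The signal increases the norm of the sum over the minority class. -/
lemma IsNoisy.sq_div_le_norm_sub_norm {l : ℝ} (hZ : IsNoisy t l μ y Z) (ht : 2 * t ≤ ‖μ‖) :
    ‖μ‖ ^ 2 / (8 * l) ≤ ‖shiftedSum μ y Z‖ / (minorityIdx y).card -
      ‖∑ i ∈ minorityIdx y, Z i‖ / (minorityIdx y).card := by
  have hN := hZ.card_pos
  have hpos := hZ.norm_pos
  have hl := hZ.pos
  have hm := norm_nonneg μ
  have hH : shiftedSum μ y Z = (∑ i ∈ minorityIdx y, Z i) +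
      (2 * ((minorityIdx y).card : ℝ)) • μ := by rw [sum_minority_eq μ]; abel
  have h1 : ‖shiftedSum μ y Z‖ ^ 2 = ‖∑ i ∈ minorityIdx y, Z i‖ ^ 2 +
      4 * (((minorityIdx y).card : ℝ) * inner ℝ μ (∑ i ∈ minorityIdx y, Z i)) +
      4 * (((minorityIdx y).card : ℝ) ^ 2 * ‖μ‖ ^ 2) := by
    rw [hH, norm_add_sq_real, real_inner_smul_right, norm_smul, real_inner_comm,
      Real.norm_of_nonneg (by positivity)]
    ring
  have h2 := (abs_le.1 hZ.isTypical.abs_inner_signal_sum_le).1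
  obtain ⟨N, hNdef⟩ : ∃ N : ℝ, N = (minorityIdx y).card := ⟨_, rfl⟩
  obtain ⟨p, hp⟩ : ∃ p : ℝ, p = inner ℝ μ (∑ i ∈ minorityIdx y, Z i) := ⟨_, rfl⟩
  obtain ⟨s, hs⟩ : ∃ s : ℝ, s = ‖∑ i ∈ minorityIdx y, Z i‖ := ⟨_, rfl⟩
  obtain ⟨x, hx⟩ : ∃ x : ℝ, x = ‖shiftedSum μ y Z‖ := ⟨_, rfl⟩
  have h3 := hZ.norm_le
  have hs0 : 0 ≤ s := by rw [hs]; exact norm_nonneg _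
  rw [← hNdef] at hN h1 h2 h3 ⊢
  rw [← hp] at h1 h2
  rw [← hs] at h1 ⊢
  rw [← hx] at h1 h3 ⊢
  -- Of the gain `4 N ^ 2 ‖μ‖ ^ 2` the cross term can take at most half, since `2 t ≤ ‖μ‖`. Dividing
  -- by `x + s ≤ 2 x ≤ 16 l N` then gives the bound.
  have h4 : 2 * (N ^ 2 * ‖μ‖ ^ 2) ≤ x ^ 2 - s ^ 2 := by
    have e1 := mul_le_mul_of_nonneg_left h2 hN.le
    have e2 : N ^ 2 * (‖μ‖ * (2 * t)) ≤ N ^ 2 * (‖μ‖ * ‖μ‖) := by gcongr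
    linarith
  have h5 : s ≤ x := by
    by_contra hc
    push Not at hc
    have : 0 ≤ N ^ 2 * ‖μ‖ ^ 2 := by positivity
    nlinarith
  rw [← sub_div, div_le_div_iff₀ (by positivity) hN]
  have h6 : 2 * (N ^ 2 * ‖μ‖ ^ 2) ≤ (x - s) * (2 * x) := by nlinarith
  have h7 : (x - s) * (2 * x) ≤ (x - s) * (2 * (8 * (l * N))) := by
    gcongr
  have h8 : N * (‖μ‖ ^ 2 * N) ≤ N * ((x - s) * (8 * l)) := by linarith
  exact le_of_mul_le_mul_left h8 hN

/-- Stability of the maximizer of a linear form on the unit ball: a value within `a` of the maximum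
`‖u‖` forces closeness to `u / ‖u‖`. -/
lemma norm_sub_inv_norm_smul_le {u v : EuclideanSpace ℝ (Fin d)} (hv : ‖v‖ ≤ 1) (hu : 0 < ‖u‖)
    {a : ℝ} (h : ‖u‖ - a ≤ inner ℝ u v) :
    ‖v - ‖u‖⁻¹ • u‖ ^ 2 ≤ 2 * a / ‖u‖ := by
  rw [norm_sub_sq_real, norm_smul, norm_inv, norm_norm, inv_mul_cancel₀ hu.ne',
    real_inner_smul_right, real_inner_comm]
  have h1 : 2 * (‖u‖ - a) / ‖u‖ ≤ 2 * inner ℝ u v / ‖u‖ := by gcongr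
  have h2 : 2 * (‖u‖ - a) / ‖u‖ = 2 - 2 * a / ‖u‖ := by field_simp
  have h3 : 2 * (‖u‖⁻¹ * inner ℝ u v) = 2 * inner ℝ u v / ‖u‖ := by field_simp
  rw [h3]
  nlinarith [norm_nonneg v]

/-- In the noisy regime the direction `β` is almost orthogonal to a weak signal. -/
lemma IsSVMSolution.inner_signal_le (h : IsSVMSolution τ (trainingSet μ y Z) β β₀ κ)
    (hτ : 0 < τ) {l : ℝ} (hZ : IsNoisy t l μ y Z) (ht : 1 ≤ t) :
    inner ℝ μ β ≤ (2 * ‖μ‖ ^ 2 + t * ‖μ‖) / l + ‖μ‖ * Real.sqrt (64 * t / l) := by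
  have hN := hZ.card_pos
  have hpos := hZ.norm_pos
  have hl := hZ.pos
  have h1 := h.le_gap_of_isNoisy hτ hZ
  have h2 := h.1.gap_le hZ.isTypical hZ.nonempty_majority
  rw [← shiftedSum] at h2
  -- The lower bound `(1 + τ) κ ≥ ‖H‖ / N - 31 t` meets the averaged upper bound up to `1 ≤ t`,
  -- whence `32 t`.
  have h3 : ‖shiftedSum μ y Z‖ - (minorityIdx y).card * (32 * t) ≤
      inner ℝ (shiftedSum μ y Z) β := by
    refine le_trans ?_ h2
    have e1 : ‖shiftedSum μ y Z‖ = (minorityIdx y).card *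
      (‖shiftedSum μ y Z‖ / (minorityIdx y).card) := (mul_div_cancel₀ _ hN.ne').symm
    have e2 : (minorityIdx y).card * (‖shiftedSum μ y Z‖ / (minorityIdx y).card - 32 * t) ≤
      (minorityIdx y).card * ((1 + τ) * κ - 1) := mul_le_mul_of_nonneg_left (by linarith) hN.le
    linarith
  -- Comparison with `H` rather than `S` keeps `‖μ‖` out of the distance, so the resulting bound
  -- stays bounded in the whole range `2 b < a - c`.
  have h4 := norm_sub_inv_norm_smul_le h.1.norm_le_one hpos h3
  have h5 : ‖β - ‖shiftedSum μ y Z‖⁻¹ • shiftedSum μ y Z‖ ≤ Real.sqrt (64 * t / l) := by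
    refine Real.le_sqrt_of_sq_le (h4.trans ?_)
    rw [div_le_div_iff₀ hpos hl]
    have := mul_le_mul_of_nonneg_left hZ.le_norm (show 0 ≤ 64 * t by linarith)
    linarith
  have h6 : inner ℝ μ β = ‖shiftedSum μ y Z‖⁻¹ * inner ℝ μ (shiftedSum μ y Z) +
      inner ℝ μ (β - ‖shiftedSum μ y Z‖⁻¹ • shiftedSum μ y Z) := by
    rw [inner_sub_right, real_inner_smul_right]; ring
  have h7 : inner ℝ μ (shiftedSum μ y Z) ≤
      (minorityIdx y).card * (2 * ‖μ‖ ^ 2 + t * ‖μ‖) := by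
    have e1 : shiftedSum μ y Z = (∑ i ∈ minorityIdx y, Z i) +
      (2 * ((minorityIdx y).card : ℝ)) • μ := by rw [sum_minority_eq μ]; abel
    have e2 := (abs_le.1 hZ.isTypical.abs_inner_signal_sum_le).2
    rw [e1, inner_add_right, real_inner_smul_right, real_inner_self_eq_norm_sq]
    linarith
  have h8 : ‖shiftedSum μ y Z‖⁻¹ * inner ℝ μ (shiftedSum μ y Z) ≤
      (2 * ‖μ‖ ^ 2 + t * ‖μ‖) / l := by
    rw [inv_mul_eq_div, div_le_div_iff₀ hpos hl]
    have e1 := mul_le_mul_of_nonneg_right h7 hl.le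
    have e2 := mul_le_mul_of_nonneg_left hZ.le_norm
      (show 0 ≤ 2 * ‖μ‖ ^ 2 + t * ‖μ‖ by positivity)
    linarith
  have h9 := (abs_le.1 (abs_real_inner_le_norm μ
    (β - ‖shiftedSum μ y Z‖⁻¹ • shiftedSum μ y Z))).2
  have h10 := mul_le_mul_of_nonneg_left h5 (norm_nonneg μ)
  linarith

/-- In the noisy regime the sum of the noise vectors of the minority class is of the same order as
the shifted sum. -/
lemma IsNoisy.norm_shiftedSum_sub_le {l : ℝ} (hZ : IsNoisy t l μ y Z) :
    ‖shiftedSum μ y Z‖ - 2 * (minorityIdx y).card * ‖μ‖ ≤ ‖∑ i ∈ minorityIdx y, Z i‖ ∧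
    ‖∑ i ∈ minorityIdx y, Z i‖ ≤ ‖shiftedSum μ y Z‖ + 2 * (minorityIdx y).card * ‖μ‖ ∧
    l * (minorityIdx y).card ≤ 2 * ‖∑ i ∈ minorityIdx y, Z i‖ := by
  have hN := hZ.card_pos
  have e3 := sum_minority_eq μ y Z
  have e4 : ‖(2 * ((minorityIdx y).card : ℝ)) • μ‖ = 2 * (minorityIdx y).card * ‖μ‖ := by
    rw [norm_smul, Real.norm_of_nonneg (mul_nonneg zero_le_two hN.le)]
  have e5 := norm_sub_norm_le (shiftedSum μ y Z) ((2 * ((minorityIdx y).card : ℝ)) • μ)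
  have e6 := norm_sub_le (shiftedSum μ y Z) ((2 * ((minorityIdx y).card : ℝ)) • μ)
  rw [← e3, e4] at e5 e6
  have e7 := hZ.le_norm
  have e8 := mul_le_mul_of_nonneg_left hZ.four_mul_signal_le hN.le
  exact ⟨e5, e6, by linarith⟩

lemma IsNoisy.norm_sum_pos {l : ℝ} (hZ : IsNoisy t l μ y Z) :
    0 < ‖∑ i ∈ minorityIdx y, Z i‖ := by
  have h1 := hZ.norm_shiftedSum_sub_le.2.2
  have h2 := mul_pos hZ.pos hZ.card_pos
  linarith

/-- In the noisy regime `β` is close to the direction of the sum of the noise vectors of the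
minority class. -/
lemma IsSVMSolution.norm_sub_direction_le (h : IsSVMSolution τ (trainingSet μ y Z) β β₀ κ)
    (hτ : 0 < τ) {l : ℝ} (hZ : IsNoisy t l μ y Z) (ht : 1 ≤ t) :
    ‖β - ‖∑ i ∈ minorityIdx y, Z i‖⁻¹ • ∑ i ∈ minorityIdx y, Z i‖ ^ 2 ≤
      4 * (32 * t + 4 * ‖μ‖) / l := by
  have hN := hZ.card_pos
  have hl := hZ.pos
  have hm := norm_nonneg μ
  have h1 := h.le_gap_of_isNoisy hτ hZ
  have h2 := h.1.gap_le hZ.isTypical hZ.nonempty_majority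
  rw [← shiftedSum] at h2
  have e1 : ‖shiftedSum μ y Z‖ = (minorityIdx y).card *
    (‖shiftedSum μ y Z‖ / (minorityIdx y).card) := (mul_div_cancel₀ _ hN.ne').symm
  have e2 : (minorityIdx y).card * (‖shiftedSum μ y Z‖ / (minorityIdx y).card - 32 * t) ≤
    (minorityIdx y).card * ((1 + τ) * κ - 1) := mul_le_mul_of_nonneg_left (by linarith) hN.le
  have e3 := sum_minority_eq μ y Z
  obtain ⟨e5, e6, h3⟩ := hZ.norm_shiftedSum_sub_le
  have hpos := hZ.norm_sum_pos
  -- Passing from `H` to `S` costs `2 N ‖μ‖` in the norm and `2 N ‖μ‖` in the inner product.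
  have h4 : ‖∑ i ∈ minorityIdx y, Z i‖ - (minorityIdx y).card * (32 * t + 4 * ‖μ‖) ≤
      inner ℝ (∑ i ∈ minorityIdx y, Z i) β := by
    have e9 := mul_le_mul_of_nonneg_left
      (abs_le.1 (abs_inner_le_norm_of_norm_le_one (u := μ) h.1.norm_le_one)).2 hN.le
    rw [e3, inner_sub_left, real_inner_smul_left, ← e3]
    linarith
  refine (norm_sub_inv_norm_smul_le h.1.norm_le_one hpos h4).trans ?_
  rw [div_le_div_iff₀ hpos hl]
  have := mul_le_mul_of_nonneg_left h3 (show 0 ≤ 2 * (32 * t + 4 * ‖μ‖) by linarith)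
  linarith

/-- If many majority points exceed the level `K` in the direction of the sum of the minority
noise, then the score of a minority test point is small. -/
lemma IsSVMSolution.logit_add_le_of_exceed (h : IsSVMSolution τ (trainingSet μ y Z) β β₀ κ)
    (hκ : 0 ≤ κ) {K p r : ℝ} (hp : 0 < p) (ht : 0 ≤ t) (hmaj : (majorityIdx y).Nonempty)
    (hS : 0 < ‖∑ i ∈ minorityIdx y, Z i‖)
    (hr : ‖β - ‖∑ i ∈ minorityIdx y, Z i‖⁻¹ • ∑ i ∈ minorityIdx y, Z i‖ ≤ r)
    (h1 : p / 2 * (majorityIdx y).card ≤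
      ∑ j ∈ majorityIdx y, exceed K (∑ i ∈ minorityIdx y, Z i) (Z j))
    (h2 : ‖∑ j ∈ majorityIdx y, exceed K (∑ i ∈ minorityIdx y, Z i) (Z j) • Z j‖ ≤
      t * (majorityIdx y).card) (z : EuclideanSpace ℝ (Fin d)) :
    logit (β, β₀) (μ + z) ≤ 2 * inner ℝ μ β + |inner ℝ z β| - K + 2 * t * r / p := by
  have hQ : (0 : ℝ) < (majorityIdx y).card := by exact_mod_cast hmaj.card_pos
  obtain ⟨s, hs⟩ : ∃ s, s = ∑ i ∈ minorityIdx y, Z i := ⟨_, rfl⟩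
  rw [← hs] at hS hr h1 h2
  obtain ⟨c, hc⟩ : ∃ c, c = ∑ j ∈ majorityIdx y, exceed K s (Z j) := ⟨_, rfl⟩
  rw [← hc] at h1
  have hr0 : 0 ≤ r := (norm_nonneg _).trans hr
  have hcpos : 0 < c := lt_of_lt_of_le (by positivity) h1
  set f := logit (β, β₀) (μ + z) with hf
  -- A majority constraint bounds the score by `-⟨Z j, β⟩` after the signal and test noise are
  -- removed. Only the sum of the errors `⟨Z j, β - s / ‖s‖⟩` over the selected points is needed,
  -- hence the norm of one vector sum.
  have h3 : ∀ j ∈ majorityIdx y, exceed K s (Z j) * (f - 2 * inner ℝ μ β - inner ℝ z β) ≤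
      -(exceed K s (Z j) * K) - inner ℝ (exceed K s (Z j) • Z j) (β - ‖s‖⁻¹ • s) := by
    intro j hj
    have e1 := h.1.le_of_mem_majority hj
    rw [hf, logit_eq, inner_add_left, real_inner_smul_left]
    unfold exceed
    split_ifs with hex
    · rw [inner_sub_right, real_inner_smul_right]
      have : K ≤ ‖s‖⁻¹ * inner ℝ (Z j) s := by
        rw [inv_mul_eq_div, le_div_iff₀ hS]; exact hex
      simp only
      linarith
    · simp
  have h4 := Finset.sum_le_sum h3
  rw [← Finset.sum_mul, ← hc, Finset.sum_sub_distrib, Finset.sum_neg_distrib, ← Finset.sum_mul,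
    ← hc, ← sum_inner] at h4
  have h5 := (abs_le.1 (abs_real_inner_le_norm
    (∑ j ∈ majorityIdx y, exceed K s (Z j) • Z j) (β - ‖s‖⁻¹ • s))).1
  have h6 : ‖∑ j ∈ majorityIdx y, exceed K s (Z j) • Z j‖ * ‖β - ‖s‖⁻¹ • s‖ ≤
      t * (majorityIdx y).card * r := mul_le_mul h2 hr (norm_nonneg _) (by positivity)
  have h7 : t * (majorityIdx y).card * r ≤ c * (2 * t * r / p) := by
    have e1 : t * (majorityIdx y).card * r = p / 2 * (majorityIdx y).card * (2 * t * r / p) := by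
      field_simp
    rw [e1]
    gcongr
  have h8 : c * (f - 2 * inner ℝ μ β - inner ℝ z β) ≤ c * (-K + 2 * t * r / p) := by linarith
  have h9 := le_of_mul_le_mul_left h8 hcpos
  linarith [le_abs_self (inner ℝ z β)]

end Scores

/-! ### The law of the labels -/

section Labels

variable {π : ℝ}

lemma isProbabilityMeasure_labelLaw (h0 : 0 ≤ π) (h1 : π ≤ 1) :
    IsProbabilityMeasure (labelLaw π) := by
  refine ⟨?_⟩
  simp only [labelLaw, Measure.add_apply, Measure.smul_apply, measure_univ, smul_eq_mul, mul_one]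
  rw [← ENNReal.ofReal_add h0 (by linarith)]
  simp

lemma lintegral_labelLaw (f : Bool → ℝ≥0∞) :
    ∫⁻ b, f b ∂(labelLaw π) =
      ENNReal.ofReal π * f true + ENNReal.ofReal (1 - π) * f false := by
  simp [labelLaw]

/-- The joint law of the labels of the training sample. -/
noncomputable def labelSample (n : ℕ) (π : ℝ) : Measure (Fin n → Bool) :=
  Measure.pi fun _ => labelLaw π

lemma isProbabilityMeasure_labelSample {n : ℕ} (h0 : 0 ≤ π) (h1 : π ≤ 1) :
    IsProbabilityMeasure (labelSample n π) := by
  have := isProbabilityMeasure_labelLaw h0 h1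
  unfold labelSample; infer_instance

lemma card_minorityIdx_eq_sum {n : ℕ} (y : Fin n → Bool) :
    ((minorityIdx y).card : ℝ) = ∑ i, if y i then (1 : ℝ) else 0 := by
  simp [minorityIdx]

/-- Concentration of the size of the minority class. -/
lemma measureReal_card_minority_le {n : ℕ} (h0 : 0 < π) (h1 : π < 1) (hn : 0 < n) :
    (labelSample n π).real {y | ¬ (n * π / 2 ≤ (minorityIdx y).card ∧
      (minorityIdx y).card ≤ 3 * (n * π / 2))} ≤ 4 / (n * π) := by
  have := isProbabilityMeasure_labelLaw h0.le h1.le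
  have := isProbabilityMeasure_labelSample (n := n) h0.le h1.le
  have hn' : (0 : ℝ) < n := by exact_mod_cast hn
  set f : Bool → ℝ := fun b => if b then 1 else 0 with hf
  have hfmem : MemLp f 2 (labelLaw π) :=
    MemLp.of_bound (measurable_of_finite f).aestronglyMeasurable 1
      (Eventually.of_forall fun b => by cases b <;> simp [hf])
  have hint : ∫ b, f b ∂(labelLaw π) = π := by
    rw [integral_eq_lintegral_of_nonneg_ae (Eventually.of_forall fun b => by
      cases b <;> simp [hf]) (measurable_of_finite f).aestronglyMeasurable, lintegral_labelLaw]
    simp [hf, h0.le]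
  have hvar : variance f (labelLaw π) ≤ π := by
    refine (variance_le_expectation_sq hfmem.aestronglyMeasurable).trans_eq ?_
    have hsq : f ^ 2 = f := by ext b; cases b <;> simp [hf]
    rw [hsq, hint]
  have hsum : (∑ i, fun y : Fin n → Bool => f (y i)) = fun y => ((minorityIdx y).card : ℝ) := by
    ext y; rw [card_minorityIdx_eq_sum]; simp [hf]
  have hmem : ∀ i, MemLp (fun y : Fin n → Bool => f (y i)) 2 (labelSample n π) := fun i =>
    hfmem.comp_measurePreserving (measurePreserving_eval (fun _ : Fin n => labelLaw π) i)
  have hmemN : MemLp (fun y : Fin n → Bool => ((minorityIdx y).card : ℝ)) 2 (labelSample n π) := by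
    rw [← hsum]; exact memLp_finsetSum' _ fun i _ => hmem i
  have hmean : ∫ y, ((minorityIdx y).card : ℝ) ∂(labelSample n π) = n * π := by
    have h2 : ∀ i : Fin n, ∫ y, f (y i) ∂(labelSample n π) = π := fun i => by
      refine Eq.trans ?_ hint
      conv_rhs => rw [← (measurePreserving_eval (fun _ : Fin n => labelLaw π) i).map_eq]
      exact (integral_map (measurable_pi_apply i).aemeasurable
        (measurable_of_finite f).aestronglyMeasurable).symm
    simp_rw [card_minorityIdx_eq_sum]
    rw [integral_finsetSum _ fun i _ => (hmem i).integrable one_le_two]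
    change ∑ i : Fin n, ∫ y, f (y i) ∂(labelSample n π) = n * π
    simp [h2]
  have hvarN : variance (fun y : Fin n → Bool => ((minorityIdx y).card : ℝ)) (labelSample n π) ≤
      n * π := by
    rw [← hsum]
    unfold labelSample
    rw [variance_sum_pi fun _ => hfmem]
    simp only [Finset.sum_const, Finset.card_univ, Fintype.card_fin, nsmul_eq_mul]
    gcongr
  have h := meas_ge_le_variance_div_sq hmemN (c := n * π / 2) (by positivity)
  rw [hmean] at h
  have h2 := measureReal_le_of_le_ofReal (div_nonneg (variance_nonneg _ _) (by positivity)) h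
  refine (measureReal_mono fun y hy => ?_).trans (h2.trans ?_)
  · change n * π / 2 ≤ |((minorityIdx y).card : ℝ) - n * π|
    by_contra hc
    rw [not_le, abs_lt] at hc
    exact hy ⟨by linarith, by linarith⟩
  · calc variance (fun y : Fin n → Bool => ((minorityIdx y).card : ℝ)) (labelSample n π) /
          (n * π / 2) ^ 2 ≤ n * π / (n * π / 2) ^ 2 := by gcongr
      _ = 4 / (n * π) := by field_simp; ring

end Labels

/-! ### The test errors in terms of labels and noise -/

section Errors

variable {d n : ℕ} {C : ℝ≥0} {ν : Fin d → Measure ℝ} {π : ℝ} {μ : EuclideanSpace ℝ (Fin d)}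

lemma measurable_signal_add (μ : EuclideanSpace ℝ (Fin d)) :
    Measurable fun w : Bool × EuclideanSpace ℝ (Fin d) => (label w.1 • μ + w.2, w.1) := by
  have : Measurable label := measurable_of_finite _
  fun_prop

lemma measurable_trainingSet (μ : EuclideanSpace ℝ (Fin d)) :
    Measurable fun w : (Fin n → Bool) × (Fin n → EuclideanSpace ℝ (Fin d)) =>
      trainingSet μ w.1 w.2 := by
  have : Measurable label := measurable_of_finite _
  unfold trainingSet
  refine measurable_pi_lambda _ fun i => ?_
  exact (((this.comp ((measurable_pi_apply i).comp measurable_fst)).smul_const μ).add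
    ((measurable_pi_apply i).comp measurable_snd)).prodMk
      ((measurable_pi_apply i).comp measurable_fst)

lemma dataLaw_apply [IsProbabilityMeasure (noiseLaw ν)] {A : Set (Point d)}
    (hA : MeasurableSet A) :
    dataLaw π μ ν A = ENNReal.ofReal π * noiseLaw ν {z | (μ + z, true) ∈ A} +
      ENNReal.ofReal (1 - π) * noiseLaw ν {z | (-μ + z, false) ∈ A} := by
  have : SFinite (labelLaw π) := by unfold labelLaw; infer_instance
  rw [dataLaw, Measure.map_apply (measurable_signal_add μ) hA,
    Measure.prod_apply (measurable_signal_add μ hA), lintegral_labelLaw]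
  simp [label, Set.preimage]

lemma isProbabilityMeasure_dataLaw (h0 : 0 ≤ π) (h1 : π ≤ 1)
    [IsProbabilityMeasure (noiseLaw ν)] : IsProbabilityMeasure (dataLaw π μ ν) := by
  have := isProbabilityMeasure_labelLaw h0 h1
  exact Measure.isProbabilityMeasure_map (measurable_signal_add μ).aemeasurable

/-- The law of the training set. -/
lemma pi_dataLaw_eq_map (h0 : 0 ≤ π) (h1 : π ≤ 1) [IsProbabilityMeasure (noiseLaw ν)] :
    (Measure.pi fun _ : Fin n => dataLaw π μ ν) =
      ((labelSample n π).prod (noiseSample n ν)).map fun w => trainingSet μ w.1 w.2 := by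
  have := isProbabilityMeasure_labelLaw h0 h1
  have := isProbabilityMeasure_dataLaw (μ := μ) (ν := ν) h0 h1
  have hmp := measurePreserving_arrowProdEquivProdArrow Bool (EuclideanSpace ℝ (Fin d)) (Fin n)
    (fun _ => labelLaw π) (fun _ => noiseLaw ν)
  unfold labelSample noiseSample
  rw [← hmp.map_eq, Measure.map_map (measurable_trainingSet μ) hmp.measurable]
  have hsig : ∀ _ : Fin n, SigmaFinite (((labelLaw π).prod (noiseLaw ν)).map fun w =>
      (label w.1 • μ + w.2, w.1)) := fun _ => by
    change SigmaFinite (dataLaw π μ ν); infer_instance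
  exact (Measure.pi_map_pi (μ := fun _ : Fin n => (labelLaw π).prod (noiseLaw ν))
    (f := fun _ w => (label w.1 • μ + w.2, w.1))
    fun _ => (measurable_signal_add μ).aemeasurable).symm

variable {svm : (Fin n → Point d) → EuclideanSpace ℝ (Fin d) × ℝ}

lemma measurable_logit (hsvm : Measurable svm) {Ω : Type*} [MeasurableSpace Ω]
    {S : Ω → Fin n → Point d} {x : Ω → EuclideanSpace ℝ (Fin d)} (hS : Measurable S)
    (hx : Measurable x) : Measurable fun ω => logit (svm (S ω)) (x ω) := by
  unfold logit
  have := hsvm.comp hS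
  have h1 : Measurable fun ω => (svm (S ω)).1 := this.fst
  have h2 : Measurable fun ω => (svm (S ω)).2 := this.snd
  fun_prop

/-- Conditioning on the test label replaces the test point by `μ + z` with fresh noise; the mass `π`
of the label cancels. -/
lemma errPlus_eq (h0 : 0 < π) (h1 : π < 1) [IsProbabilityMeasure (noiseLaw ν)]
    (hsvm : Measurable svm) :
    errPlus π μ ν svm = ((Measure.pi fun _ : Fin n => dataLaw π μ ν).prod (noiseLaw ν)).real
      {w | logit (svm w.1) (μ + w.2) ≤ 0} := by
  have := isProbabilityMeasure_dataLaw (μ := μ) (ν := ν) h0.le h1.le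
  have hm : MeasurableSet {w : (Fin n → Point d) × Point d | w.2.2 = true} :=
    measurable_snd.snd (measurableSet_singleton true)
  have hE : MeasurableSet {w : (Fin n → Point d) × Point d | logit (svm w.1) w.2.1 ≤ 0} :=
    measurableSet_le (measurable_logit hsvm measurable_fst measurable_snd.fst) measurable_const
  have hE' : MeasurableSet {w : (Fin n → Point d) × EuclideanSpace ℝ (Fin d) |
      logit (svm w.1) (μ + w.2) ≤ 0} :=
    measurableSet_le (measurable_logit hsvm measurable_fst (by fun_prop)) measurable_const
  have hs : jointLaw n π μ ν {w | w.2.2 = true} = ENNReal.ofReal π := by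
    rw [jointLaw, Measure.prod_apply hm]
    simp only [Set.preimage, Set.mem_ofPred_eq]
    rw [dataLaw_apply (A := {x : Point d | x.2 = true})
      (measurable_snd (measurableSet_singleton true))]
    simp
  have hst : jointLaw n π μ ν ({w | w.2.2 = true} ∩ {w | logit (svm w.1) w.2.1 ≤ 0}) =
      ENNReal.ofReal π * ((Measure.pi fun _ : Fin n => dataLaw π μ ν).prod (noiseLaw ν))
      {w | logit (svm w.1) (μ + w.2) ≤ 0} := by
    rw [jointLaw, Measure.prod_apply (hm.inter hE), Measure.prod_apply hE',
      ← lintegral_const_mul _ (measurable_measure_prodMk_left hE')]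
    refine lintegral_congr fun S => ?_
    rw [dataLaw_apply (measurable_prodMk_left (hm.inter hE))]
    simp [Set.preimage]
  rw [errPlus, Measure.real, cond_apply hm, hs, hst, ← mul_assoc,
    ENNReal.inv_mul_cancel (by simpa using h0) (by simp), one_mul]
  rfl

lemma errMinus_eq (h0 : 0 < π) (h1 : π < 1) [IsProbabilityMeasure (noiseLaw ν)]
    (hsvm : Measurable svm) :
    errMinus π μ ν svm = ((Measure.pi fun _ : Fin n => dataLaw π μ ν).prod (noiseLaw ν)).real
      {w | 0 < logit (svm w.1) (-μ + w.2)} := by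
  have := isProbabilityMeasure_dataLaw (μ := μ) (ν := ν) h0.le h1.le
  have hm : MeasurableSet {w : (Fin n → Point d) × Point d | w.2.2 = false} :=
    measurable_snd.snd (measurableSet_singleton false)
  have hE : MeasurableSet {w : (Fin n → Point d) × Point d | 0 < logit (svm w.1) w.2.1} :=
    measurableSet_lt measurable_const (measurable_logit hsvm measurable_fst measurable_snd.fst)
  have hE' : MeasurableSet {w : (Fin n → Point d) × EuclideanSpace ℝ (Fin d) |
      0 < logit (svm w.1) (-μ + w.2)} :=
    measurableSet_lt measurable_const (measurable_logit hsvm measurable_fst (by fun_prop))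
  have hs : jointLaw n π μ ν {w | w.2.2 = false} = ENNReal.ofReal (1 - π) := by
    rw [jointLaw, Measure.prod_apply hm]
    simp only [Set.preimage, Set.mem_ofPred_eq]
    rw [dataLaw_apply (A := {x : Point d | x.2 = false})
      (measurable_snd (measurableSet_singleton false))]
    simp
  have hst : jointLaw n π μ ν ({w | w.2.2 = false} ∩ {w | 0 < logit (svm w.1) w.2.1}) =
      ENNReal.ofReal (1 - π) * ((Measure.pi fun _ : Fin n => dataLaw π μ ν).prod (noiseLaw ν))
      {w | 0 < logit (svm w.1) (-μ + w.2)} := by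
    rw [jointLaw, Measure.prod_apply (hm.inter hE), Measure.prod_apply hE',
      ← lintegral_const_mul _ (measurable_measure_prodMk_left hE')]
    refine lintegral_congr fun S => ?_
    rw [dataLaw_apply (measurable_prodMk_left (hm.inter hE))]
    simp [Set.preimage]
  rw [errMinus, Measure.real, cond_apply hm, hs, hst, ← mul_assoc,
    ENNReal.inv_mul_cancel (by simpa using h1) (by simp), one_mul]
  rfl

/-- A set of training sets and test noises is unlikely if, outside an unlikely event, it requires
a large component of the test noise in the direction of `β`. -/
lemma IsSubGaussianNoise.measureReal_train_test_le (hν : IsSubGaussianNoise C ν) (h0 : 0 ≤ π)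
    (h1 : π ≤ 1) (hsvm : Measurable svm) {A : ℝ} (hA : 0 < A)
    {bad : Set ((Fin n → Bool) × (Fin n → EuclideanSpace ℝ (Fin d)))}
    {T : Set ((Fin n → Point d) × EuclideanSpace ℝ (Fin d))} (hT : MeasurableSet T)
    (h : ∀ y Z, (y, Z) ∉ bad → ‖(svm (trainingSet μ y Z)).1‖ ≤ 1 ∧
      ∀ z, |inner ℝ z (svm (trainingSet μ y Z)).1| ≤ A → (trainingSet μ y Z, z) ∉ T) :
    ((Measure.pi fun _ : Fin n => dataLaw π μ ν).prod (noiseLaw ν)).real T ≤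
      ((labelSample n π).prod (noiseSample n ν)).real bad + 1 / A ^ 2 := by
  have := hν.isProbabilityMeasure_noiseLaw
  have := hν.isProbabilityMeasure_noiseSample (n := n)
  have := isProbabilityMeasure_labelSample (n := n) h0 h1
  have := isProbabilityMeasure_dataLaw (μ := μ) (ν := ν) h0 h1
  set β : (Fin n → Bool) × (Fin n → EuclideanSpace ℝ (Fin d)) → EuclideanSpace ℝ (Fin d) :=
    fun w => (svm (trainingSet μ w.1 w.2)).1 with hβ
  have hβm : Measurable β := (hsvm.comp (measurable_trainingSet μ)).fst
  set P := (labelSample n π).prod (noiseSample n ν) with hP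
  have hmap : (Measure.pi fun _ : Fin n => dataLaw π μ ν).prod (noiseLaw ν) =
      (P.prod (noiseLaw ν)).map (fun w => (trainingSet μ w.1.1 w.1.2, w.2)) := by
    rw [pi_dataLaw_eq_map h0 h1]
    have := Measure.map_prod_map P (noiseLaw ν) (measurable_trainingSet μ) measurable_id
    rw [Measure.map_id] at this
    exact this
  have hmeas : Measurable fun w : ((Fin n → Bool) × (Fin n → EuclideanSpace ℝ (Fin d))) ×
      EuclideanSpace ℝ (Fin d) => (trainingSet μ w.1.1 w.1.2, w.2) :=
    ((measurable_trainingSet μ).comp measurable_fst).prodMk measurable_snd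
  -- The norm restriction matters: when a class is empty `svm` is arbitrary, and its direction may
  -- be long.
  set large : Set (((Fin n → Bool) × (Fin n → EuclideanSpace ℝ (Fin d))) ×
      EuclideanSpace ℝ (Fin d)) := {w | ‖β w.1‖ ≤ 1 ∧ A < |inner ℝ w.2 (β w.1)|} with hlarge
  have hlm : MeasurableSet large :=
    (measurableSet_le (f := fun w : ((Fin n → Bool) × (Fin n → EuclideanSpace ℝ (Fin d))) ×
      EuclideanSpace ℝ (Fin d) => ‖β w.1‖) (by fun_prop) measurable_const).inter
    (measurableSet_lt (g := fun w : ((Fin n → Bool) × (Fin n → EuclideanSpace ℝ (Fin d))) ×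
      EuclideanSpace ℝ (Fin d) => |inner ℝ w.2 (β w.1)|) measurable_const (by fun_prop))
  have hle : (P.prod (noiseLaw ν)) large ≤ ENNReal.ofReal (1 / A ^ 2) := by
    rw [Measure.prod_apply hlm]
    calc ∫⁻ w, noiseLaw ν (Prod.mk w ⁻¹' large) ∂P ≤ ∫⁻ _, ENNReal.ofReal (1 / A ^ 2) ∂P := by
          refine lintegral_mono fun w => ?_
          by_cases hw : ‖β w‖ ≤ 1
          · refine (measure_mono fun z hz => ?_).trans (hν.measure_le_abs_inner_le (β w) hw hA)
            exact hz.2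
          · have : Prod.mk w ⁻¹' large = ∅ := by
              ext z; simp [hlarge, hw]
            rw [this]; simp
      _ = _ := by simp
  have hle' := measureReal_le_of_le_ofReal (by positivity) hle
  have hbad : (P.prod (noiseLaw ν)).real (bad ×ˢ Set.univ) = P.real bad := by
    simp [Measure.real]
  rw [hmap, map_measureReal_apply hmeas hT]
  calc (P.prod (noiseLaw ν)).real ((fun w => (trainingSet μ w.1.1 w.1.2, w.2)) ⁻¹' T)
      ≤ (P.prod (noiseLaw ν)).real (bad ×ˢ Set.univ ∪ large) := by
        refine measureReal_mono fun w hw => ?_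
        by_cases hwb : w.1 ∈ bad
        · exact Or.inl ⟨hwb, Set.mem_univ _⟩
        · right
          obtain ⟨h2, h3⟩ := h w.1.1 w.1.2 hwb
          refine ⟨h2, ?_⟩
          by_contra hc
          exact h3 w.2 (not_lt.1 hc) hw
    _ ≤ _ := measureReal_union_le _ _
    _ ≤ _ := by rw [hbad]; gcongr

/-- Since the first factor is finite, `s` is a finite union of slices and needs no measurability.
Bounds for fixed labels can thus be integrated for events such as `IsNoisy`. -/
lemma measureReal_prod_le {α β : Type*} [MeasurableSpace α] [MeasurableSpace β] [Fintype α]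
    [MeasurableSingletonClass α] {P : Measure α} {Q : Measure β} [IsProbabilityMeasure P]
    [IsProbabilityMeasure Q] {s : Set (α × β)} {B : Set α} {δ : ℝ} (hδ : 0 ≤ δ)
    (h : ∀ a ∉ B, Q.real {b | (a, b) ∈ s} ≤ δ) : (P.prod Q).real s ≤ P.real B + δ := by
  classical
  have hs : s = ⋃ a, {a} ×ˢ {b | (a, b) ∈ s} := by ext ⟨a, b⟩; simp
  have hsum : ∑ a, P.real {a} = 1 := by
    rw [← measureReal_biUnion_finset (fun a _ b _ hab => by simpa using hab) fun a _ =>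
      measurableSet_singleton a]
    have : ⋃ b ∈ (Finset.univ : Finset α), {b} = (Set.univ : Set α) := by ext; simp
    rw [this, probReal_univ]
  have hB : P.real B = ∑ a, if a ∈ B then P.real {a} else 0 := by
    rw [← Finset.sum_filter, ← measureReal_biUnion_finset
      (fun a _ b _ hab => by simpa using hab) fun a _ => measurableSet_singleton a]
    congr 1
    ext; simp
  calc (P.prod Q).real s ≤ ∑ a, (P.prod Q).real ({a} ×ˢ {b | (a, b) ∈ s}) := by
        conv_lhs => rw [hs]
        exact measureReal_iUnion_fintype_le _
    _ = ∑ a, P.real {a} * Q.real {b | (a, b) ∈ s} := by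
        refine Finset.sum_congr rfl fun a _ => ?_
        rw [measureReal_prod_prod]
    _ ≤ ∑ a, ((if a ∈ B then P.real {a} else 0) + P.real {a} * δ) := by
        refine Finset.sum_le_sum fun a _ => ?_
        split_ifs with ha
        · have h1 : Q.real {b | (a, b) ∈ s} ≤ 1 := measureReal_le_one
          have h2 : 0 ≤ P.real {a} := measureReal_nonneg
          nlinarith
        · have h2 : 0 ≤ P.real {a} := measureReal_nonneg
          have := h a ha
          rw [zero_add]; gcongr
    _ = P.real B + δ := by
        rw [Finset.sum_add_distrib, ← hB, ← Finset.sum_mul, hsum, one_mul]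

end Errors

/-! ### Probability bounds for the training sample -/

section Typical

variable {d n : ℕ} {C : ℝ≥0} {ν : Fin d → Measure ℝ} {μ : EuclideanSpace ℝ (Fin d)}
  {y : Fin n → Bool} {t : ℝ}

/-- A bound for the probability that one of `n` standardized noise variables exceeds `t`. -/
noncomputable def maxTail (C : ℝ≥0) (n : ℕ) (t : ℝ) : ℝ :=
  n * (2 * Real.exp (-t ^ 2 / (2 * varianceProxy C)))

/-- The squared norm of the majority noise average has mean `d` divided by the class size, which is
small because `n` dominates `d`. -/
lemma IsSubGaussianNoise.measureReal_not_isTypical_le (hν : IsSubGaussianNoise C ν) (ht : 0 ≤ t)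
    (hmaj : (majorityIdx y).Nonempty) :
    (noiseSample n ν).real {Z | ¬ IsTypical t μ y Z} ≤
      d / (majorityIdx y).card + maxTail C n t := by
  have := hν.isProbabilityMeasure_noiseSample (n := n)
  have hcard : (0 : ℝ) < (majorityIdx y).card := by exact_mod_cast hmaj.card_pos
  have h1 := hν.measureReal_lt_norm_sum_le (majorityIdx y) hcard
  have h2 := hν.measureReal_exists_lt_abs_inner_le (n := n) μ ht
  have h3 : ((majorityIdx y).card : ℝ) * d / ((majorityIdx y).card : ℝ) ^ 2 =
      d / (majorityIdx y).card := by field_simp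
  rw [h3] at h1
  refine le_trans (measureReal_mono fun Z hZ => ?_)
    ((measureReal_union_le _ _).trans (add_le_add h1 h2))
  by_contra hc
  simp only [Set.mem_union, Set.mem_ofPred_eq, not_or, not_lt, not_exists] at hc
  exact hZ ⟨hc.1, hc.2⟩

/-- The tolerance `t √(N d)` is chosen so that in a union of Chebyshev bounds over the `N` minority
points both `N` and `d` cancel. -/
lemma IsSubGaussianNoise.measureReal_not_isSpread_le (hν : IsSubGaussianNoise C ν) (ht : 0 < t)
    (hd : 1 ≤ d) (hmin : (minorityIdx y).Nonempty) :
    (noiseSample n ν).real {Z | ¬ IsSpread t μ y Z} ≤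
      maxTail C n t + 96 * (varianceProxy C : ℝ) ^ 2 / t ^ 2 := by
  have := hν.isProbabilityMeasure_noiseSample (n := n)
  have hcard : (0 : ℝ) < (minorityIdx y).card := by exact_mod_cast hmin.card_pos
  have hd' : (0 : ℝ) < d := by exact_mod_cast hd
  have hq : 0 < Real.sqrt ((minorityIdx y).card * d) := Real.sqrt_pos.2 (by positivity)
  have h1 := hν.measureReal_exists_lt_abs_inner_sum_erase_le ((2 : ℝ) • μ) (minorityIdx y) ht.le
  have h2 := hν.measureReal_exists_lt_abs_norm_sq_sub_le (minorityIdx y)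
    (T := t * Real.sqrt ((minorityIdx y).card * d)) (by positivity)
  have h3 : ((minorityIdx y).card : ℝ) * (96 * (varianceProxy C : ℝ) ^ 2 * d /
      (t * Real.sqrt ((minorityIdx y).card * d)) ^ 2) =
      96 * (varianceProxy C : ℝ) ^ 2 / t ^ 2 := by
    rw [mul_pow, Real.sq_sqrt (by positivity)]
    field_simp
  rw [h3] at h2
  refine le_trans (measureReal_mono fun Z hZ => ?_)
    ((measureReal_union_le _ _).trans (add_le_add h1 h2))
  by_contra hc
  simp only [Set.mem_union, Set.mem_ofPred_eq, not_or, not_lt, not_exists, not_and] at hc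
  exact hZ ⟨hc.1, hc.2⟩

/-- The noise level of the average of a class with `M` points. -/
noncomputable def noiseLevel (d : ℕ) (M : ℝ) : ℝ := Real.sqrt (d / M)

lemma noiseLevel_sq {M : ℝ} (hM : 0 < M) : noiseLevel d M ^ 2 = d / M :=
  Real.sq_sqrt (by positivity)

/-- With `N` between `M / 2` and `3 M / 2`, the ratio `‖H‖ / N` lies between `L √(2/3) / 2` and `2
√2 L`. The constants `2 / 5` and `8 * (2 / 5)` enclose this range. -/
lemma isNoisy_of_isSpread {M : ℝ} {Z : Fin n → EuclideanSpace ℝ (Fin d)} (hM : 0 < M)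
    (hd : 1 ≤ d) (ht : 0 ≤ t) (hmaj : (majorityIdx y).Nonempty)
    (hlow : M / 2 ≤ (minorityIdx y).card) (hupp : (minorityIdx y).card ≤ 3 * (M / 2))
    (h1 : 160 * t ≤ noiseLevel d M) (h2 : 20 * ‖μ‖ ≤ noiseLevel d M)
    (htyp : IsTypical t μ y Z) (hsp : IsSpread t μ y Z) :
    IsNoisy t (2 / 5 * noiseLevel d M) μ y Z := by
  have hd' : (0 : ℝ) < d := by exact_mod_cast hd
  have hcard : (0 : ℝ) < (minorityIdx y).card := by linarith
  have hmin : (minorityIdx y).Nonempty := by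
    rw [← Finset.card_pos]; exact_mod_cast hcard
  have hL2 := noiseLevel_sq (d := d) hM
  have hLpos : 0 < noiseLevel d M := Real.sqrt_pos.2 (by positivity)
  obtain ⟨N, hN⟩ : ∃ N : ℝ, N = (minorityIdx y).card := ⟨_, rfl⟩
  obtain ⟨L, hL⟩ : ∃ L : ℝ, L = noiseLevel d M := ⟨_, rfl⟩
  obtain ⟨q, hq⟩ : ∃ q : ℝ, q = Real.sqrt (N * d) := ⟨_, rfl⟩
  rw [← hN] at hlow hupp hcard
  rw [← hL] at h1 h2 hL2 hLpos ⊢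
  have hd2 : (d : ℝ) = L ^ 2 * M := by rw [hL2]; field_simp
  have hq2 : q ^ 2 = N * d := by rw [hq]; exact Real.sq_sqrt (by positivity)
  have hq0 : 0 ≤ q := by rw [hq]; exact Real.sqrt_nonneg _
  -- `5 / 4` exceeds `√(3 / 2)`. The constants `160` and `20` then give `112 t q ≤ d` and `16 ‖μ‖ q
  -- ≤ d`.
  have hqL : q * L ≤ 5 / 4 * d := by
    refine abs_le_of_sq_le_sq' ?_ (by positivity) |>.2
    rw [mul_pow, hq2, mul_pow]
    have : N * d * L ^ 2 ≤ 3 * (M / 2) * d * L ^ 2 := by gcongr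
    have h5 : 3 * (M / 2) * d * L ^ 2 = 3 / 2 * (d : ℝ) ^ 2 := by
      conv_rhs => rw [sq, hd2]
      rw [hd2]; ring
    nlinarith [sq_nonneg (d : ℝ)]
  have c1 : 112 * t * q ≤ d := by
    have := mul_le_mul_of_nonneg_left h1 hq0
    nlinarith
  have c2 : 16 * ‖μ‖ * q ≤ d := by
    have := mul_le_mul_of_nonneg_left h2 hq0
    nlinarith
  obtain ⟨g1, g2, g3⟩ := hsp.norm_shiftedSum_and_gap htyp ht hd hmin
    (by rw [← hN, ← hq]; exact c1) (by rw [← hN, ← hq]; exact c2)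
  rw [← hN, ← hq] at g1 g2
  refine ⟨htyp, hmin, hmaj, by positivity, ?_, ?_, by linarith, g3⟩
  · rw [← hN]
    refine le_trans ?_ g1
    refine abs_le_of_sq_le_sq' ?_ (by positivity) |>.2
    have : N * (L ^ 2 * N) ≤ N * (L ^ 2 * (3 * (M / 2))) := by gcongr
    rw [div_pow, hq2, hd2]
    nlinarith [mul_pos hcard (mul_pos (pow_pos hLpos 2) hM)]
  · rw [← hN]
    refine le_trans g2 ?_
    refine abs_le_of_sq_le_sq' ?_ (by positivity) |>.2
    have : N * (L ^ 2 * (M / 2)) ≤ N * (L ^ 2 * N) := by gcongr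
    rw [mul_pow, hq2, hd2]
    nlinarith [mul_pos hcard (mul_pos (pow_pos hLpos 2) hM)]

variable {π : ℝ}

/-- The labels for which the size of the minority class is close to its mean. -/
def IsBalancedLabels (π : ℝ) (y : Fin n → Bool) : Prop :=
  n * π / 2 ≤ (minorityIdx y).card ∧ (minorityIdx y).card ≤ 3 * (n * π / 2)

lemma IsBalancedLabels.nonempty_minority (hy : IsBalancedLabels π y) (hM : 0 < n * π) :
    (minorityIdx y).Nonempty := by
  rw [← Finset.card_pos]
  have : (0 : ℝ) < (minorityIdx y).card := lt_of_lt_of_le (by linarith) hy.1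
  exact_mod_cast this

lemma IsBalancedLabels.half_le_card_majority (hy : IsBalancedLabels π y) (hπ : π ≤ 1 / 3) :
    (n : ℝ) / 2 ≤ (majorityIdx y).card := by
  have h1 : ((minorityIdx y).card : ℝ) + (majorityIdx y).card = n := by
    exact_mod_cast card_minority_add_card_majority y
  have h2 := hy.2
  have : (n : ℝ) * π ≤ n * (1 / 3) := by gcongr
  linarith

lemma IsBalancedLabels.nonempty_majority (hy : IsBalancedLabels π y) (hπ : π ≤ 1 / 3)
    (hn : 0 < n) : (majorityIdx y).Nonempty := by
  rw [← Finset.card_pos]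
  have hn' : (0 : ℝ) < n := by exact_mod_cast hn
  have : (0 : ℝ) < (majorityIdx y).card :=
    lt_of_lt_of_le (by linarith) (hy.half_le_card_majority hπ)
  exact_mod_cast this

/-- A bound for the probability that the noise of the sample is not typical. -/
noncomputable def typicalBound (C : ℝ≥0) (d n : ℕ) (t : ℝ) : ℝ := d / (n / 2) + maxTail C n t

lemma IsSubGaussianNoise.measureReal_not_isTypical_le' (hν : IsSubGaussianNoise C ν) (ht : 0 ≤ t)
    (hy : IsBalancedLabels π y) (hπ : π ≤ 1 / 3) (hn : 0 < n) :
    (noiseSample n ν).real {Z | ¬ IsTypical t μ y Z} ≤ typicalBound C d n t := by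
  have hn' : (0 : ℝ) < n := by exact_mod_cast hn
  refine (hν.measureReal_not_isTypical_le ht (hy.nonempty_majority hπ hn)).trans ?_
  have := hy.half_le_card_majority hπ
  unfold typicalBound
  gcongr

/-- The event used in the high signal regime. -/
structure IsQuiet (t r : ℝ) (μ : EuclideanSpace ℝ (Fin d)) (y : Fin n → Bool)
    (Z : Fin n → EuclideanSpace ℝ (Fin d)) : Prop where
  isTypical : IsTypical t μ y Z
  nonempty_minority : (minorityIdx y).Nonempty
  nonempty_majority : (majorityIdx y).Nonempty
  norm_sum_le : ‖∑ i ∈ minorityIdx y, Z i‖ / (minorityIdx y).card ≤ r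

/-- Markov's inequality for the squared norm of the minority noise average, whose mean `d / N` is at
most twice the squared noise level. -/
lemma IsSubGaussianNoise.measureReal_not_isQuiet_le (hν : IsSubGaussianNoise C ν) (ht : 0 < t)
    (hy : IsBalancedLabels π y) (hπ0 : 0 < π) (hπ : π ≤ 1 / 3) (hn : 0 < n) (hd : 1 ≤ d) :
    (noiseSample n ν).real {Z | ¬ IsQuiet t (t * noiseLevel d (n * π)) μ y Z} ≤
      typicalBound C d n t + 2 / t ^ 2 := by
  have := hν.isProbabilityMeasure_noiseSample (n := n)
  have hn' : (0 : ℝ) < n := by exact_mod_cast hn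
  have hd' : (0 : ℝ) < d := by exact_mod_cast hd
  have hM : 0 < n * π := by positivity
  have hmin := hy.nonempty_minority hM
  have hcard : (0 : ℝ) < (minorityIdx y).card := by exact_mod_cast hmin.card_pos
  have hL2 := noiseLevel_sq (d := d) hM
  have hLpos : 0 < noiseLevel d (n * π) := Real.sqrt_pos.2 (by positivity)
  have h1 := hν.measureReal_not_isTypical_le' (μ := μ) ht.le hy hπ hn
  have h2 := hν.measureReal_lt_norm_sum_le (minorityIdx y)
    (r := t * noiseLevel d (n * π) * (minorityIdx y).card) (by positivity)
  have h3 : ((minorityIdx y).card : ℝ) * d /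
      (t * noiseLevel d (n * π) * (minorityIdx y).card) ^ 2 ≤ 2 / t ^ 2 := by
    rw [mul_pow, mul_pow, hL2]
    have e1 : ((minorityIdx y).card : ℝ) * d /
        (t ^ 2 * (d / (n * π)) * ((minorityIdx y).card : ℝ) ^ 2) =
        n * π / (minorityIdx y).card / t ^ 2 := by
      field_simp
    rw [e1]
    gcongr
    rw [div_le_iff₀ hcard]
    linarith [hy.1]
  refine le_trans (measureReal_mono fun Z hZ => ?_)
    ((measureReal_union_le _ _).trans (add_le_add h1 (h2.trans h3)))
  by_contra hc
  simp only [Set.mem_union, Set.mem_ofPred_eq, not_or, not_lt, not_not] at hc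
  exact hZ ⟨hc.1, hmin, hy.nonempty_majority hπ hn, by rw [div_le_iff₀ hcard]; exact hc.2⟩

/-- A bound for the probability that the sample is not noisy. -/
noncomputable def noisyBound (C : ℝ≥0) (d n : ℕ) (t : ℝ) : ℝ :=
  typicalBound C d n t + (maxTail C n t + 96 * (varianceProxy C : ℝ) ^ 2 / t ^ 2)

lemma IsSubGaussianNoise.measureReal_not_isNoisy_le (hν : IsSubGaussianNoise C ν) (ht : 0 < t)
    (hy : IsBalancedLabels π y) (hπ0 : 0 < π) (hπ : π ≤ 1 / 3) (hn : 0 < n) (hd : 1 ≤ d)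
    (h1 : 160 * t ≤ noiseLevel d (n * π)) (h2 : 20 * ‖μ‖ ≤ noiseLevel d (n * π)) :
    (noiseSample n ν).real {Z | ¬ IsNoisy t (2 / 5 * noiseLevel d (n * π)) μ y Z} ≤
      noisyBound C d n t := by
  have := hν.isProbabilityMeasure_noiseSample (n := n)
  have hn' : (0 : ℝ) < n := by exact_mod_cast hn
  have hM : 0 < n * π := by positivity
  have e1 := hν.measureReal_not_isTypical_le' (μ := μ) ht.le hy hπ hn
  have e2 := hν.measureReal_not_isSpread_le (μ := μ) ht hd (hy.nonempty_minority hM)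
  refine le_trans (measureReal_mono fun Z hZ => ?_)
    ((measureReal_union_le _ _).trans (add_le_add e1 e2))
  by_contra hc
  simp only [Set.mem_union, Set.mem_ofPred_eq, not_or, not_not] at hc
  exact hZ (isNoisy_of_isSpread hM hd ht.le (hy.nonempty_majority hπ hn) hy.1 hy.2 h1 h2
    hc.1 hc.2)

/-- The event used in the low signal regime: the sample is noisy, and many majority points exceed
the level `K` in the direction of the sum of the minority noise. -/
structure IsExceeded (t l K p : ℝ) (μ : EuclideanSpace ℝ (Fin d)) (y : Fin n → Bool)
    (Z : Fin n → EuclideanSpace ℝ (Fin d)) : Prop where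
  isNoisy : IsNoisy t l μ y Z
  le_sum : p / 2 * (majorityIdx y).card ≤
    ∑ j ∈ majorityIdx y, exceed K (∑ i ∈ minorityIdx y, Z i) (Z j)
  norm_sum_le : ‖∑ j ∈ majorityIdx y, exceed K (∑ i ∈ minorityIdx y, Z i) (Z j) • Z j‖ ≤
    t * (majorityIdx y).card

/-- A bound for the probability that the sample is not exceeded. -/
noncomputable def exceededBound (C : ℝ≥0) (d n : ℕ) (t p η : ℝ) : ℝ :=
  noisyBound C d n t + (240000 * (varianceProxy C : ℝ) ^ 2 / (η * d) +
    (4 / (p * (n / 2)) + (d / (n / 2) + 1) / t ^ 2))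

lemma exists_measureReal_not_isExceeded_le (C : ℝ≥0) (K : ℝ) : ∃ p > 0, ∃ η > 0,
    ∀ (d n : ℕ) (ν : Fin d → Measure ℝ), IsSubGaussianNoise C ν →
      ∀ (μ : EuclideanSpace ℝ (Fin d)) (y : Fin n → Bool) (t π : ℝ), 0 < t →
        IsBalancedLabels π y → 0 < π → π ≤ 1 / 3 → 0 < n → 1 ≤ d →
        160 * t ≤ noiseLevel d (n * π) → 20 * ‖μ‖ ≤ noiseLevel d (n * π) →
        (noiseSample n ν).real {Z | ¬ IsExceeded t (2 / 5 * noiseLevel d (n * π)) K p μ y Z} ≤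
          exceededBound C d n t p η := by
  obtain ⟨p, hp, η, hη, hmain⟩ := exists_measureReal_delocalized_le C K
  refine ⟨p, hp, η, hη, fun d n ν hν μ y t π ht hy hπ0 hπ hn hd h1 h2 => ?_⟩
  have := hν.isProbabilityMeasure_noiseSample (n := n)
  have hn' : (0 : ℝ) < n := by exact_mod_cast hn
  have hd' : (0 : ℝ) < d := by exact_mod_cast hd
  have hM : 0 < n * π := by positivity
  have hmin := hy.nonempty_minority hM
  have hmaj := hy.nonempty_majority hπ hn
  have hcard : (0 : ℝ) < (minorityIdx y).card := by exact_mod_cast hmin.card_pos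
  have hL2 := noiseLevel_sq (d := d) hM
  have hLpos : 0 < noiseLevel d (n * π) := Real.sqrt_pos.2 (by positivity)
  have hv := varianceProxy_pos C
  obtain ⟨l, hl⟩ : ∃ l, l = 2 / 5 * noiseLevel d (n * π) := ⟨_, rfl⟩
  have hlpos : 0 < l := by rw [hl]; positivity
  rw [← hl]
  have e1 := hν.measureReal_not_isNoisy_le (μ := μ) ht hy hπ0 hπ hn hd h1 h2
  rw [← hl] at e1
  have e2 := hν.measureReal_lt_sum_pow_four_le (minorityIdx y)
    (r := η * (l * (minorityIdx y).card / 2) ^ 4) (by positivity)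
  have e3 := hmain d n ν hν _ _ (disjoint_minority_majority y) hmaj t ht
  -- Here `16 * 96 * 625 / 16 = 60000` comes from `l ^ 4`, and a factor `4` from `n π ≤ 2 N`. The
  -- remaining `1 / d` says that `S` is delocalized in high dimension.
  have e4 : (d : ℝ) * (96 * ((varianceProxy C : ℝ) * (minorityIdx y).card) ^ 2) /
      (η * (l * (minorityIdx y).card / 2) ^ 4) ≤
      240000 * (varianceProxy C : ℝ) ^ 2 / (η * d) := by
    have hl4 : l ^ 4 = 16 / 625 * (d / (n * π)) ^ 2 := by
      rw [← hL2, hl]; ring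
    have e5 : (d : ℝ) * (96 * ((varianceProxy C : ℝ) * (minorityIdx y).card) ^ 2) /
        (η * (l * (minorityIdx y).card / 2) ^ 4) =
        60000 * (varianceProxy C : ℝ) ^ 2 / (η * d) *
          (n * π / (minorityIdx y).card) ^ 2 := by
      have : (l * ((minorityIdx y).card : ℝ) / 2) ^ 4 =
        l ^ 4 * ((minorityIdx y).card : ℝ) ^ 4 / 16 := by ring
      rw [this, hl4]
      field_simp
      ring
    have e6 : n * π / (minorityIdx y).card ≤ 2 := by
      rw [div_le_iff₀ hcard]; linarith [hy.1]
    have e7 : (n * π / (minorityIdx y).card) ^ 2 ≤ 2 ^ 2 := by gcongr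
    rw [e5]
    calc 60000 * (varianceProxy C : ℝ) ^ 2 / (η * d) * (n * π / (minorityIdx y).card) ^ 2
        ≤ 60000 * (varianceProxy C : ℝ) ^ 2 / (η * d) * 2 ^ 2 := by gcongr
      _ = _ := by ring
  have e5 : 4 / (p * (majorityIdx y).card) + (d / (majorityIdx y).card + 1) / t ^ 2 ≤
      4 / (p * (n / 2)) + (d / (n / 2) + 1) / t ^ 2 := by
    have := hy.half_le_card_majority hπ
    gcongr
  refine le_trans (measureReal_mono fun Z hZ => ?_)
    ((measureReal_union_le _ _).trans (add_le_add e1 ((measureReal_union_le _ _).trans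
      (add_le_add (e2.trans e4) (e3.trans e5)))))
  by_contra hc
  simp only [Set.mem_union, Set.mem_ofPred_eq, not_or, not_lt, not_not, not_and_or] at hc
  obtain ⟨hnoisy, hdeloc, hc | hc⟩ := hc
  -- On the noisy event `‖S‖ ≥ l N / 2`, so the threshold with `l N / 2` implies the homogeneous
  -- condition with `‖S‖`.
  · have hle := hnoisy.norm_shiftedSum_sub_le.2.2
    refine hc.elim (fun h => h.not_gt hnoisy.norm_sum_pos) fun h => h ?_
    refine hdeloc.trans ?_
    gcongr
    linarith
  · exact hZ ⟨hnoisy, hc.1, hc.2⟩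

end Typical

/-! ### Comparison of sequences with powers of the dimension -/

section Powers

variable {f g : ℕ → ℝ} {p q : ℝ}

lemma isLittleO_rpow_rpow (h : p < q) :
    (fun d : ℕ => (d : ℝ) ^ p) =o[atTop] fun d : ℕ => (d : ℝ) ^ q := by
  refine (isLittleO_iff_tendsto' ?_).2 ?_
  · filter_upwards [eventually_gt_atTop 0] with d hd h0
    have : (0 : ℝ) < d := by exact_mod_cast hd
    exact absurd h0 (Real.rpow_pos_of_pos this q).ne'
  · have := (tendsto_rpow_neg_atTop (sub_pos.2 h)).comp tendsto_natCast_atTop_atTop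
    refine this.congr' ?_
    filter_upwards [eventually_gt_atTop 0] with d hd
    have : (0 : ℝ) < d := by exact_mod_cast hd
    rw [← Real.rpow_sub this, Function.comp_apply, neg_sub]

lemma isLittleO_of_rpow (hf : f =O[atTop] fun d : ℕ => (d : ℝ) ^ p)
    (hg : (fun d : ℕ => (d : ℝ) ^ q) =O[atTop] g) (h : p < q) : f =o[atTop] g :=
  (hf.trans_isLittleO (isLittleO_rpow_rpow h)).trans_isBigO hg

lemma rpow_mul_rpow_eventuallyEq (p q : ℝ) :
    (fun d : ℕ => (d : ℝ) ^ p * (d : ℝ) ^ q) =ᶠ[atTop] fun d : ℕ => (d : ℝ) ^ (p + q) := by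
  filter_upwards [eventually_gt_atTop 0] with d hd
  rw [Real.rpow_add (by exact_mod_cast hd)]

lemma isBigO_mul_rpow (hf : f =O[atTop] fun d : ℕ => (d : ℝ) ^ p)
    (hg : g =O[atTop] fun d : ℕ => (d : ℝ) ^ q) :
    (fun d => f d * g d) =O[atTop] fun d : ℕ => (d : ℝ) ^ (p + q) :=
  (hf.mul hg).trans_eventuallyEq (rpow_mul_rpow_eventuallyEq p q)

lemma isTheta_mul_rpow (hf : f =Θ[atTop] fun d : ℕ => (d : ℝ) ^ p)
    (hg : g =Θ[atTop] fun d : ℕ => (d : ℝ) ^ q) :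
    (fun d => f d * g d) =Θ[atTop] fun d : ℕ => (d : ℝ) ^ (p + q) :=
  (hf.mul hg).trans_eventuallyEq (rpow_mul_rpow_eventuallyEq p q)

lemma isTheta_inv_rpow (hf : f =Θ[atTop] fun d : ℕ => (d : ℝ) ^ p) :
    (fun d => (f d)⁻¹) =Θ[atTop] fun d : ℕ => (d : ℝ) ^ (-p) :=
  hf.inv.trans_eventuallyEq (Eventually.of_forall fun d => by
    simp [Real.rpow_neg (Nat.cast_nonneg d)])

lemma isTheta_sqrt_rpow (hf : f =Θ[atTop] fun d : ℕ => (d : ℝ) ^ p) (h0 : ∀ d, 0 ≤ f d) :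
    (fun d => √(f d)) =Θ[atTop] fun d : ℕ => (d : ℝ) ^ (p / 2) := by
  have := hf.rpow (r := 1 / 2) (Eventually.of_forall h0)
    (Eventually.of_forall fun d => Real.rpow_nonneg (Nat.cast_nonneg d) p)
  simp only [Real.sqrt_eq_rpow]
  refine this.trans_eventuallyEq (Eventually.of_forall fun d => ?_)
  simp only
  rw [← Real.rpow_mul (Nat.cast_nonneg d)]
  ring_nf

lemma tendsto_zero_of_isBigO_rpow (hf : f =O[atTop] fun d : ℕ => (d : ℝ) ^ p) (hp : p < 0) :
    Tendsto f atTop (𝓝 0) :=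
  hf.trans_tendsto (by
    simpa [Function.comp_def] using
      (tendsto_rpow_neg_atTop (neg_pos.2 hp)).comp tendsto_natCast_atTop_atTop)

lemma eventually_mul_le_of_isLittleO (h : f =o[atTop] g) (hg : ∀ d, 0 ≤ g d) {r : ℝ}
    (hr : 0 < r) : ∀ᶠ d in atTop, r * f d ≤ g d := by
  filter_upwards [h.bound (inv_pos.2 hr)] with d h1
  rw [Real.norm_eq_abs, Real.norm_of_nonneg (hg d), ← div_eq_inv_mul, le_div_iff₀' hr] at h1
  exact (mul_le_mul_of_nonneg_left (le_abs_self _) hr.le).trans h1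

lemma const_isLittleO_of_rpow (hg : (fun d : ℕ => (d : ℝ) ^ q) =O[atTop] g) (hq : 0 < q)
    (r : ℝ) : (fun _ : ℕ => r) =o[atTop] g :=
  isLittleO_of_rpow (p := 0) (by simpa using isBigO_const_const r (one_ne_zero (α := ℝ)) atTop)
    hg hq

end Powers

/-! ### The sequences of the high imbalance regime -/

section Regime

variable {a b c : ℝ} {π : ℕ → ℝ} {μ : (d : ℕ) → EuclideanSpace ℝ (Fin d)} {n : ℕ → ℕ}

lemma IsImbalanced.isTheta_norm_signal (h : IsImbalanced a b c π μ n) :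
    (fun d => ‖μ d‖) =Θ[atTop] fun d : ℕ => (d : ℝ) ^ (b / 2) := by
  have := isTheta_sqrt_rpow h.signal fun d => sq_nonneg _
  simpa [Real.sqrt_sq (norm_nonneg _)] using this

lemma IsImbalanced.isTheta_minority (h : IsImbalanced a b c π μ n) :
    (fun d => n d * π d) =Θ[atTop] fun d : ℕ => (d : ℝ) ^ (1 - (a - c)) := by
  have := isTheta_mul_rpow h.sampleSize h.ratio
  convert this using 3
  ring

lemma natCast_isTheta_rpow : (fun d : ℕ => (d : ℝ)) =Θ[atTop] fun d : ℕ => (d : ℝ) ^ (1 : ℝ) := by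
  simpa using isTheta_rfl

lemma IsImbalanced.isTheta_noiseLevel (h : IsImbalanced a b c π μ n) (hπ : ∀ d, 0 < π d) :
    (fun d => noiseLevel d (n d * π d)) =Θ[atTop] fun d : ℕ => (d : ℝ) ^ ((a - c) / 2) := by
  have h1 := isTheta_mul_rpow natCast_isTheta_rpow (isTheta_inv_rpow h.isTheta_minority)
  have h2 := isTheta_sqrt_rpow h1 fun d => by have := hπ d; positivity
  simp only [noiseLevel, div_eq_mul_inv] at h2 ⊢
  convert h2 using 3
  ring

lemma IsImbalanced.eventually_ratio_le (h : IsImbalanced a b c π μ n) (ha : 0 < a) :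
    ∀ᶠ d in atTop, π d ≤ 1 / 3 :=
  (tendsto_zero_of_isBigO_rpow h.ratio.1 (by linarith)).eventually_le_const (by norm_num)

lemma IsImbalanced.eventually_sampleSize_pos (h : IsImbalanced a b c π μ n) (hc : 0 < c) :
    ∀ᶠ d in atTop, 0 < n d := by
  have h1 := const_isLittleO_of_rpow h.sampleSize.2 (by linarith) 1
  filter_upwards [eventually_mul_le_of_isLittleO h1 (fun d => by positivity) one_pos] with d hd
  rw [one_mul] at hd
  exact_mod_cast zero_lt_one.trans_le hd

lemma IsImbalanced.tendsto_dim_div (h : IsImbalanced a b c π μ n) (hc : 0 < c) :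
    Tendsto (fun d : ℕ => (d : ℝ) / ((n d : ℝ) / 2)) atTop (𝓝 0) := by
  have h1 := isTheta_mul_rpow natCast_isTheta_rpow (isTheta_inv_rpow h.sampleSize)
  have h2 := (tendsto_zero_of_isBigO_rpow h1.1 (by linarith)).const_mul 2
  rw [mul_zero] at h2
  refine h2.congr fun d => ?_
  rw [div_div_eq_mul_div, div_eq_mul_inv]
  ring

lemma IsImbalanced.tendsto_inv_sampleSize (h : IsImbalanced a b c π μ n) (hc : 0 < c) :
    Tendsto (fun d : ℕ => (n d : ℝ)⁻¹) atTop (𝓝 0) :=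
  tendsto_zero_of_isBigO_rpow (isTheta_inv_rpow h.sampleSize).1 (by linarith)

variable {ε : ℝ}

/-- The tail at `d ^ ε` decays faster than any power of `d`; comparison with `d ^ (-(c + 2))` leaves
`d ^ (-1)` after multiplying by `n`. -/
lemma IsImbalanced.tendsto_maxTail (h : IsImbalanced a b c π μ n) (hε : 0 < ε) (C : ℝ≥0) :
    Tendsto (fun d => maxTail C (n d) ((d : ℝ) ^ ε)) atTop (𝓝 0) := by
  have hv : (0 : ℝ) < varianceProxy C := by exact_mod_cast varianceProxy_pos C
  have h1 : Tendsto (fun d : ℕ => (d : ℝ) ^ (2 * ε)) atTop atTop :=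
    (tendsto_rpow_atTop (by linarith)).comp tendsto_natCast_atTop_atTop
  have h2 : (fun d : ℕ => Real.exp (-(1 / (2 * varianceProxy C)) * (d : ℝ) ^ (2 * ε))) =o[atTop]
      fun d : ℕ => ((d : ℝ) ^ (2 * ε)) ^ (-(c + 2) / (2 * ε)) :=
    (isLittleO_exp_neg_mul_rpow_atTop (a := 1 / (2 * varianceProxy C)) (by positivity)
      (-(c + 2) / (2 * ε))).comp_tendsto h1
  have h3 : (fun d : ℕ => Real.exp (-(1 / (2 * varianceProxy C)) * (d : ℝ) ^ (2 * ε))) =O[atTop]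
      fun d : ℕ => (d : ℝ) ^ (-(c + 2)) := by
    refine h2.isBigO.trans_eventuallyEq (Eventually.of_forall fun d => ?_)
    simp only
    rw [← Real.rpow_mul (Nat.cast_nonneg d), mul_div_cancel₀ _ (by positivity)]
  have h4 := (tendsto_zero_of_isBigO_rpow (isBigO_mul_rpow h.sampleSize.1 h3)
    (by linarith)).const_mul 2
  rw [mul_zero] at h4
  refine h4.congr fun d => ?_
  rw [maxTail, ← Real.rpow_natCast, ← Real.rpow_mul (Nat.cast_nonneg d)]
  push_cast
  rw [mul_comm ε 2]
  ring_nf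

lemma tendsto_inv_sq_rpow (hε : 0 < ε) :
    Tendsto (fun d : ℕ => (((d : ℝ) ^ ε) ^ 2)⁻¹) atTop (𝓝 0) := by
  have h1 : Tendsto (fun d : ℕ => (d : ℝ) ^ ε) atTop atTop :=
    (tendsto_rpow_atTop hε).comp tendsto_natCast_atTop_atTop
  exact tendsto_inv_atTop_zero.comp ((tendsto_pow_atTop two_ne_zero).comp h1)

lemma IsImbalanced.tendsto_typicalBound (h : IsImbalanced a b c π μ n) (hc : 0 < c) (hε : 0 < ε)
    (C : ℝ≥0) : Tendsto (fun d => typicalBound C d (n d) ((d : ℝ) ^ ε)) atTop (𝓝 0) := by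
  simpa [typicalBound] using (h.tendsto_dim_div hc).add (h.tendsto_maxTail hε C)

lemma IsImbalanced.tendsto_noisyBound (h : IsImbalanced a b c π μ n) (hc : 0 < c) (hε : 0 < ε)
    (C : ℝ≥0) : Tendsto (fun d => noisyBound C d (n d) ((d : ℝ) ^ ε)) atTop (𝓝 0) := by
  have := (h.tendsto_typicalBound hc hε C).add ((h.tendsto_maxTail hε C).add
    ((tendsto_inv_sq_rpow hε).const_mul (96 * (varianceProxy C : ℝ) ^ 2)))
  simpa [noisyBound, div_eq_mul_inv] using this

lemma IsImbalanced.tendsto_exceededBound (h : IsImbalanced a b c π μ n) (hc : 0 < c) (hε : 0 < ε)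
    (C : ℝ≥0) (p η : ℝ) :
    Tendsto (fun d => exceededBound C d (n d) ((d : ℝ) ^ ε) p η) atTop (𝓝 0) := by
  have h1 := (tendsto_inv_atTop_zero.comp (tendsto_natCast_atTop_atTop (R := ℝ))).const_mul
    (240000 * (varianceProxy C : ℝ) ^ 2 / η)
  have h2 := (h.tendsto_inv_sampleSize hc).const_mul (8 / p)
  have h3 := ((h.tendsto_dim_div hc).add_const 1).mul (tendsto_inv_sq_rpow hε)
  have h4 := (h.tendsto_noisyBound hc hε C).add (h1.add (h2.add h3))
  simp only [mul_zero, add_zero] at h4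
  refine h4.congr fun d => ?_
  simp only [exceededBound, Function.comp_apply, div_eq_mul_inv, mul_inv, inv_inv]
  ring

end Regime

/-! ### Test errors of sequences of classifiers -/

section Limits

variable {C : ℝ≥0} {n : ℕ → ℕ} {π : ℕ → ℝ} {μ : (d : ℕ) → EuclideanSpace ℝ (Fin d)}
  {ν : (d : ℕ) → Fin d → Measure ℝ} {τ : ℕ → ℝ}
  {svm : (d : ℕ) → (Fin (n d) → Point d) → EuclideanSpace ℝ (Fin d) × ℝ}

/-- The probability that labels and noise of the training sample satisfy `good` tends to one. -/
def IsLikely (n : ℕ → ℕ) (π : ℕ → ℝ) (ν : (d : ℕ) → Fin d → Measure ℝ)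
    (good : (d : ℕ) → (Fin (n d) → Bool) → (Fin (n d) → EuclideanSpace ℝ (Fin d)) → Prop) : Prop :=
  Tendsto (fun d => ((labelSample (n d) (π d)).prod (noiseSample (n d) (ν d))).real
    {w | ¬ good d w.1 w.2}) atTop (𝓝 0)

/-- With high probability over the training sample, every solution of the SVM satisfies `p` for all
test noises with a moderate component in the direction of `β`. -/
def IsScoreBound (n : ℕ → ℕ) (π : ℕ → ℝ) (μ : (d : ℕ) → EuclideanSpace ℝ (Fin d))
    (ν : (d : ℕ) → Fin d → Measure ℝ) (τ : ℕ → ℝ)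
    (p : (d : ℕ) → EuclideanSpace ℝ (Fin d) × ℝ → EuclideanSpace ℝ (Fin d) → Prop) : Prop :=
  ∀ A > 0, ∃ good : (d : ℕ) → (Fin (n d) → Bool) → (Fin (n d) → EuclideanSpace ℝ (Fin d)) → Prop,
    IsLikely n π ν good ∧ ∀ᶠ d in atTop, ∀ y Z, good d y Z →
      (minorityIdx y).Nonempty ∧ (majorityIdx y).Nonempty ∧ ∀ β β₀ κ z,
      IsSVMSolution (τ d) (trainingSet (μ d) y Z) β β₀ κ → |inner ℝ z β| ≤ A → p d (β, β₀) z

/-- The limit over `d` is taken for fixed `A`, and `A` is adapted to the target accuracy; hence a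
good event that depends on `A` is enough. -/
lemma IsScoreBound.tendsto_measureReal (hπ : ∀ d, 0 < π d ∧ π d < 1)
    (hν : ∀ d, IsSubGaussianNoise C (ν d)) (hsvm : ∀ d, IsSVM (τ d) (svm d))
    {p : (d : ℕ) → EuclideanSpace ℝ (Fin d) × ℝ → EuclideanSpace ℝ (Fin d) → Prop}
    (h : IsScoreBound n π μ ν τ p)
    {T : (d : ℕ) → Set ((Fin (n d) → Point d) × EuclideanSpace ℝ (Fin d))}
    (hT : ∀ d, MeasurableSet (T d)) (hp : ∀ d S z, p d (svm d S) z → (S, z) ∉ T d) :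
    Tendsto (fun d => ((Measure.pi fun _ : Fin (n d) => dataLaw (π d) (μ d) (ν d)).prod
      (noiseLaw (ν d))).real (T d)) atTop (𝓝 0) := by
  rw [Metric.tendsto_nhds]
  intro δ hδ
  -- The test noise contributes `1 / A ^ 2 = δ / 2`.
  have hA : 0 < √(2 / δ) := by positivity
  obtain ⟨good, hgood, hev⟩ := h _ hA
  filter_upwards [hev, hgood.eventually_lt_const (half_pos hδ)] with d hev hgood
  rw [Real.dist_eq, sub_zero, abs_of_nonneg measureReal_nonneg]
  refine ((hν d).measureReal_train_test_le (hπ d).1.le (hπ d).2.le (hsvm d).measurable hA (hT d)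
    (bad := {w | ¬ good d w.1 w.2}) fun y Z hw => ?_).trans_lt ?_
  · obtain ⟨⟨i, hi⟩, ⟨j, hj⟩, hmain⟩ := hev y Z (by simpa using hw)
    obtain ⟨κ, hκ⟩ := (hsvm d).optimal (trainingSet (μ d) y Z)
      ⟨i, by simpa [minorityIdx, trainingSet] using hi⟩
      ⟨j, by simpa [majorityIdx, trainingSet] using hj⟩
    exact ⟨hκ.1.norm_le_one, fun z hz => hp d _ z (hmain _ _ κ z hκ hz)⟩
  · rw [Real.sq_sqrt (by positivity), one_div_div]
    linarith

lemma IsScoreBound.tendsto_errPlus_zero (hπ : ∀ d, 0 < π d ∧ π d < 1)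
    (hν : ∀ d, IsSubGaussianNoise C (ν d)) (hsvm : ∀ d, IsSVM (τ d) (svm d))
    (h : IsScoreBound n π μ ν τ fun d θ z => 0 < logit θ (μ d + z)) :
    Tendsto (fun d => errPlus (π d) (μ d) (ν d) (svm d)) atTop (𝓝 0) := by
  refine (h.tendsto_measureReal hπ hν hsvm (fun d => measurableSet_le
    (measurable_logit (hsvm d).measurable measurable_fst (measurable_snd.const_add (μ d)))
    (measurable_const (a := 0))) fun d S z hS => not_le.2 hS).congr fun d => ?_
  have := (hν d).isProbabilityMeasure_noiseLaw
  rw [errPlus_eq (hπ d).1 (hπ d).2 (hsvm d).measurable]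

lemma IsScoreBound.tendsto_errMinus_zero (hπ : ∀ d, 0 < π d ∧ π d < 1)
    (hν : ∀ d, IsSubGaussianNoise C (ν d)) (hsvm : ∀ d, IsSVM (τ d) (svm d))
    (h : IsScoreBound n π μ ν τ fun d θ z => logit θ (-μ d + z) ≤ 0) :
    Tendsto (fun d => errMinus (π d) (μ d) (ν d) (svm d)) atTop (𝓝 0) := by
  refine (h.tendsto_measureReal hπ hν hsvm (fun d => measurableSet_lt (measurable_const (a := 0))
    (measurable_logit (hsvm d).measurable measurable_fst (measurable_snd.const_add (-μ d))))
    fun d S z hS => not_lt.2 hS).congr fun d => ?_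
  have := (hν d).isProbabilityMeasure_noiseLaw
  rw [errMinus_eq (hπ d).1 (hπ d).2 (hsvm d).measurable]

lemma IsScoreBound.tendsto_errPlus_one (hπ : ∀ d, 0 < π d ∧ π d < 1)
    (hν : ∀ d, IsSubGaussianNoise C (ν d)) (hsvm : ∀ d, IsSVM (τ d) (svm d))
    (h : IsScoreBound n π μ ν τ fun d θ z => logit θ (μ d + z) ≤ 0) :
    Tendsto (fun d => errPlus (π d) (μ d) (ν d) (svm d)) atTop (𝓝 1) := by
  have hT : ∀ d, MeasurableSet {w : (Fin (n d) → Point d) × EuclideanSpace ℝ (Fin d) |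
      0 < logit (svm d w.1) (μ d + w.2)} := fun d => measurableSet_lt measurable_const
    (measurable_logit (hsvm d).measurable measurable_fst (measurable_snd.const_add (μ d)))
  have hlim := (h.tendsto_measureReal hπ hν hsvm hT fun d S z hS => not_lt.2 hS).const_sub 1
  rw [sub_zero] at hlim
  refine hlim.congr fun d => ?_
  have := (hν d).isProbabilityMeasure_noiseLaw
  have := isProbabilityMeasure_dataLaw (μ := μ d) (ν := ν d) (hπ d).1.le (hπ d).2.le
  rw [errPlus_eq (hπ d).1 (hπ d).2 (hsvm d).measurable, ← probReal_compl_eq_one_sub (hT d)]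
  congr 1
  ext w
  simp

end Limits

/-! ### Likely events in the high imbalance regime -/

section Likely

variable {a b c : ℝ} {C : ℝ≥0} {n : ℕ → ℕ} {π : ℕ → ℝ} {μ : (d : ℕ) → EuclideanSpace ℝ (Fin d)}
  {ν : (d : ℕ) → Fin d → Measure ℝ} {ε : ℝ}

/-- The labels are balanced outside an event of probability at most `4 / (n π)`, which vanishes
because `a - c < 1`. The noise bound for fixed labels handles the rest. -/
lemma IsImbalanced.isLikely_of_le (h : IsImbalanced a b c π μ n) (hc : 0 < c) (hac : a - c < 1)
    (hπ : ∀ d, 0 < π d ∧ π d < 1) (hν : ∀ d, IsSubGaussianNoise C (ν d))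
    {good : (d : ℕ) → (Fin (n d) → Bool) → (Fin (n d) → EuclideanSpace ℝ (Fin d)) → Prop}
    {δ : ℕ → ℝ} (hδ : Tendsto δ atTop (𝓝 0))
    (hle : ∀ᶠ d in atTop, ∀ y, IsBalancedLabels (π d) y →
      (noiseSample (n d) (ν d)).real {Z | ¬ good d y Z} ≤ δ d) : IsLikely n π ν good := by
  have hM := (tendsto_zero_of_isBigO_rpow (isTheta_inv_rpow h.isTheta_minority).1
    (by linarith)).const_mul 4
  rw [mul_zero] at hM
  have hlim := hM.add hδ.abs
  rw [abs_zero, add_zero] at hlim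
  refine squeeze_zero' (Eventually.of_forall fun d => measureReal_nonneg) ?_ hlim
  filter_upwards [h.eventually_sampleSize_pos hc, hle] with d hn hle
  have := (hν d).isProbabilityMeasure_noiseSample (n := n d)
  have := isProbabilityMeasure_labelSample (n := n d) (hπ d).1.le (hπ d).2.le
  refine (measureReal_prod_le (B := {y | ¬ IsBalancedLabels (π d) y}) (abs_nonneg (δ d))
    fun y hy => ?_).trans (add_le_add_left
      (measureReal_card_minority_le (hπ d).1 (hπ d).2 hn) _)
  exact (hle y (by simpa using hy)).trans (le_abs_self _)

lemma eventually_rpow_pos (ε : ℝ) : ∀ᶠ d : ℕ in atTop, 0 < (d : ℝ) ^ ε := by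
  filter_upwards [eventually_gt_atTop 0] with d hd
  exact Real.rpow_pos_of_pos (by exact_mod_cast hd) ε

lemma IsImbalanced.isLikely_isQuiet (h : IsImbalanced a b c π μ n) (ha : 0 < a) (hc : 0 < c)
    (hac : a - c < 1) (hπ : ∀ d, 0 < π d ∧ π d < 1) (hν : ∀ d, IsSubGaussianNoise C (ν d))
    (hε : 0 < ε) : IsLikely n π ν fun d => IsQuiet ((d : ℝ) ^ ε)
      ((d : ℝ) ^ ε * noiseLevel d (n d * π d)) (μ d) := by
  have h1 := (h.tendsto_typicalBound hc hε C).add ((tendsto_inv_sq_rpow hε).const_mul 2)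
  rw [mul_zero, add_zero] at h1
  refine h.isLikely_of_le hc hac hπ hν h1 ?_
  filter_upwards [h.eventually_ratio_le ha, h.eventually_sampleSize_pos hc, eventually_ge_atTop 1,
    eventually_rpow_pos ε] with d h2 h3 h4 h5 y hy
  exact (hν d).measureReal_not_isQuiet_le h5 hy (hπ d).1 h2 h3 h4

lemma noiseLevel_nonneg (d : ℕ) (M : ℝ) : 0 ≤ noiseLevel d M := Real.sqrt_nonneg _

lemma IsImbalanced.eventually_le_noiseLevel (h : IsImbalanced a b c π μ n)
    (hπ : ∀ d, 0 < π d ∧ π d < 1) {f : ℕ → ℝ} {p : ℝ} (hf : f =O[atTop] fun d : ℕ => (d : ℝ) ^ p)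
    (hp : p < (a - c) / 2) {r : ℝ} (hr : 0 < r) :
    ∀ᶠ d in atTop, r * f d ≤ noiseLevel d (n d * π d) :=
  eventually_mul_le_of_isLittleO
    (isLittleO_of_rpow hf (h.isTheta_noiseLevel fun d => (hπ d).1).2 hp)
    (fun _ => noiseLevel_nonneg _ _) hr

lemma IsImbalanced.isLikely_isNoisy (h : IsImbalanced a b c π μ n) (ha : 0 < a) (hc : 0 < c)
    (hac : a - c < 1) (hπ : ∀ d, 0 < π d ∧ π d < 1) (hν : ∀ d, IsSubGaussianNoise C (ν d))
    (hε : 0 < ε) (hε' : ε < (a - c) / 2) (hb : b < a - c) :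
    IsLikely n π ν fun d => IsNoisy ((d : ℝ) ^ ε) (2 / 5 * noiseLevel d (n d * π d)) (μ d) := by
  refine h.isLikely_of_le hc hac hπ hν (h.tendsto_noisyBound hc hε C) ?_
  filter_upwards [h.eventually_ratio_le ha, h.eventually_sampleSize_pos hc, eventually_ge_atTop 1,
    eventually_rpow_pos ε,
    h.eventually_le_noiseLevel hπ (isBigO_refl _ _) hε' (r := 160) (by norm_num),
    h.eventually_le_noiseLevel hπ h.isTheta_norm_signal.1 (by linarith) (r := 20) (by norm_num)]
    with d h2 h3 h4 h5 h6 h7 y hy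
  exact (hν d).measureReal_not_isNoisy_le h5 hy (hπ d).1 h2 h3 h4 h6 h7

lemma IsImbalanced.exists_isLikely_isExceeded (h : IsImbalanced a b c π μ n) (ha : 0 < a)
    (hc : 0 < c) (hac : a - c < 1) (hπ : ∀ d, 0 < π d ∧ π d < 1)
    (hν : ∀ d, IsSubGaussianNoise C (ν d)) (hε : 0 < ε) (hε' : ε < (a - c) / 2) (hb : b < a - c)
    (K : ℝ) : ∃ p > 0, IsLikely n π ν fun d =>
      IsExceeded ((d : ℝ) ^ ε) (2 / 5 * noiseLevel d (n d * π d)) K p (μ d) := by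
  obtain ⟨p, hp, η, -, hmain⟩ := exists_measureReal_not_isExceeded_le C K
  refine ⟨p, hp, h.isLikely_of_le hc hac hπ hν (h.tendsto_exceededBound hc hε C p η) ?_⟩
  filter_upwards [h.eventually_ratio_le ha, h.eventually_sampleSize_pos hc, eventually_ge_atTop 1,
    eventually_rpow_pos ε,
    h.eventually_le_noiseLevel hπ (isBigO_refl _ _) hε' (r := 160) (by norm_num),
    h.eventually_le_noiseLevel hπ h.isTheta_norm_signal.1 (by linarith) (r := 20) (by norm_num)]
    with d h2 h3 h4 h5 h6 h7 y hy
  exact hmain d (n d) (ν d) (hν d) (μ d) y _ (π d) h5 hy (hπ d).1 h2 h3 h4 h6 h7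

end Likely

/-! ### The signal regimes -/

section Regimes

variable {a b c : ℝ} {C : ℝ≥0} {n : ℕ → ℕ} {π : ℕ → ℝ} {μ : (d : ℕ) → EuclideanSpace ℝ (Fin d)}
  {ν : (d : ℕ) → Fin d → Measure ℝ} {τ : ℕ → ℝ}

lemma IsImbalanced.eventually_const_le_noiseLevel (h : IsImbalanced a b c π μ n)
    (hπ : ∀ d, 0 < π d ∧ π d < 1) (hac : 0 < a - c) {r : ℝ} (hr : 0 < r) :
    ∀ᶠ d in atTop, r ≤ noiseLevel d (n d * π d) := by
  simpa using eventually_mul_le_of_isLittleO (const_isLittleO_of_rpow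
    (h.isTheta_noiseLevel fun d => (hπ d).1).2 (half_pos hac) 1) (fun d => noiseLevel_nonneg _ _) hr

lemma IsImbalanced.eventually_const_le_norm (h : IsImbalanced a b c π μ n) (hb : 0 < b) {r : ℝ}
    (hr : 0 < r) : ∀ᶠ d in atTop, r ≤ ‖μ d‖ := by
  simpa using eventually_mul_le_of_isLittleO (const_isLittleO_of_rpow
    h.isTheta_norm_signal.2 (half_pos hb) 1) (fun d => norm_nonneg _) hr

lemma IsImbalanced.eventually_le_norm (h : IsImbalanced a b c π μ n) {f : ℕ → ℝ} {p : ℝ}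
    (hf : f =O[atTop] fun d : ℕ => (d : ℝ) ^ p) (hp : p < b / 2) {r : ℝ} (hr : 0 < r) :
    ∀ᶠ d in atTop, r * f d ≤ ‖μ d‖ :=
  eventually_mul_le_of_isLittleO (isLittleO_of_rpow hf h.isTheta_norm_signal.2 hp)
    (fun _ => norm_nonneg _) hr

/-- For `τ ≥ 1` the minority share of the gap is at least half, about `‖μ‖`. The choice of `ε` makes
this dominate `d ^ ε`, the constant `A`, and `d ^ ε` times the noise level. -/
lemma IsImbalanced.minority_of_high_signal (h : IsImbalanced a b c π μ n) (ha : 0 < a) (hb : 0 < b)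
    (hc : 0 < c) (hac : a - c < 1) (hπ : ∀ d, 0 < π d ∧ π d < 1)
    (hν : ∀ d, IsSubGaussianNoise C (ν d)) (hτ : ∀ d, 0 < τ d) (hacb : a - c < b)
    (hτ1 : ∀ᶠ d in atTop, 1 ≤ τ d) :
    IsScoreBound n π μ ν τ fun d θ z => 0 < logit θ (μ d + z) := by
  intro A hA
  obtain ⟨ε, hε, hε'⟩ := exists_between (lt_min (half_pos hb) (half_pos (sub_pos.2 hacb)))
  obtain ⟨hε1, hε2⟩ := lt_min_iff.1 hε'
  refine ⟨_, h.isLikely_isQuiet ha hc hac hπ hν hε, ?_⟩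
  filter_upwards [hτ1, h.eventually_const_le_norm hb (r := 8 * A) (by positivity),
    h.eventually_le_norm (isBigO_refl _ _) hε1 (r := 8) (by norm_num),
    h.eventually_le_norm (isBigO_mul_rpow (isBigO_refl _ _)
      (h.isTheta_noiseLevel fun d => (hπ d).1).1) (p := ε + (a - c) / 2) (by linarith)
      (r := 8) (by norm_num)] with d e1 e2 e3 e4 y Z hZ
  refine ⟨hZ.nonempty_minority, hZ.nonempty_majority, fun β β₀ κ z hκ hz => ?_⟩
  have hμ : 0 < ‖μ d‖ := lt_of_lt_of_le (by positivity) e2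
  have hg := hκ.two_mul_norm_sub_le_gap (hτ d) hZ.isTypical hZ.nonempty_majority hμ
  have h1 := hκ.le_logit_add (hτ d) hZ.nonempty_minority hg z
  have h2 : (2 * ‖μ d‖ - 2 * (d : ℝ) ^ ε) / (1 + τ d) ≤ (2 * ‖μ d‖ - 2 * (d : ℝ) ^ ε) / 2 :=
    div_le_div_of_nonneg_left (by linarith) two_pos (by linarith)
  have h3 := hZ.norm_sum_le
  linarith

/-- Here `κ` is at least of order `‖μ‖ / (1 + τ)`, which exceeds every constant. -/
lemma IsImbalanced.majority_of_high_signal (h : IsImbalanced a b c π μ n) (ha : 0 < a) (hb : 0 < b)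
    (hc : 0 < c) (hac : a - c < 1) (hπ : ∀ d, 0 < π d ∧ π d < 1)
    (hν : ∀ d, IsSubGaussianNoise C (ν d)) (hτ : ∀ d, 0 < τ d)
    (hτb : τ =o[atTop] fun d : ℕ => (d : ℝ) ^ (b / 2)) :
    IsScoreBound n π μ ν τ fun d θ z => logit θ (-μ d + z) ≤ 0 := by
  intro A hA
  obtain ⟨ε, hε, hε1⟩ := exists_between (half_pos hb)
  refine ⟨_, h.isLikely_isQuiet ha hc hac hπ hν hε, ?_⟩
  filter_upwards [h.eventually_const_le_norm hb (r := 4 * (A + 1)) (by positivity),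
    h.eventually_le_norm (isBigO_refl _ _) hε1 (r := 4) (by norm_num),
    eventually_mul_le_of_isLittleO (hτb.trans_isBigO h.isTheta_norm_signal.2)
      (fun d => norm_nonneg _) (r := 4 * (A + 1)) (by positivity)] with d e1 e2 e3 y Z hZ
  refine ⟨hZ.nonempty_minority, hZ.nonempty_majority, fun β β₀ κ z hκ hz => ?_⟩
  have hμ : 0 < ‖μ d‖ := lt_of_lt_of_le (by positivity) e1
  have hg := hκ.two_mul_norm_sub_le_gap (hτ d) hZ.isTypical hZ.nonempty_majority hμ
  have h1 := hκ.logit_neg_add_le (hτ d) hZ.isTypical hZ.nonempty_majority hg z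
  have hτd := hτ d
  have h2 : A + 1 ≤ (2 * ‖μ d‖ - 2 * (d : ℝ) ^ ε) / (1 + τ d) := by
    rw [le_div_iff₀ (by positivity)]
    linarith
  linarith

lemma IsNoisy.le_average {d n : ℕ} {t l : ℝ} {μ : EuclideanSpace ℝ (Fin d)} {y : Fin n → Bool}
    {Z : Fin n → EuclideanSpace ℝ (Fin d)} (hZ : IsNoisy t l μ y Z) :
    l ≤ ‖shiftedSum μ y Z‖ / (minorityIdx y).card := by
  rw [le_div_iff₀ hZ.card_pos]
  exact hZ.le_norm

lemma IsNoisy.average_le {d n : ℕ} {t l : ℝ} {μ : EuclideanSpace ℝ (Fin d)} {y : Fin n → Bool}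
    {Z : Fin n → EuclideanSpace ℝ (Fin d)} (hZ : IsNoisy t l μ y Z) :
    ‖shiftedSum μ y Z‖ / (minorityIdx y).card ≤ 8 * l := by
  rw [div_le_iff₀ hZ.card_pos, mul_assoc]
  exact hZ.norm_le

/-- The gap is at least `(2 / 5) L - 31 t ≥ (3 / 10) L`, so `κ` exceeds every constant when `τ ≪ L`.
-/
lemma IsImbalanced.majority_of_noisy (h : IsImbalanced a b c π μ n) (ha : 0 < a) (hb : 0 < b)
    (hc : 0 < c) (hac : a - c < 1) (hπ : ∀ d, 0 < π d ∧ π d < 1)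
    (hν : ∀ d, IsSubGaussianNoise C (ν d)) (hτ : ∀ d, 0 < τ d) (hbac : b < a - c)
    (hτb : τ =o[atTop] fun d : ℕ => (d : ℝ) ^ ((a - c) / 2)) :
    IsScoreBound n π μ ν τ fun d θ z => logit θ (-μ d + z) ≤ 0 := by
  intro A hA
  obtain ⟨ε, hε, hε1⟩ := exists_between (half_pos (hb.trans hbac))
  refine ⟨_, h.isLikely_isNoisy ha hc hac hπ hν hε hε1 hbac, ?_⟩
  filter_upwards [h.eventually_const_le_noiseLevel hπ (hb.trans hbac) (r := 10 * (A + 1))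
      (by positivity),
    h.eventually_le_noiseLevel hπ (isBigO_refl _ _) hε1 (r := 310) (by norm_num),
    eventually_mul_le_of_isLittleO (hτb.trans_isBigO (h.isTheta_noiseLevel fun d => (hπ d).1).2)
      (fun d => noiseLevel_nonneg _ _) (r := 10 * (A + 1)) (by positivity)] with d e1 e2 e3 y Z hZ
  refine ⟨hZ.nonempty_minority, hZ.nonempty_majority, fun β β₀ κ z hκ hz => ?_⟩
  have hg := hκ.le_gap_of_isNoisy (hτ d) hZ
  have h1 := hκ.logit_neg_add_le (hτ d) hZ.isTypical hZ.nonempty_majority hg z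
  have hτd := hτ d
  have h2 := hZ.le_average
  have h3 : A + 1 ≤ (‖shiftedSum (μ d) y Z‖ / (minorityIdx y).card - 31 * (d : ℝ) ^ ε) /
      (1 + τ d) := by
    rw [le_div_iff₀ (by positivity)]
    linarith
  linarith

/-- For bounded `τ` the margin of the majority is itself of order `L`, which pushes the intercept
below anything that the weaker signal could compensate. -/
lemma IsImbalanced.minority_of_bounded_ratio (h : IsImbalanced a b c π μ n) (ha : 0 < a)
    (hb : 0 < b) (hc : 0 < c) (hac : a - c < 1) (hπ : ∀ d, 0 < π d ∧ π d < 1)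
    (hν : ∀ d, IsSubGaussianNoise C (ν d)) (hτ : ∀ d, 0 < τ d) (hbac : b < a - c)
    (hτb : τ =O[atTop] fun d : ℕ => (d : ℝ) ^ (0 : ℝ)) :
    IsScoreBound n π μ ν τ fun d θ z => logit θ (μ d + z) ≤ 0 := by
  intro A hA
  have hac0 := hb.trans hbac
  obtain ⟨ε, hε, hε1⟩ := exists_between (half_pos hac0)
  refine ⟨_, h.isLikely_isNoisy ha hc hac hπ hν hε hε1 hbac, ?_⟩
  filter_upwards [h.eventually_const_le_noiseLevel hπ hac0 (r := 20 * (A + 1)) (by positivity),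
    h.eventually_le_noiseLevel hπ (isBigO_refl _ _) hε1 (r := 310) (by norm_num),
    h.eventually_le_noiseLevel hπ hτb (half_pos hac0) (r := 20 * (A + 1)) (by positivity),
    h.eventually_le_noiseLevel hπ h.isTheta_norm_signal.1 (by linarith) (r := 40) (by norm_num),
    h.eventually_le_noiseLevel hπ (isBigO_mul_rpow h.isTheta_norm_signal.1 hτb)
      (by linarith) (r := 40) (by norm_num)] with d e1 e2 e3 e4 e5 y Z hZ
  refine ⟨hZ.nonempty_minority, hZ.nonempty_majority, fun β β₀ κ z hκ hz => ?_⟩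
  have hg := hκ.le_gap_of_isNoisy (hτ d) hZ
  have h1 := hκ.logit_add_le (hτ d) hZ.isTypical hZ.nonempty_majority hg z
  have hτd := hτ d
  have h2 := hZ.le_average
  have h3 : 2 * ‖μ d‖ + A + 1 ≤ (‖shiftedSum (μ d) y Z‖ / (minorityIdx y).card -
      31 * (d : ℝ) ^ ε) / (1 + τ d) := by
    rw [le_div_iff₀ (by positivity)]
    linarith
  linarith

lemma IsImbalanced.minority_of_moderate_signal (h : IsImbalanced a b c π μ n) (ha : 0 < a)
    (hb : 0 < b) (hc : 0 < c) (hac : a - c < 1) (hπ : ∀ d, 0 < π d ∧ π d < 1)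
    (hν : ∀ d, IsSubGaussianNoise C (ν d)) (hτ : ∀ d, 0 < τ d) (hbac : b < a - c)
    (hacb : a - c < 2 * b) (hτb : (fun d : ℕ => (d : ℝ) ^ (a - b - c)) =o[atTop] τ) :
    IsScoreBound n π μ ν τ fun d θ z => 0 < logit θ (μ d + z) := by
  intro A hA
  have hac0 := hb.trans hbac
  have hL := h.isTheta_noiseLevel fun d => (hπ d).1
  obtain ⟨ε, hε, hε1⟩ := exists_between (show 0 < b - (a - c) / 2 by linarith)
  -- This is the order of the signal's gain `‖H‖ / N - ‖S‖ / N`; its exponent is positive exactly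
  -- when `a - c < 2 * b`.
  have hQ : (fun d => ‖μ d‖ ^ 2 * (noiseLevel d (n d * π d))⁻¹) =Θ[atTop]
      fun d : ℕ => (d : ℝ) ^ (b + -((a - c) / 2)) :=
    isTheta_mul_rpow h.signal (isTheta_inv_rpow hL)
  have hQ0 : ∀ d, 0 ≤ ‖μ d‖ ^ 2 * (noiseLevel d (n d * π d))⁻¹ := fun d =>
    mul_nonneg (sq_nonneg _) (inv_nonneg.2 (noiseLevel_nonneg _ _))
  -- The loss `g / (1 + τ)` is of order at most `L / τ`; it is negligible against `‖μ‖ ^ 2 / L`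
  -- precisely under the lower bound assumed for `τ`.
  have hτi : (fun d => noiseLevel d (n d * π d) * (τ d)⁻¹) =o[atTop]
      fun d => ‖μ d‖ ^ 2 * (noiseLevel d (n d * π d))⁻¹ := by
    have h1 : (fun d => (τ d)⁻¹) =o[atTop] fun d : ℕ => (d : ℝ) ^ (-(a - b - c)) := by
      refine (hτb.inv_rev ?_).trans_eventuallyEq (Eventually.of_forall fun d =>
        (Real.rpow_neg (Nat.cast_nonneg d) _).symm)
      filter_upwards [eventually_rpow_pos (a - b - c)] with d hd h0
      exact absurd h0 hd.ne'
    refine ((hL.1.mul_isLittleO h1).trans_eventuallyEq (rpow_mul_rpow_eventuallyEq _ _)).trans_isBigO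
      ?_
    have : (a - c) / 2 + -(a - b - c) = b + -((a - c) / 2) := by ring
    rw [this]
    exact hQ.2
  refine ⟨_, h.isLikely_isNoisy ha hc hac hπ hν hε (by linarith) hbac, ?_⟩
  filter_upwards [eventually_mul_le_of_isLittleO (const_isLittleO_of_rpow hQ.2 (by linarith) A)
      hQ0 (r := 400) (by norm_num),
    eventually_mul_le_of_isLittleO (isLittleO_of_rpow (isBigO_refl _ _) hQ.2
      (show ε < _ by linarith)) hQ0 (r := 400) (by norm_num),
    eventually_mul_le_of_isLittleO hτi hQ0 (r := 20) (by norm_num),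
    h.eventually_le_norm (isBigO_refl _ _) (show ε < _ by linarith) (r := 2) (by norm_num)]
    with d e1 e2 e3 e4 y Z hZ
  refine ⟨hZ.nonempty_minority, hZ.nonempty_majority, fun β β₀ κ z hκ hz => ?_⟩
  have hg := hκ.le_gap_of_isNoisy (hτ d) hZ
  have h1 := hκ.le_logit_add (hτ d) hZ.nonempty_minority hg z
  have hτd := hτ d
  have hl := hZ.pos
  have h2 := hZ.average_le
  have h3 := hZ.sq_div_le_norm_sub_norm e4
  have h4 : ‖μ d‖ ^ 2 / (8 * (2 / 5 * noiseLevel d (n d * π d))) =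
      5 / 16 * (‖μ d‖ ^ 2 * (noiseLevel d (n d * π d))⁻¹) := by
    have : noiseLevel d (n d * π d) ≠ 0 := by
      intro h0
      simp [h0] at hl
    field_simp
    ring
  have h5 : (‖shiftedSum (μ d) y Z‖ / (minorityIdx y).card - 31 * (d : ℝ) ^ ε) / (1 + τ d) ≤
      16 / 5 * (noiseLevel d (n d * π d) * (τ d)⁻¹) := by
    have : (0 : ℝ) ≤ (d : ℝ) ^ ε := Real.rpow_nonneg (Nat.cast_nonneg d) ε
    calc _ ≤ 16 / 5 * noiseLevel d (n d * π d) / (1 + τ d) := by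
          gcongr
          linarith
      _ ≤ 16 / 5 * noiseLevel d (n d * π d) / τ d := by
          have := noiseLevel_nonneg d (n d * π d)
          gcongr
          linarith
      _ = _ := by rw [div_eq_mul_inv, mul_assoc]
  rw [h4] at h3
  linarith

lemma IsImbalanced.minority_of_low_signal (h : IsImbalanced a b c π μ n) (ha : 0 < a)
    (hb : 0 < b) (hc : 0 < c) (hac : a - c < 1) (hπ : ∀ d, 0 < π d ∧ π d < 1)
    (hν : ∀ d, IsSubGaussianNoise C (ν d)) (hτ : ∀ d, 0 < τ d) (hbac : 2 * b < a - c) :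
    IsScoreBound n π μ ν τ fun d θ z => logit θ (μ d + z) ≤ 0 := by
  intro A hA
  obtain ⟨ε, hε, hε1⟩ := exists_between (show 0 < ((a - c) / 2 - b) / 3 by linarith)
  -- The level `A + 5` pays for `2 ⟨μ, β⟩ ≤ 4`, the test noise `A` and a direction error of `1`.
  obtain ⟨p, hp, hlikely⟩ := h.exists_isLikely_isExceeded ha hc hac hπ hν hε (by linarith)
    (by linarith) (A + 5)
  have ht : (fun d : ℕ => (d : ℝ) ^ ε) =O[atTop] fun d : ℕ => (d : ℝ) ^ ε := isBigO_refl _ _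
  have hm := h.isTheta_norm_signal.1
  refine ⟨_, hlikely, ?_⟩
  filter_upwards [eventually_mul_le_of_isLittleO (const_isLittleO_of_rpow ht hε 1)
      (fun d => Real.rpow_nonneg (Nat.cast_nonneg d) ε) one_pos,
    h.eventually_le_noiseLevel hπ ht (by linarith) (r := 310) (by norm_num),
    h.eventually_le_noiseLevel hπ h.signal.1 (by linarith) (r := 10) (by norm_num),
    h.eventually_le_noiseLevel hπ (isBigO_mul_rpow ht hm) (by linarith) (r := 5) (by norm_num),
    h.eventually_le_noiseLevel hπ (isBigO_mul_rpow ht h.signal.1) (by linarith) (r := 160)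
      (by norm_num),
    h.eventually_le_noiseLevel hπ (isBigO_mul_rpow ht (isBigO_mul_rpow ht ht)) (by linarith)
      (r := 2560 / p ^ 2) (by positivity),
    h.eventually_le_noiseLevel hπ (isBigO_mul_rpow ht (isBigO_mul_rpow ht hm)) (by linarith)
      (r := 320 / p ^ 2) (by positivity)]
    with d e1 e2 e3 e4 e5 e6 e7 y Z hZ
  have hnoisy := hZ.isNoisy
  refine ⟨hnoisy.nonempty_minority, hnoisy.nonempty_majority, fun β β₀ κ z hκ hz => ?_⟩
  obtain ⟨L, hLdef⟩ : ∃ L, L = noiseLevel d (n d * π d) := ⟨_, rfl⟩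
  obtain ⟨t, htdef⟩ : ∃ t, t = (d : ℝ) ^ ε := ⟨_, rfl⟩
  obtain ⟨m, hmdef⟩ : ∃ m, m = ‖μ d‖ := ⟨_, rfl⟩
  have hm0 := norm_nonneg (μ d)
  rw [← hmdef] at e3 e4 e5 e7 hm0
  rw [← hLdef] at e2 e3 e4 e5 e6 e7 hZ hnoisy
  rw [← htdef] at e1 e2 e4 e5 e6 e7 hZ hnoisy
  rw [one_mul] at e1
  have ht0 : 0 < t := zero_lt_one.trans_le e1
  have hl := hnoisy.pos
  have hL : 0 < L := by linarith
  have hτd := hτ d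
  have hκ0 : 0 ≤ κ := by
    have h1 := hκ.le_gap_of_isNoisy hτd hnoisy
    have h2 := hnoisy.le_average
    by_contra hneg
    have := mul_neg_of_pos_of_neg (show 0 < 1 + τ d by linarith) (not_le.1 hneg)
    linarith
  have hinner : inner ℝ (μ d) β ≤ 2 := by
    have h1 := hκ.inner_signal_le hτd hnoisy e1
    rw [← hmdef] at h1
    have h2 : (2 * m ^ 2 + t * m) / (2 / 5 * L) ≤ 1 := by
      rw [div_le_one hl]
      linarith
    have h3 : m * √(64 * t / (2 / 5 * L)) ≤ 1 := by
      refine (sq_le_sq₀ (by positivity) zero_le_one).1 ?_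
      rw [mul_pow, Real.sq_sqrt (by positivity), ← mul_div_assoc, one_pow, div_le_one hl]
      linarith
    linarith
  -- The radius `p / (2 t)` makes the error `2 t r / p` equal to one. It requires `t ^ 3` and `t ^ 2
  -- ‖μ‖` to be small compared with `L`, hence the division by three in the choice of `ε`.
  have hdir : ‖β - ‖∑ i ∈ minorityIdx y, Z i‖⁻¹ • ∑ i ∈ minorityIdx y, Z i‖ ≤ p / (2 * t) := by
    refine (sq_le_sq₀ (norm_nonneg _) (by positivity)).1
      ((hκ.norm_sub_direction_le hτd hnoisy e1).trans ?_)
    rw [← hmdef, div_pow, div_le_div_iff₀ hl (by positivity)]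
    rw [div_mul_eq_mul_div, div_le_iff₀ (by positivity)] at e6 e7
    linarith
  have h1 := hκ.logit_add_le_of_exceed hκ0 hp ht0.le hnoisy.nonempty_majority hnoisy.norm_sum_pos
    hdir hZ.le_sum hZ.norm_sum_le z
  have h2 : 2 * t * (p / (2 * t)) / p = 1 := by field_simp
  rw [h2] at h1
  linarith

end Regimes

end HighImbalance

/-! ### The phase transition, assembled from the regimes. -/

theorem mainTheorem3 (a b c : ℝ) (ha : 0 < a) (hb : 0 < b) (hc : 0 < c) (hac : a - c < 1)
    (C : ℝ≥0) (n : ℕ → ℕ) (π : ℕ → ℝ) (μ : (d : ℕ) → EuclideanSpace ℝ (Fin d))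
    (ν : (d : ℕ) → Fin d → Measure ℝ)
    (hπ : ∀ d, 0 < π d ∧ π d < 1)
    (hν : ∀ d, HighImbalance.IsSubGaussianNoise C (ν d))
    (himb : HighImbalance.IsImbalanced a b c π μ n)
    (τ : ℕ → ℝ) (hτ : ∀ d, 0 < τ d)
    (svm : (d : ℕ) → (Fin (n d) → HighImbalance.Point d) → EuclideanSpace ℝ (Fin d) × ℝ)
    (hsvm : ∀ d, HighImbalance.IsSVM (τ d) (svm d)) :
    -- high signal
    (a - c < b →
      (∀ᶠ d in atTop, 1 ≤ τ d) → τ =o[atTop] (fun d : ℕ => (d : ℝ) ^ (b / 2)) →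
        Tendsto (fun d => HighImbalance.errPlus (π d) (μ d) (ν d) (svm d)) atTop (𝓝 0) ∧
        Tendsto (fun d => HighImbalance.errMinus (π d) (μ d) (ν d) (svm d)) atTop (𝓝 0)) ∧
    -- moderate signal
    (b < a - c → a - c < 2 * b →
      ((fun d : ℕ => (d : ℝ) ^ (a - b - c)) =o[atTop] τ →
        τ =o[atTop] (fun d : ℕ => (d : ℝ) ^ ((a - c) / 2)) →
          Tendsto (fun d => HighImbalance.errPlus (π d) (μ d) (ν d) (svm d)) atTop (𝓝 0) ∧
          Tendsto (fun d => HighImbalance.errMinus (π d) (μ d) (ν d) (svm d)) atTop (𝓝 0)) ∧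
      (τ =Θ[atTop] (fun _ : ℕ => (1 : ℝ)) →
          Tendsto (fun d => HighImbalance.errPlus (π d) (μ d) (ν d) (svm d)) atTop (𝓝 1) ∧
          Tendsto (fun d => HighImbalance.errMinus (π d) (μ d) (ν d) (svm d)) atTop (𝓝 0))) ∧
    -- low signal
    (2 * b < a - c →
      ∀ ε > 0, ∀ᶠ d in atTop,
        1 / 2 - ε ≤ HighImbalance.errBal (π d) (μ d) (ν d) (svm d)) := by
  have hone : (fun _ : ℕ => (1 : ℝ)) = fun d : ℕ => (d : ℝ) ^ (0 : ℝ) := by simp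
  refine ⟨fun h hτ1 hτb => ⟨?_, ?_⟩, fun h1 h2 => ⟨fun hτa hτb => ⟨?_, ?_⟩, fun hτc => ⟨?_, ?_⟩⟩,
    fun h ε hε => ?_⟩
  · exact (himb.minority_of_high_signal ha hb hc hac hπ hν hτ h hτ1).tendsto_errPlus_zero hπ hν hsvm
  · exact (himb.majority_of_high_signal ha hb hc hac hπ hν hτ hτb).tendsto_errMinus_zero hπ hν hsvm
  · exact (himb.minority_of_moderate_signal ha hb hc hac hπ hν hτ h1 h2 hτa).tendsto_errPlus_zero
      hπ hν hsvm
  · exact (himb.majority_of_noisy ha hb hc hac hπ hν hτ h1 hτb).tendsto_errMinus_zero hπ hν hsvm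
  · exact (himb.minority_of_bounded_ratio ha hb hc hac hπ hν hτ h1
      (hone ▸ hτc.1)).tendsto_errPlus_one hπ hν hsvm
  · exact (himb.majority_of_noisy ha hb hc hac hπ hν hτ h1 (hτc.1.trans_isLittleO
      (hone ▸ HighImbalance.isLittleO_rpow_rpow (half_pos (hb.trans h1))))).tendsto_errMinus_zero
      hπ hν hsvm
  -- The minority error alone tends to one, and the majority error is only used through its
  -- nonnegativity.
  · have hlim := (himb.minority_of_low_signal ha hb hc hac hπ hν hτ h).tendsto_errPlus_one
      hπ hν hsvm
    filter_upwards [hlim.eventually_const_lt (show 1 - ε < 1 by linarith)] with d hd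
    have : 0 ≤ HighImbalance.errMinus (π d) (μ d) (ν d) (svm d) := measureReal_nonneg
    rw [HighImbalance.errBal]
    linarith
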